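/- **Setting.** A principal sells $k\ge 1$ identical units to $n$ unit-demand agents whose values $v_i\ge 0$ are drawn independently from distributions $F_i$; $F=(F_1,\dots,F_n)$ is the instance. Let ${\rm OPT}(F)$ be the supremum of the expected revenue over all mechanisms (allocation rule with $x_i\in[0,1]$ and $\sum_i x_i\le k$, and payment rule) that are Bayesian incentive compatible and interim individually rational. Let ${\rm AP}(F)=\sup_{p\ge 0}\, p\cdot \mathbb E[\min(k,\#\{i: v_i\ge p\})]$ be the optimal revenue of anonymous pricing, and call ${\rm OPT}(F)/{\rm AP}(F)$ (with $0/0=0$) the approximation ratio. For the value $v_i(q)=\inf\{v\ge 0: F_i(v)\ge 1-q\}$ of quantile $q$, let $R_i(q)=q\,v_i(q)$ be the revenue curve. The instance is $\varepsilon$-large if $\sup_{q\in[0,1]}R_i(q)\le \varepsilon\cdot{\rm OPT}(F)$ for every agent $i$. A distribution $F_i$ is quasi-regular if the conditional expected virtual value $\mathbb E[\phi(z)\mid z\le v]=\frac1{F_i(v)}\big(\int_{[0,v]}x\,dF_i(x)-\int_0^v(1-F_i(x))\,dx\big)$ is weakly increasing in $v$ on $\{F_i(v)>0\}$. It is triangular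 if for some $r>0$, $q\in[0,1]$ its distribution function is $1$ for $v\ge r/q$ and $1-\frac{1}{1+\frac vr(1-q)}$ for $0\le v<r/q$ (with $r/0=+\infty$). Write $\ell_k=\log k$ for $k\ge2$ and $\ell_1=\log 2$. **Proposition.** 1. There is a constant $\gamma>0$ such that for all $k\ge1$ and all $k$-unit instances $F$ with quasi-regular distributions, ${\rm OPT}(F)\le \gamma\,\ell_k\,{\rm AP}(F)$. 2. Let $k\ge 1$ and let $\gamma$ be any constant for which the bound in (1) holds for all $k$-unit instances with quasi-regular distributions. Let $0<\varepsilon<\frac{1}{\gamma k\ell_k}$, and let $F$ be a $k$-unit instance with quasi-regular distributions that is $\varepsilon$-large. Then there is an $\varepsilon$-large $k$-unit instance $\hat F$ with at least one agent, all of whose distributions are triangular, such that $$\frac{{\rm OPT}(F)}{{\rm AP}(F)}\;\le\;\frac{1+\varepsilon\gamma k\ell_k}{(1-\varepsilon\gamma k\ell_k)^2}\cdot\frac{{\rm OPT}(\hat F)}{{\rm AP}(\hat F)} .$$ 3. Consequently triangular distributions are the worst case in the limit: for every $k\ge1$, as $\varepsilon\to0^+$, the supremum of the approximation ratio over $\varepsilon$-large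 $k$-unit instances with quasi-regular distributions and the supremum over $\varepsilon$-large $k$-unit instances with triangular distributions converge to the same finite limit. -/

import Mathlib

open MeasureTheory ProbabilityTheory Filter Topology Set
open scoped ENNReal

noncomputable section

namespace AnonPricing

/-- A value distribution: a Borel probability measure on the line carried by `[0, ∞)`. -/
structure ValueDist where
  law : Measure ℝ
  isProb : IsProbabilityMeasure law
  nonneg : law (Iio 0) = 0

attribute [instance] ValueDist.isProb

/-- The cumulative distribution function `F(v) = Pr[z ≤ v]`. -/
def ValueDist.cdf (D : ValueDist) (v : ℝ) : ℝ := ProbabilityTheory.cdf D.law v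

/-- The value of quantile `q`: `v(q) = inf {v ≥ 0 : F(v) ≥ 1 - q}`. -/
def ValueDist.valueAt (D : ValueDist) (q : ℝ) : ℝ := sInf {v : ℝ | 0 ≤ v ∧ 1 - q ≤ D.cdf v}

/-- The revenue curve in quantile space, `R(q) = q · v(q)`. -/
def ValueDist.revenueCurve (D : ValueDist) (q : ℝ) : ℝ := q * D.valueAt q

/-- The monopoly revenue `R(q*) = sup_{q ∈ [0,1]} R(q)`. -/
def ValueDist.monopolyRevenue (D : ValueDist) : ℝ≥0∞ :=
  ⨆ q ∈ Icc (0 : ℝ) 1, ENNReal.ofReal (D.revenueCurve q)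

/-- The conditional expected virtual value `E[φ(z) | z ≤ v]`, where `φ(x) = x - (1 - F(x)) / f(x)`.
Since `φ(x) dF(x) = x dF(x) - (1 - F(x)) dx`, the numerator `E[φ(z); z ≤ v]` is
`∫_{x ≤ v} x dF(x) - ∫_0^v (1 - F(x)) dx`, which makes sense also without a density.
(The second integral starts at value `0`, of quantile `1`, where the revenue curve is `0`.) -/
def ValueDist.condVirtualValue (D : ValueDist) (v : ℝ) : ℝ :=
  ((∫ x in Iic v, x ∂D.law) - ∫ x in (0 : ℝ)..v, (1 - D.cdf x)) / D.cdf v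

/-- Quasi-regularity: the conditional expected virtual value is weakly increasing in `v`, over all
`v` for which the conditioning event `z ≤ v` has positive probability. -/
def ValueDist.QuasiRegular (D : ValueDist) : Prop :=
  MonotoneOn D.condVirtualValue {v : ℝ | 0 < D.cdf v}

/-- The cumulative distribution function, on `[0, ∞)`, of the triangular distribution with monopoly
revenue `r` and monopoly quantile `q`; for `q = 0` the threshold `r / q` is read as `+∞`. -/
def triCDF (r q v : ℝ) : ℝ :=
  if 0 < q ∧ r / q ≤ v then 1 else 1 - 1 / (1 + v / r * (1 - q))

/-- `D` is a triangular (truncated Pareto) distribution. -/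
def ValueDist.Triangular (D : ValueDist) : Prop :=
  ∃ r q : ℝ, 0 < r ∧ 0 ≤ q ∧ q ≤ 1 ∧ ∀ v : ℝ, 0 ≤ v → D.cdf v = triCDF r q v

/-- The joint law of the agents' independent values. -/
def jointLaw {n : ℕ} (F : Fin n → ValueDist) : Measure (Fin n → ℝ) :=
  Measure.pi fun i => (F i).law

/-- A `k`-unit (direct revelation) mechanism for the instance `F`: an allocation rule and a payment
rule, feasible, Bayesian incentive compatible and interim individually rational. The expectation
over `v₋ᵢ` given that agent `i` reports `t` is the integral over all of `v` with the `i`-th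
coordinate overwritten by `t`. Measurability and integrability make all expectations meaningful. -/
structure Mechanism (k : ℕ) {n : ℕ} (F : Fin n → ValueDist) where
  alloc : (Fin n → ℝ) → Fin n → ℝ
  pay : (Fin n → ℝ) → Fin n → ℝ
  measurable_alloc : Measurable alloc
  measurable_pay : Measurable pay
  alloc_mem : ∀ v i, alloc v i ∈ Icc (0 : ℝ) 1
  alloc_sum_le : ∀ v, ∑ i, alloc v i ≤ (k : ℝ)
  integrable_pay : ∀ i, Integrable (fun v => pay v i) (jointLaw F)
  integrable_interim_pay : ∀ i, ∀ t : ℝ, 0 ≤ t →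
    Integrable (fun v => pay (Function.update v i t) i) (jointLaw F)
  incentive_compatible : ∀ i, ∀ s t : ℝ, 0 ≤ s → 0 ≤ t →
    (∫ v, (s * alloc (Function.update v i t) i - pay (Function.update v i t) i) ∂jointLaw F) ≤
      ∫ v, (s * alloc (Function.update v i s) i - pay (Function.update v i s) i) ∂jointLaw F
  individually_rational : ∀ i, ∀ s : ℝ, 0 ≤ s →
    0 ≤ ∫ v, (s * alloc (Function.update v i s) i - pay (Function.update v i s) i) ∂jointLaw F

/-- The expected revenue of a mechanism. -/
def Mechanism.revenue {k n : ℕ} {F : Fin n → ValueDist} (M : Mechanism k F) : ℝ :=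
  ∫ v, ∑ i, M.pay v i ∂jointLaw F

/-- The optimal revenue. (It is nonnegative: never selling is a mechanism.) -/
def OPT (k : ℕ) {n : ℕ} (F : Fin n → ValueDist) : ℝ≥0∞ :=
  ⨆ M : Mechanism k F, ENNReal.ofReal M.revenue

/-- The number of units sold at anonymous price `p` when the values are `v`: whatever the order of
the offers, agents with value at least `p` buy until the `k` units run out. -/
def sales (k : ℕ) {n : ℕ} (p : ℝ) (v : Fin n → ℝ) : ℕ :=
  min k (Finset.univ.filter fun i => p ≤ v i).card

/-- The expected revenue of anonymous pricing at price `p`. -/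
def APat (k : ℕ) {n : ℕ} (p : ℝ) (F : Fin n → ValueDist) : ℝ :=
  ∫ v, p * (sales k p v : ℝ) ∂jointLaw F

/-- The optimal revenue of anonymous pricing. -/
def AP (k : ℕ) {n : ℕ} (F : Fin n → ValueDist) : ℝ≥0∞ :=
  ⨆ p ∈ Ici (0 : ℝ), ENNReal.ofReal (APat k p F)

/-- The approximation ratio of anonymous pricing. -/
def ratio (k : ℕ) {n : ℕ} (F : Fin n → ValueDist) : ℝ≥0∞ := OPT k F / AP k F

/-- `ε`-large markets: every agent's monopoly revenue is at most `ε · OPT(F)`. -/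
def IsLarge (k : ℕ) (ε : ℝ) {n : ℕ} (F : Fin n → ValueDist) : Prop :=
  ∀ i, (F i).monopolyRevenue ≤ ENNReal.ofReal ε * OPT k F

/-- `log k`, with `log 2` in place of `log 1 = 0` when `k = 1`. -/
def logUnits (k : ℕ) : ℝ := Real.log (max k 2 : ℕ)

/-- In `k`-unit instances with quasi-regular distributions, the gap between the optimal revenue and
anonymous pricing is at most `γ · log k`. -/
def GapBound (k : ℕ) (γ : ℝ) : Prop :=
  ∀ (n : ℕ) (F : Fin n → ValueDist), (∀ i, (F i).QuasiRegular) →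
    OPT k F ≤ ENNReal.ofReal (γ * logUnits k) * AP k F

/-- The worst-case approximation ratio of anonymous pricing over all `ε`-large `k`-unit instances
whose distributions all satisfy `P`. -/
def worstRatio (k : ℕ) (P : ValueDist → Prop) (ε : ℝ) : ℝ≥0∞ :=
  ⨆ (n : ℕ) (F : Fin n → ValueDist) (_ : ∀ i, P (F i)) (_ : IsLarge k ε F), ratio k F

end AnonPricing

end

open AnonPricing

/-! ### Quasi-regularity in terms of posted-price revenue -/

namespace AnonPricing

/-! Quasi-regularity says that the revenue `p * tail p` of a price, divided by the probability `1 -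
tail p` of not selling, decreases in `p` (`QuasiRegular.odds_le`). Triangular distributions have
this quotient constant up to their monopoly price. In particular, if a value is at least `p` with
probability at most `δ`, no price above `p` earns more than `p * tail p / (1 - δ)`.

Upper bounds on the optimal revenue come from weak duality (`Mechanism.revenue_le`). By the envelope
formula an interim payment rule is dominated by a mixture of posted prices. Hence nonnegative
functions `ψ i` and constants `A i` with `t * P(H) ≤ ∫_H ψ i + A i` for all upper sets `H ⊆ [t, ∞)`
bound the revenue by `∑ A i` plus the expected surplus for the virtual values `ψ i`. Lower bounds
come from sequential posted prices in decreasing order (`le_OPT_of_levels`). Both bounds, and the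
revenue of anonymous pricing, are expectations of `min k N` for sums `N` of independent Bernoulli
variables (`bern`), compared through monotonicity and concavity.

For the logarithmic gap the dual is a constant virtual value of order `AP / k`. Prices above it are
charged to about `log k` dyadic levels, at each of which anonymous pricing limits the total demand,
and quasi-regularity covers the prices above the last level.

For the triangular approximation, prices below `a = AP / k` earn at most `AP` in any instance, so
only prices above `a` have to be compared. In an `ε`-large market the gap bound makes each agent's
value reach `a` with probability at most `δ = εγkℓ_k`. On a fine geometric grid of prices, the
Lagrangian hull of an agent's revenue curve assigns to each level an optimal sales event. The
increment of its quantile from one level to the next is replaced by many tiny triangular agents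
whose monopoly price is that level. After a slight thinning, the acceptances of the tiny agents
dominate those of the agent at every level, which keeps the optimal revenue up to `1 + δ`. At an
anonymous price `p ≥ a` their total demand is at most the sum of their monopoly revenues divided by
`p`. These revenues telescope to the revenue of one price above `p` (`sum_rate_le`), which
quasi-regularity bounds; the loss is `(1 - δ)^2`.

In the limit, both worst ratios are monotone in `ε` and differ by a factor tending to `1`. -/

/-- The probability that the value is at least `p`. -/
noncomputable def ValueDist.tail (D : ValueDist) (p : ℝ) : ℝ := D.law.real (Ici p)

lemma mul_le_of_forall_lt {a T c b : ℝ} (haT : a < T)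
    (h : ∀ x, a < x → x < T → x * c ≤ b) : T * c ≤ b := by
  have h1 : Tendsto (fun x : ℝ => x * c) (𝓝[<] T) (𝓝 (T * c)) :=
    ((continuous_id.mul continuous_const).tendsto T).mono_left nhdsWithin_le_nhds
  refine le_of_tendsto h1 ?_
  filter_upwards [Ioo_mem_nhdsLT haT] with x hx using h x hx.1 hx.2

namespace ValueDist

lemma tail_nonneg (D : ValueDist) (p : ℝ) : 0 ≤ D.tail p := measureReal_nonneg

lemma tail_le_one (D : ValueDist) (p : ℝ) : D.tail p ≤ 1 := measureReal_le_one

lemma tail_anti (D : ValueDist) : Antitone D.tail := fun _ _ h =>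
  measureReal_mono (Ici_subset_Ici.2 h)

lemma cdf_eq (D : ValueDist) (v : ℝ) : D.cdf v = D.law.real (Iic v) :=
  ProbabilityTheory.cdf_eq_real _ _

lemma cdf_mono (D : ValueDist) : Monotone D.cdf := monotone_cdf D.law

lemma cdf_nonneg (D : ValueDist) (v : ℝ) : 0 ≤ D.cdf v := ProbabilityTheory.cdf_nonneg _ _

lemma cdf_le_one (D : ValueDist) (v : ℝ) : D.cdf v ≤ 1 := ProbabilityTheory.cdf_le_one _ _

lemma one_sub_cdf (D : ValueDist) (v : ℝ) : 1 - D.cdf v = D.law.real (Ioi v) := by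
  rw [cdf_eq, ← compl_Iic, probReal_compl_eq_one_sub measurableSet_Iic]

lemma one_sub_tail (D : ValueDist) (v : ℝ) : 1 - D.tail v = D.law.real (Iio v) := by
  rw [tail, ← compl_Ici, probReal_compl_eq_one_sub measurableSet_Ici]

lemma ae_nonneg (D : ValueDist) : ∀ᵐ x ∂D.law, 0 ≤ x := by
  rw [ae_iff]
  convert D.nonneg using 2
  ext x; simp

lemma cdf_of_neg (D : ValueDist) {v : ℝ} (hv : v < 0) : D.cdf v = 0 := by
  rw [cdf_eq, measureReal_def, measure_mono_null _ D.nonneg]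
  · simp
  · exact fun x hx => lt_of_le_of_lt hx hv

lemma setIntegral_Iic_id (D : ValueDist) {v : ℝ} (hv : 0 ≤ v) :
    ∫ x in Iic v, x ∂D.law = ∫ t in (0 : ℝ)..v, (D.cdf v - D.cdf t) := by
  have h1 : ∫ x in Iic v, x ∂D.law = ∫ x in Iic v, max x 0 ∂D.law := by
    apply integral_congr_ae
    filter_upwards [ae_restrict_of_ae D.ae_nonneg] with x hx
    simp [hx]
  have hint : Integrable (fun x : ℝ => max x 0) (D.law.restrict (Iic v)) := by
    refine Integrable.mono' (integrable_const v) (by fun_prop) ?_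
    filter_upwards [ae_restrict_mem measurableSet_Iic] with x hx
    rw [Real.norm_of_nonneg (le_max_right _ _)]
    exact max_le hx hv
  rw [h1, hint.integral_eq_integral_meas_lt (Eventually.of_forall fun x => le_max_right _ _),
    intervalIntegral.integral_of_le hv]
  have hset : ∀ t, 0 < t → (D.law.restrict (Iic v)).real {a | t < max a 0} =
      D.law.real (Ioc t v) := by
    intro t ht
    rw [measureReal_restrict_apply (measurableSet_lt measurable_const (by fun_prop))]
    congr 1
    ext x
    simp [ht.not_gt]
  rw [setIntegral_eq_of_subset_of_forall_sdiff_eq_zero measurableSet_Ioi Ioc_subset_Ioi_self]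
  · refine setIntegral_congr_fun measurableSet_Ioc fun t ht => ?_
    rw [hset t ht.1, cdf_eq, cdf_eq, ← Iic_sdiff_Iic, measureReal_sdiff (Iic_subset_Iic.2 ht.2)
      measurableSet_Iic]
  · intro t ht
    rw [hset t ht.1, Ioc_eq_empty]
    · simp
    · intro h
      exact ht.2 ⟨ht.1, h.le⟩

/-- By the layer-cake formula the first integral is `∫_0^v (F(v) - F(t)) dt`. Subtracting `∫_0^v (1
- F(t)) dt` cancels `F(t)` and leaves `-v (1 - F(v))`. -/
theorem condVirtualValue_eq (D : ValueDist) {v : ℝ} (hv : 0 ≤ v) :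
    D.condVirtualValue v = -(v * (1 - D.cdf v)) / D.cdf v := by
  have hi : IntervalIntegrable D.cdf volume 0 v := D.cdf_mono.intervalIntegrable
  rw [condVirtualValue, setIntegral_Iic_id D hv, intervalIntegral.integral_sub (by simp) hi,
    intervalIntegral.integral_sub (by simp) hi]
  simp only [intervalIntegral.integral_const, smul_eq_mul, sub_zero]
  ring_nf

/-- Monotonicity with the denominators cleared. Negative values need no condition, because the
distribution function vanishes there. -/
theorem quasiRegular_iff (D : ValueDist) : D.QuasiRegular ↔
    ∀ s t, 0 ≤ s → s ≤ t → 0 < D.cdf s →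
      t * (1 - D.cdf t) * D.cdf s ≤ s * (1 - D.cdf s) * D.cdf t := by
  have key : ∀ s t, 0 ≤ s → s ≤ t → 0 < D.cdf s →
      (D.condVirtualValue s ≤ D.condVirtualValue t ↔
        t * (1 - D.cdf t) * D.cdf s ≤ s * (1 - D.cdf s) * D.cdf t) := by
    intro s t hs hst h
    have ht : 0 < D.cdf t := h.trans_le (D.cdf_mono hst)
    rw [condVirtualValue_eq D hs, condVirtualValue_eq D (hs.trans hst), div_le_div_iff₀ h ht]
    constructor <;> intro h <;> linarith
  constructor
  · intro h s t hs hst h0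
    exact (key s t hs hst h0).1 (h h0 (h0.trans_le (D.cdf_mono hst)) hst)
  · intro h s hs t ht hst
    have h0 : 0 ≤ s := by
      by_contra hneg
      rw [mem_ofPred_eq, D.cdf_of_neg (not_le.1 hneg)] at hs
      exact lt_irrefl _ hs
    exact (key s t h0 hst hs).2 (h s t h0 hst hs)

/-- In a quasi-regular distribution the revenue of a price, divided by the probability of not
selling, is weakly decreasing. -/
theorem QuasiRegular.odds_le {D : ValueDist} (h : D.QuasiRegular) {p t : ℝ} (hp : 0 < p)
    (hpt : p ≤ t) : t * D.tail t * (1 - D.tail p) ≤ p * D.tail p * (1 - D.tail t) := by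
  rcases hpt.eq_or_lt with rfl | hpt
  · rfl
  have ht1 := D.tail_le_one t
  -- `1 - cdf` excludes an atom that `tail` includes, so the criterion is applied at `p' < p` and
  -- `t' < t`, followed by the limits `t' ↑ t` and `p' ↑ p`.
  have h1 : ∀ p' < p, 0 ≤ p' → D.cdf p' * (t * D.tail t + p * (1 - D.tail t)) ≤
      p * (1 - D.tail t) := by
    intro p' hp' h0
    have h6 := D.cdf_le_one p'
    have h7 : 0 ≤ p' * (1 - D.cdf p') := mul_nonneg h0 (by linarith)
    have h8 : p' * (1 - D.cdf p') ≤ p * (1 - D.cdf p') := by gcongr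
    have h2 : ∀ t', p < t' → t' < t →
        t' * (D.tail t * D.cdf p') ≤ p * (1 - D.cdf p') * (1 - D.tail t) := by
      intro t' hpt' ht'
      have ht0 : 0 ≤ t' := hp.le.trans hpt'.le
      rcases (D.cdf_nonneg p').eq_or_lt with hz | hz
      · rw [← hz, mul_zero, mul_zero]
        exact mul_nonneg (mul_nonneg hp.le (by simp)) (by linarith)
      have h3 := (D.quasiRegular_iff).1 h p' t' h0 (hp'.le.trans hpt'.le) hz
      have h4 : D.tail t ≤ 1 - D.cdf t' := by
        rw [one_sub_cdf]; exact measureReal_mono (fun x hx => ht'.trans_le hx)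
      calc t' * (D.tail t * D.cdf p') = t' * D.tail t * D.cdf p' := by ring
        _ ≤ t' * (1 - D.cdf t') * D.cdf p' := by gcongr
        _ ≤ p' * (1 - D.cdf p') * D.cdf t' := h3
        _ ≤ p' * (1 - D.cdf p') * (1 - D.tail t) := by gcongr; linarith
        _ ≤ p * (1 - D.cdf p') * (1 - D.tail t) :=
            mul_le_mul_of_nonneg_right h8 (by linarith)
    have := mul_le_of_forall_lt hpt h2
    linarith
  have h2 : D.law.real (Iio p) * (t * D.tail t + p * (1 - D.tail t)) ≤ p * (1 - D.tail t) := by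
    obtain ⟨u, hu, hup, hulim⟩ := exists_seq_strictMono_tendsto p
    have hU : ⋃ n, Iic (u n) = Iio p := iUnion_Iic_eq_Iio_of_lt_of_tendsto hup hulim
    have hm : Monotone fun n => Iic (u n) := fun a b hab => Iic_subset_Iic.2 (hu.monotone hab)
    have hlim := tendsto_measure_iUnion_atTop (μ := D.law) hm
    rw [hU] at hlim
    have hlim' : Tendsto (fun n => D.cdf (u n)) atTop (𝓝 (D.law.real (Iio p))) := by
      simp_rw [cdf_eq]
      exact (ENNReal.tendsto_toReal (measure_ne_top _ _)).comp hlim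
    refine le_of_tendsto (hlim'.mul_const _) ?_
    filter_upwards [hulim.eventually_const_le hp] with n hn using h1 _ (hup n) hn
  rw [← one_sub_tail] at h2
  linarith

/-- In a quasi-regular distribution the revenue of a price `t` is controlled by that of any lower
price. -/
theorem QuasiRegular.tail_le {D : ValueDist} (h : D.QuasiRegular) {p t : ℝ} (hp : 0 < p)
    (hpt : p ≤ t) : t * D.tail t * (1 - D.tail p) ≤ p * D.tail p := by
  have h1 := h.odds_le hp hpt
  have h2 := mul_nonneg (mul_nonneg hp.le (D.tail_nonneg p)) (D.tail_nonneg t)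
  linarith

/-- The revenue of every price is at most the monopoly revenue. -/
theorem mul_tail_le_monopolyRevenue (D : ValueDist) (t : ℝ) :
    ENNReal.ofReal (t * D.tail t) ≤ D.monopolyRevenue := by
  by_cases htop : D.monopolyRevenue = ⊤
  · rw [htop]; exact le_top
  rcases (D.tail_nonneg t).eq_or_lt with h0 | h0
  · rw [← h0]; simp
  -- A quantile strictly below `tail t` has value at least `t`; then `q ↑ tail t`.
  have key : ∀ q, 0 < q → q < D.tail t → q * t ≤ D.monopolyRevenue.toReal := by
    intro q hq hqt
    have hq1 : q ≤ 1 := hqt.le.trans (D.tail_le_one t)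
    have hv : t ≤ D.valueAt q := by
      apply le_csInf
      · obtain ⟨v, hv, hv0⟩ := (((tendsto_cdf_atTop D.law).eventually_const_le
          (show 1 - q < 1 by linarith)).and (eventually_ge_atTop 0)).exists
        exact ⟨v, hv0, hv⟩
      · rintro v ⟨hv0, hv⟩
        by_contra hlt
        have : D.cdf v ≤ 1 - D.tail t := by
          rw [one_sub_tail, cdf_eq]
          exact measureReal_mono (fun x hx => lt_of_le_of_lt hx (not_le.1 hlt))
        linarith
    have h1 : ENNReal.ofReal (D.revenueCurve q) ≤ D.monopolyRevenue :=
      le_iSup₂_of_le q ⟨hq.le, hq1⟩ le_rfl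
    refine (mul_le_mul_of_nonneg_left hv hq.le).trans ?_
    exact (ENNReal.ofReal_le_iff_le_toReal htop).1 h1
  rw [ENNReal.ofReal_le_iff_le_toReal htop, mul_comm]
  exact mul_le_of_forall_lt h0 key

theorem tendsto_tail (D : ValueDist) : Tendsto D.tail atTop (𝓝 0) := by
  have h1 : Tendsto (fun t => 1 - D.cdf (t - 1)) atTop (𝓝 (1 - 1)) :=
    tendsto_const_nhds.sub ((tendsto_cdf_atTop D.law).comp (tendsto_atTop_add_const_right _ _ tendsto_id))
  rw [sub_self] at h1
  refine squeeze_zero (fun t => D.tail_nonneg t) (fun t => ?_) h1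
  rw [one_sub_cdf]
  exact measureReal_mono (fun x hx => (sub_one_lt t).trans_le hx)

end ValueDist
-- Resampling one agent's value
instance {n : ℕ} (F : Fin n → ValueDist) : IsProbabilityMeasure (jointLaw F) := by
  unfold jointLaw; infer_instance

/-- Resampling one coordinate of a product measure preserves it. -/
theorem measurePreserving_update {n : ℕ} (F : Fin n → ValueDist) (i : Fin n) :
    MeasurePreserving (fun z : ℝ × (Fin n → ℝ) => Function.update z.2 i z.1)
      ((F i).law.prod (jointLaw F)) (jointLaw F) := by
  have hm : Measurable (fun z : ℝ × (Fin n → ℝ) => Function.update z.2 i z.1) := by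
    refine measurable_pi_lambda _ fun j => ?_
    by_cases h : j = i
    · subst h; simpa using measurable_fst
    · simp only [Function.update_of_ne h]
      exact (measurable_pi_apply j).comp measurable_snd
  refine ⟨hm, ?_⟩
  symm
  refine Measure.pi_eq fun s hs => ?_
  rw [Measure.map_apply hm (MeasurableSet.univ_pi hs)]
  have : (fun z : ℝ × (Fin n → ℝ) => Function.update z.2 i z.1) ⁻¹' (univ.pi s) =
      s i ×ˢ univ.pi (Function.update s i univ) := by
    ext ⟨t, v⟩
    simp only [mem_preimage, mem_univ_pi, mem_prod]
    constructor
    · intro h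
      refine ⟨by simpa using h i, fun j => ?_⟩
      by_cases hj : j = i
      · subst hj; simp
      · simpa [hj] using h j
    · rintro ⟨h1, h2⟩ j
      by_cases hj : j = i
      · subst hj; simpa using h1
      · simpa [hj] using h2 j
  rw [this, Measure.prod_prod, jointLaw, Measure.pi_pi,
    ← Finset.mul_prod_erase _ _ (Finset.mem_univ i), ← Finset.mul_prod_erase (a := i) Finset.univ
      (fun j => (F j).law (s j)) (Finset.mem_univ i)]
  simp only [Function.update_self, measure_univ, one_mul]
  congr 1
  refine Finset.prod_congr rfl fun j hj => ?_
  rw [Function.update_of_ne (Finset.ne_of_mem_erase hj)]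

/-- Converts ex ante expectations into averages of interim ones, in the overwritten-coordinate form
in which `Mechanism` states its incentive constraints. -/
theorem integral_update {n : ℕ} (F : Fin n → ValueDist) (i : Fin n) {f : (Fin n → ℝ) → ℝ}
    (hf : Integrable f (jointLaw F)) :
    ∫ v, f v ∂jointLaw F = ∫ t, ∫ v, f (Function.update v i t) ∂jointLaw F ∂(F i).law := by
  have h := measurePreserving_update F i
  have h1 : ∫ v, f v ∂jointLaw F = ∫ z, f (Function.update z.2 i z.1) ∂((F i).law.prod (jointLaw F)) := by
    conv_lhs => rw [← h.map_eq]
    rw [integral_map h.measurable.aemeasurable]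
    rw [h.map_eq]; exact hf.1
  rw [h1, integral_prod]
  exact h.integrable_comp_of_integrable hf

theorem integrable_update {n : ℕ} (F : Fin n → ValueDist) (i : Fin n) {f : (Fin n → ℝ) → ℝ}
    (hf : Integrable f (jointLaw F)) :
    Integrable (fun t => ∫ v, f (Function.update v i t) ∂jointLaw F) (F i).law :=
  ((measurePreserving_update F i).integrable_comp_of_integrable hf).integral_prod_left

/-! ### Weak duality for the optimal revenue -/

/-- Layer-cake form of the single-agent revenue bound: the payment that the envelope formula assigns
to a monotone allocation rule is a mixture of posted prices. -/
theorem lintegral_envelope_le (D : ValueDist) {X ψ : ℝ → ℝ} {A : ℝ} (hXm : Monotone X)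
    (hX0 : ∀ t, 0 ≤ X t) (hX1 : ∀ t, X t ≤ 1) (hXneg : ∀ t < 0, X t = 0)
    (hψ : Integrable ψ D.law) (hψm : Measurable ψ) (hψ0 : ∀ t, 0 ≤ ψ t) (hA : 0 ≤ A)
    (hdual : ∀ (t : ℝ) (H : Set ℝ), 0 ≤ t → IsUpperSet H → MeasurableSet H → H ⊆ Ici t →
      t * D.law.real H ≤ ∫ x in H, ψ x ∂D.law + A) :
    ∫⁻ v, ENNReal.ofReal (v * X v - ∫ z in (0 : ℝ)..v, X z) ∂D.law ≤
      ∫⁻ v, ENNReal.ofReal (ψ v * X v) ∂D.law + ENNReal.ofReal A := by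
  have hX := hXm.measurable
  let I1 : ℝ × ℝ → ℝ≥0∞ := indicator {p | X p.1 < p.2} 1
  let I2 : ℝ × ℝ → ℝ≥0∞ := indicator {p | p.2 ≤ X p.1} 1
  have hI1 : Measurable I1 := measurable_one.indicator
    (measurableSet_lt (hX.comp measurable_fst) measurable_snd)
  have hI2 : Measurable I2 := measurable_one.indicator
    (measurableSet_le measurable_snd (hX.comp measurable_fst))
  have hI1l : ∀ y, Measurable fun z => I1 (z, y) := fun y => hI1.comp (by fun_prop)
  have hI2l : ∀ y, Measurable fun v => I2 (v, y) := fun y => hI2.comp (by fun_prop)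
  have hI2r : ∀ v, Measurable fun y => I2 (v, y) := fun v => hI2.comp (by fun_prop)
  let ν : Measure ℝ := volume.restrict (Ioc 0 1)
  -- The measure of the positive types with allocation below `y`: the price posted at level `y`,
  -- with `y` uniform on `(0, 1]`. The envelope payment of `v` is the integral of `τ y` over the
  -- levels `y ≤ X v`.
  let τ : ℝ → ℝ≥0∞ := fun y => ∫⁻ z in Ioi (0 : ℝ), I1 (z, y)
  have hτ : Measurable τ := hI1.lintegral_prod_left'
  have step1 : ∀ v, 0 ≤ v → ENNReal.ofReal (v * X v - ∫ z in (0 : ℝ)..v, X z) ≤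
      ∫⁻ y, τ y * I2 (v, y) ∂ν := by
    intro v hv
    have hi : IntervalIntegrable X volume 0 v := hXm.intervalIntegrable
    have e1 : v * X v - ∫ z in (0 : ℝ)..v, X z = ∫ z in Ioc 0 v, (X v - X z) := by
      rw [← intervalIntegral.integral_of_le hv, intervalIntegral.integral_sub (by simp) hi]
      simp
    have e2 : ∀ z, ENNReal.ofReal (X v - X z) ≤ ∫⁻ y, I1 (z, y) * I2 (v, y) ∂ν := by
      intro z
      have : ∀ y, I1 (z, y) * I2 (v, y) = indicator (Ioc (X z) (X v)) 1 y := by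
        intro y
        simp only [I1, I2, indicator_apply, mem_ofPred_eq, mem_Ioc, Pi.one_apply]
        split_ifs <;> simp_all
      simp_rw [this]
      rw [lintegral_indicator_one measurableSet_Ioc, Measure.restrict_apply measurableSet_Ioc,
        inter_eq_left.2 (Ioc_subset_Ioc (hX0 z) (hX1 v)), Real.volume_Ioc]
    rw [e1, ofReal_integral_eq_lintegral_ofReal]
    · calc ∫⁻ z in Ioc 0 v, ENNReal.ofReal (X v - X z)
          ≤ ∫⁻ z in Ioi 0, (∫⁻ y, I1 (z, y) * I2 (v, y) ∂ν) :=
            (lintegral_mono_set Ioc_subset_Ioi_self).trans (lintegral_mono e2)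
        _ = ∫⁻ y, (∫⁻ z in Ioi 0, I1 (z, y) * I2 (v, y)) ∂ν := by
            refine lintegral_lintegral_swap (Measurable.aemeasurable ?_)
            exact hI1.mul (hI2.comp (measurable_const.prodMk measurable_snd))
        _ = ∫⁻ y, τ y * I2 (v, y) ∂ν := by
            refine lintegral_congr fun y => ?_
            rw [lintegral_mul_const _ (hI1l y)]
    · exact ((integrable_const (X v)).sub ((intervalIntegrable_iff_integrableOn_Ioc_of_le hv).1 hi))
    · filter_upwards [ae_restrict_mem measurableSet_Ioc] with z hz
      exact sub_nonneg.2 (hXm hz.2)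
  have step2 : ∀ y, 0 < y → τ y * D.law {v | y ≤ X v} ≤
      ∫⁻ v, ENNReal.ofReal (ψ v) * I2 (v, y) ∂D.law + ENNReal.ofReal A := by
    intro y hy
    set H := {v | y ≤ X v} with hH
    have hup : IsUpperSet H := fun a b hab ha => le_trans ha (hXm hab)
    have hmeas : MeasurableSet H := measurableSet_le measurable_const hX
    have hpos : ∀ h ∈ H, 0 ≤ h := by
      intro h hh
      by_contra hneg
      have h1 : y ≤ X h := hh
      rw [hXneg h (not_le.1 hneg)] at h1
      linarith
    rcases H.eq_empty_or_nonempty with he | hne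
    · rw [he]; simp
    have hbdd : BddBelow H := ⟨0, hpos⟩
    have ht0 : 0 ≤ sInf H := le_csInf hne hpos
    -- Positive types outside the upper set `H` lie below its infimum, so dual feasibility with `t =
    -- sInf H` bounds this level.
    have hτle : τ y ≤ ENNReal.ofReal (sInf H) := by
      have : ∀ z, I1 (z, y) = indicator Hᶜ 1 z := by
        intro z
        simp only [I1, hH, indicator_apply, mem_ofPred_eq, mem_compl_iff, not_le]
        rfl
      simp only [τ, this]
      rw [lintegral_indicator_one hmeas.compl, Measure.restrict_apply hmeas.compl]
      calc volume (Hᶜ ∩ Ioi 0) ≤ volume (Ioc 0 (sInf H)) := by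
            refine measure_mono fun z hz => ⟨hz.2, ?_⟩
            by_contra hlt
            obtain ⟨h, hh, hlt'⟩ := exists_lt_of_csInf_lt hne (not_le.1 hlt)
            exact hz.1 (hup hlt'.le hh)
        _ = ENNReal.ofReal (sInf H) := by simp
    have e3 : ∫⁻ v, ENNReal.ofReal (ψ v) * I2 (v, y) ∂D.law = ENNReal.ofReal (∫ x in H, ψ x ∂D.law) := by
      rw [ofReal_integral_eq_lintegral_ofReal hψ.integrableOn (Eventually.of_forall hψ0),
        ← lintegral_indicator hmeas]
      refine lintegral_congr fun v => ?_
      simp only [I2, hH, indicator_apply, mem_ofPred_eq, Pi.one_apply]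
      split_ifs <;> simp
    rw [e3, ← ENNReal.ofReal_add (setIntegral_nonneg hmeas fun x _ => hψ0 x) hA]
    calc τ y * D.law H ≤ ENNReal.ofReal (sInf H) * D.law H := by gcongr
      _ = ENNReal.ofReal (sInf H * D.law.real H) := by
          rw [ENNReal.ofReal_mul ht0, ofReal_measureReal]
      _ ≤ _ := ENNReal.ofReal_le_ofReal
          (hdual _ H ht0 hup hmeas fun h hh => csInf_le hbdd hh)
  calc ∫⁻ v, ENNReal.ofReal (v * X v - ∫ z in (0 : ℝ)..v, X z) ∂D.law
      ≤ ∫⁻ v, ∫⁻ y, τ y * I2 (v, y) ∂ν ∂D.law := by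
        refine lintegral_mono_ae ?_
        filter_upwards [D.ae_nonneg] with v hv using step1 v hv
    _ = ∫⁻ y, ∫⁻ v, τ y * I2 (v, y) ∂D.law ∂ν :=
        lintegral_lintegral_swap ((hτ.comp measurable_snd).mul hI2).aemeasurable
    _ ≤ ∫⁻ y, (∫⁻ v, ENNReal.ofReal (ψ v) * I2 (v, y) ∂D.law + ENNReal.ofReal A) ∂ν := by
        refine lintegral_mono_ae ?_
        filter_upwards [ae_restrict_mem measurableSet_Ioc] with y hy
        rw [lintegral_const_mul _ (hI2l y)]
        refine le_trans (le_of_eq ?_) (step2 y hy.1)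
        congr 1
        rw [← lintegral_indicator_one (measurableSet_le measurable_const hX)]
        rfl
    _ = ∫⁻ v, ENNReal.ofReal (ψ v * X v) ∂D.law + ENNReal.ofReal A := by
        rw [lintegral_add_right _ measurable_const, lintegral_lintegral_swap]
        · congr 1
          · refine lintegral_congr fun v => ?_
            rw [lintegral_const_mul _ (hI2r v),
              ENNReal.ofReal_mul (hψ0 v)]
            congr 1
            have : ∀ y, I2 (v, y) = indicator (Iic (X v)) 1 y := fun y => rfl
            simp_rw [this]
            rw [lintegral_indicator_one measurableSet_Iic, Measure.restrict_apply measurableSet_Iic,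
              inter_comm, Ioc_inter_Iic, min_eq_right (hX1 v), Real.volume_Ioc, sub_zero]
          · simp [ν]
        · exact ((hψm.ennreal_ofReal.comp measurable_snd).mul
            (hI2.comp measurable_swap)).aemeasurable

/-- The envelope inequality: utility dominates the integral of the allocation. -/
theorem integral_le_of_incentive {X P : ℝ → ℝ} (hX1 : ∀ t, X t ≤ 1) (hX0 : ∀ t, 0 ≤ X t)
    (hm : MonotoneOn X (Ici 0))
    (hIC : ∀ s t, 0 ≤ s → 0 ≤ t → s * X t - P t ≤ s * X s - P s)
    (hIR : 0 ≤ 0 * X 0 - P 0) {v : ℝ} (hv : 0 ≤ v) :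
    ∫ z in (0 : ℝ)..v, X z ≤ v * X v - P v := by
  -- Chaining the incentive constraints along a grid of mesh `v / n` bounds the lower Riemann sum by
  -- the utility. The upper sum exceeds the lower one by at most the mesh, since `0 ≤ X ≤ 1`.
  have key : ∀ n : ℕ, 0 < n → ∫ z in (0 : ℝ)..v, X z ≤ v * X v - P v + v / n := by
    intro n hn
    have hn' : (0 : ℝ) < n := by exact_mod_cast hn
    set h := v / n with hh
    have hh0 : 0 ≤ h := by positivity
    have hnh : h * n = v := by rw [hh]; field_simp
    have h1 : h * ∫ z in (0 : ℝ)..n, X (h * z) = ∫ z in (0 : ℝ)..v, X z := by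
      rw [intervalIntegral.mul_integral_comp_mul_left, mul_zero, hnh]
    have hmono : MonotoneOn (fun z => X (h * z)) (Icc (0 : ℝ) (0 + n)) := by
      intro a ha b hb hab
      exact hm (mul_nonneg hh0 ha.1) (mul_nonneg hh0 hb.1) (mul_le_mul_of_nonneg_left hab hh0)
    have h2 := hmono.integral_le_sum
    simp only [zero_add] at h2
    have h3 : ∀ m : ℕ, ∑ i ∈ Finset.range m, h * X (h * i) ≤
        (h * m) * X (h * m) - P (h * m) := by
      intro m
      induction m with
      | zero => simpa using hIR
      | succ m ih =>
        rw [Finset.sum_range_succ]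
        have := hIC (h * (m + 1 : ℕ)) (h * m) (by positivity) (by positivity)
        push_cast at this ⊢
        linarith
    have h4 : ∑ i ∈ Finset.range n, X (h * ((i + 1 : ℕ) : ℝ)) =
        ∑ i ∈ Finset.range n, X (h * i) + X (h * n) - X (h * 0) := by
      have := Finset.sum_range_succ' (fun i : ℕ => X (h * i)) n
      rw [Finset.sum_range_succ] at this
      push_cast at this ⊢
      linarith
    have h5 := h3 n
    rw [hnh, ← Finset.mul_sum] at h5
    rw [h4] at h2
    rw [← h1]
    have h6 := mul_le_mul_of_nonneg_left h2 hh0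
    have h7 : h * (X (h * n) - X (h * 0)) ≤ h * 1 :=
      mul_le_mul_of_nonneg_left (by linarith [hX1 (h * n), hX0 (h * 0)]) hh0
    linarith
  have hlim : Tendsto (fun n : ℕ => v * X v - P v + v / n) atTop (𝓝 (v * X v - P v + 0)) :=
    tendsto_const_nhds.add (tendsto_const_div_atTop_nhds_zero_nat v)
  rw [add_zero] at hlim
  exact ge_of_tendsto hlim ((eventually_gt_atTop 0).mono key)

/-- The single-agent revenue bound. `X` and `P` are the interim allocation and payment rules of an
incentive compatible and individually rational mechanism; `ψ` is a dual virtual value. -/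
theorem interim_revenue_le (D : ValueDist) {X P ψ : ℝ → ℝ} {A : ℝ}
    (hX0 : ∀ t, 0 ≤ X t) (hX1 : ∀ t, X t ≤ 1)
    (hP : Integrable P D.law) (hψ : Integrable ψ D.law) (hψm : Measurable ψ) (hψ0 : ∀ t, 0 ≤ ψ t)
    (hIC : ∀ s t, 0 ≤ s → 0 ≤ t → s * X t - P t ≤ s * X s - P s)
    (hIR : 0 ≤ 0 * X 0 - P 0) (hA : 0 ≤ A)
    (hdual : ∀ (t : ℝ) (H : Set ℝ), 0 ≤ t → IsUpperSet H → MeasurableSet H → H ⊆ Ici t →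
      t * D.law.real H ≤ ∫ x in H, ψ x ∂D.law + A) :
    ∫ t, P t ∂D.law ≤ ∫ t, ψ t * X t ∂D.law + A := by
  have hm : MonotoneOn X (Ici 0) := by
    intro s hs t ht hst
    rcases hst.eq_or_lt with rfl | hlt
    · rfl
    have h1 := hIC s t hs ht
    have h2 := hIC t s ht hs
    by_contra hcon
    nlinarith [mul_pos (sub_pos.2 hlt) (sub_pos.2 (not_le.1 hcon))]
  -- Incentive constraints concern nonnegative types only. Setting the allocation to zero below `0`
  -- makes it monotone on the whole line and changes nothing almost surely.
  let Y : ℝ → ℝ := indicator (Ici 0) X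
  have hYX : ∀ t, 0 ≤ t → Y t = X t := fun t ht => indicator_of_mem (mem_Ici.2 ht) X
  have hYneg : ∀ t < 0, Y t = 0 := fun t ht => indicator_of_notMem (by simpa using ht) X
  have hY0 : ∀ t, 0 ≤ Y t := fun t => indicator_nonneg (fun _ _ => hX0 _) t
  have hY1 : ∀ t, Y t ≤ 1 := by
    intro t
    rcases le_or_gt 0 t with h | h
    · rw [hYX t h]; exact hX1 t
    · rw [hYneg t h]; exact zero_le_one
  have hYm : Monotone Y := by
    intro s t hst
    rcases le_or_gt 0 s with h | h
    · rw [hYX s h, hYX t (h.trans hst)]; exact hm h (h.trans hst) hst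
    · rw [hYneg s h]; exact hY0 t
  have hψY : Integrable (fun t => ψ t * Y t) D.law :=
    Integrable.mul_bdd (c := 1) hψ hYm.measurable.aestronglyMeasurable
      (Eventually.of_forall fun t => by rw [Real.norm_of_nonneg (hY0 t)]; exact hY1 t)
  have hcore := lintegral_envelope_le D hYm hY0 hY1 hYneg hψ hψm hψ0 hA hdual
  have e1 : ∫ t, ψ t * X t ∂D.law = ∫ t, ψ t * Y t ∂D.law := by
    apply integral_congr_ae
    filter_upwards [D.ae_nonneg] with t ht
    rw [hYX t ht]
  rw [e1]
  have h2 : ∫⁻ t, ENNReal.ofReal (P t) ∂D.law ≤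
      ∫⁻ v, ENNReal.ofReal (v * Y v - ∫ z in (0 : ℝ)..v, Y z) ∂D.law := by
    refine lintegral_mono_ae ?_
    filter_upwards [D.ae_nonneg] with v hv
    apply ENNReal.ofReal_le_ofReal
    have h3 := integral_le_of_incentive hX1 hX0 hm hIC hIR hv
    have h4 : ∫ z in (0 : ℝ)..v, Y z = ∫ z in (0 : ℝ)..v, X z := by
      apply intervalIntegral.integral_congr
      intro z hz
      rw [uIcc_of_le hv] at hz
      exact hYX z hz.1
    rw [h4, hYX v hv]
    linarith
  have h5 : ∫ t, P t ∂D.law ≤ (∫⁻ t, ENNReal.ofReal (P t) ∂D.law).toReal := by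
    rw [integral_eq_lintegral_pos_part_sub_lintegral_neg_part hP]
    linarith [ENNReal.toReal_nonneg (a := ∫⁻ t, ENNReal.ofReal (-P t) ∂D.law)]
  have h6 := h2.trans hcore
  have hn : ∀ t, 0 ≤ ψ t * Y t := fun t => mul_nonneg (hψ0 t) (hY0 t)
  rw [← ofReal_integral_eq_lintegral_ofReal hψY (Eventually.of_forall hn),
    ← ENNReal.ofReal_add (integral_nonneg hn) hA] at h6
  refine h5.trans (ENNReal.toReal_le_of_le_ofReal ?_ h6)
  exact add_nonneg (integral_nonneg hn) hA

/-- The revenue of every mechanism is bounded by a dual virtual surplus. -/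
theorem Mechanism.revenue_le {k n : ℕ} {F : Fin n → ValueDist} (M : Mechanism k F)
    (ψ : Fin n → ℝ → ℝ) (A : Fin n → ℝ) (hψm : ∀ i, Measurable (ψ i)) (C : ℝ)
    (hψ0 : ∀ i t, 0 ≤ ψ i t) (hψC : ∀ i t, ψ i t ≤ C) (hA : ∀ i, 0 ≤ A i)
    (hdual : ∀ i (t : ℝ) (H : Set ℝ), 0 ≤ t → IsUpperSet H → MeasurableSet H → H ⊆ Ici t →
      t * (F i).law.real H ≤ ∫ x in H, ψ i x ∂(F i).law + A i) :
    M.revenue ≤ ∑ i, A i + ∫ v, ∑ i, ψ i (v i) * M.alloc v i ∂jointLaw F := by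
  have hψ : ∀ i t, |ψ i t| ≤ C := fun i t => by rw [abs_of_nonneg (hψ0 i t)]; exact hψC i t
  have hupd : ∀ (i : Fin n) (t : ℝ), Measurable (fun v : Fin n → ℝ => Function.update v i t) :=
    fun i t => (measurePreserving_update F i).measurable.comp (measurable_const.prodMk measurable_id)
  have halloc : ∀ i, Measurable fun v => M.alloc v i := fun i =>
    (measurable_pi_apply i).comp M.measurable_alloc
  have hbd : ∀ {g : (Fin n → ℝ) → ℝ} (c : ℝ), Measurable g → (∀ v, |g v| ≤ c) →
      Integrable g (jointLaw F) := fun c hg hc =>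
    Integrable.of_bound hg.aestronglyMeasurable c (Eventually.of_forall hc)
  have habs : ∀ v i, |M.alloc v i| ≤ 1 := fun v i => by
    rw [abs_of_nonneg (M.alloc_mem v i).1]; exact (M.alloc_mem v i).2
  have hint : ∀ i, Integrable (fun v => ψ i (v i) * M.alloc v i) (jointLaw F) := by
    intro i
    refine hbd C (((hψm i).comp (measurable_pi_apply i)).mul (halloc i)) fun v => ?_
    rw [abs_mul]
    calc _ ≤ C * 1 := mul_le_mul (hψ i _) (habs v i) (abs_nonneg _) ((abs_nonneg _).trans (hψ i 0))
      _ = C := mul_one C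
  have key : ∀ i, ∫ v, M.pay v i ∂jointLaw F ≤ ∫ v, ψ i (v i) * M.alloc v i ∂jointLaw F + A i := by
    intro i
    have hai : Integrable (fun v => M.alloc v i) (jointLaw F) := hbd 1 (halloc i) fun v => habs v i
    have hau : ∀ t, Integrable (fun v => M.alloc (Function.update v i t) i) (jointLaw F) :=
      fun t => hbd 1 ((halloc i).comp (hupd i t)) fun v => habs _ i
    have hsub : ∀ s t, 0 ≤ t → ∫ v, (s * M.alloc (Function.update v i t) i -
        M.pay (Function.update v i t) i) ∂jointLaw F =
        s * (∫ v, M.alloc (Function.update v i t) i ∂jointLaw F) -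
          ∫ v, M.pay (Function.update v i t) i ∂jointLaw F := by
      intro s t ht
      rw [integral_sub ((hau t).const_mul s) (M.integrable_interim_pay i t ht),
        integral_const_mul]
    rw [integral_update F i (M.integrable_pay i), integral_update F i (hint i)]
    have hr : ∀ t, ∫ v, ψ i (Function.update v i t i) * M.alloc (Function.update v i t) i
        ∂jointLaw F = ψ i t * ∫ v, M.alloc (Function.update v i t) i ∂jointLaw F := by
      intro t
      simp only [Function.update_self]
      rw [integral_const_mul]
    simp_rw [hr]
    refine interim_revenue_le (F i) (X := fun t => ∫ v, M.alloc (Function.update v i t) i ∂jointLaw F)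
      (fun t => ?_) (fun t => ?_) (integrable_update F i (M.integrable_pay i)) ?_ (hψm i) (hψ0 i)
      ?_ ?_ (hA i)
      (hdual i)
    · exact integral_nonneg fun v => (M.alloc_mem _ i).1
    · calc _ ≤ ∫ v, (1 : ℝ) ∂jointLaw F :=
          integral_mono (hau t) (integrable_const 1) fun v => (M.alloc_mem _ i).2
        _ = 1 := by simp
    · exact Integrable.of_bound (hψm i).aestronglyMeasurable C (Eventually.of_forall (hψ i))
    · intro s t hs ht
      rw [← hsub s t ht, ← hsub s s hs]
      exact M.incentive_compatible i s t hs ht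
    · rw [← hsub 0 0 le_rfl]
      exact M.individually_rational i 0 le_rfl
  rw [Mechanism.revenue, integral_finsetSum _ fun i _ => M.integrable_pay i,
    integral_finsetSum _ fun i _ => hint i, ← Finset.sum_add_distrib]
  exact Finset.sum_le_sum fun i _ => (key i).trans_eq (add_comm _ _)

/-! ### Expectations over sums of independent Bernoulli variables -/

lemma insert_product_eq {κ β : Type*} [DecidableEq κ] [DecidableEq β] (a : κ) (S : Finset κ)
    (J : Finset β) : insert a S ×ˢ J = J.image (Prod.mk a) ∪ S ×ˢ J := by
  ext ⟨i, j⟩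
  simp only [Finset.mem_product, Finset.mem_insert, Finset.mem_union, Finset.mem_image,
    Prod.mk.injEq]
  constructor
  · rintro ⟨rfl | h, hj⟩
    · exact Or.inl ⟨j, hj, rfl, rfl⟩
    · exact Or.inr ⟨h, hj⟩
  · rintro (⟨_, hj, rfl, rfl⟩ | ⟨h, hj⟩)
    · exact ⟨Or.inl rfl, hj⟩
    · exact ⟨Or.inr h, hj⟩

section Bernoulli

variable {ι κ β : Type*} [DecidableEq ι] [DecidableEq κ] [DecidableEq β]

/-- The expectation of `f (x + N)`, where `N` is a sum of independent Bernoulli variables with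
success probabilities `q i`, `i ∈ S`. -/
noncomputable def bern (S : Finset ι) (q : ι → ℝ) (f : ℕ → ℝ) (x : ℕ) : ℝ :=
  ∑ A ∈ S.powerset, (∏ i ∈ A, q i) * (∏ i ∈ S \ A, (1 - q i)) * f (x + A.card)

@[simp] lemma bern_empty (q : ι → ℝ) (f : ℕ → ℝ) (x : ℕ) : bern ∅ q f x = f x := by
  simp [bern]

/-- Conditioning on one variable; the recursion behind most inductions on `S` below. -/
lemma bern_insert {S : Finset ι} {a : ι} (ha : a ∉ S) (q : ι → ℝ) (f : ℕ → ℝ) (x : ℕ) :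
    bern (insert a S) q f x = (1 - q a) * bern S q f x + q a * bern S q f (x + 1) := by
  rw [bern, Finset.sum_powerset_insert ha, bern, bern, Finset.mul_sum, Finset.mul_sum]
  congr 1
  · refine Finset.sum_congr rfl fun A hA => ?_
    have haA : a ∉ A := fun h => ha (Finset.mem_powerset.1 hA h)
    rw [Finset.insert_sdiff_of_notMem _ haA, Finset.prod_insert (by simp [ha])]
    ring
  · refine Finset.sum_congr rfl fun A hA => ?_
    have haA : a ∉ A := fun h => ha (Finset.mem_powerset.1 hA h)
    rw [Finset.prod_insert haA, Finset.card_insert_of_notMem haA, Finset.insert_sdiff_insert,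
      Finset.sdiff_insert_of_notMem ha]
    ring_nf

lemma bern_congr {S : Finset ι} {q q' : ι → ℝ} (h : ∀ i ∈ S, q i = q' i) (f : ℕ → ℝ) (x : ℕ) :
    bern S q f x = bern S q' f x := by
  refine Finset.sum_congr rfl fun A hA => ?_
  rw [Finset.prod_congr rfl fun i hi => h i (Finset.mem_powerset.1 hA hi),
    Finset.prod_congr (s₁ := S \ A) rfl fun i hi => by rw [h i (Finset.mem_sdiff.1 hi).1]]

lemma bern_union {S T : Finset ι} (h : Disjoint S T) (q : ι → ℝ) (f : ℕ → ℝ) (x : ℕ) :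
    bern (S ∪ T) q f x = bern S q (bern T q f) x := by
  induction S using Finset.induction_on generalizing x with
  | empty => simp
  | insert a S ha ih =>
    rw [Finset.disjoint_insert_left] at h
    rw [Finset.insert_union, bern_insert (by simp [ha, h.1]), bern_insert ha, ih h.2, ih h.2]

lemma bern_map {S : Finset ι} (φ : ι ↪ κ) (q : κ → ℝ) (f : ℕ → ℝ) (x : ℕ) :
    bern (S.map φ) q f x = bern S (fun i => q (φ i)) f x := by
  induction S using Finset.induction_on generalizing x with
  | empty => simp
  | insert a S ha ih =>
    rw [Finset.map_insert, bern_insert (by simpa using ha), bern_insert ha, ih, ih]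

lemma bern_of_eq_zero {S : Finset ι} {q : ι → ℝ} (h : ∀ i ∈ S, q i = 0) (f : ℕ → ℝ) (x : ℕ) :
    bern S q f x = f x := by
  induction S using Finset.induction_on generalizing x with
  | empty => simp
  | insert a S ha ih =>
    rw [bern_insert ha, h a (by simp), ih fun i hi => h i (by simp [hi])]
    ring

lemma bern_subset {S T : Finset ι} (hST : S ⊆ T) {q : ι → ℝ} (h : ∀ i ∈ T, i ∉ S → q i = 0)
    (f : ℕ → ℝ) (x : ℕ) : bern T q f x = bern S q f x := by
  rw [← Finset.union_sdiff_of_subset hST, bern_union Finset.disjoint_sdiff]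
  congr 1
  funext y
  exact bern_of_eq_zero (fun i hi => h i (Finset.mem_sdiff.1 hi).1 (Finset.mem_sdiff.1 hi).2) f y

lemma bern_succ (S : Finset ι) (q : ι → ℝ) (f : ℕ → ℝ) (x : ℕ) :
    bern S q f (x + 1) = bern S q (fun y => f (y + 1)) x := by
  refine Finset.sum_congr rfl fun A _ => ?_
  rw [add_right_comm]

lemma bern_sub (S : Finset ι) (q : ι → ℝ) (f g : ℕ → ℝ) (x : ℕ) :
    bern S q (fun y => f y - g y) x = bern S q f x - bern S q g x := by
  rw [bern, bern, bern, ← Finset.sum_sub_distrib]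
  exact Finset.sum_congr rfl fun A _ => by ring

lemma bern_const (S : Finset ι) (q : ι → ℝ) (c : ℝ) (x : ℕ) : bern S q (fun _ => c) x = c := by
  induction S using Finset.induction_on generalizing x with
  | empty => simp
  | insert a S ha ih => rw [bern_insert ha, ih, ih]; ring

section

variable {S : Finset ι} {q : ι → ℝ} (h0 : ∀ i, 0 ≤ q i) (h1 : ∀ i, q i ≤ 1)
include h0 h1

lemma bern_le_bern {f g : ℕ → ℝ} (hfg : ∀ x, f x ≤ g x) (x : ℕ) : bern S q f x ≤ bern S q g x := by
  refine Finset.sum_le_sum fun A _ => mul_le_mul_of_nonneg_left (hfg _) (mul_nonneg ?_ ?_)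
  · exact Finset.prod_nonneg fun i _ => h0 i
  · exact Finset.prod_nonneg fun i _ => sub_nonneg.2 (h1 i)

lemma bern_monotone {f : ℕ → ℝ} (hf : Monotone f) : Monotone (bern S q f) :=
  monotone_nat_of_le_succ fun x => by
    rw [bern_succ]; exact bern_le_bern h0 h1 (fun y => hf (Nat.le_succ y)) x

/-- Taking increments commutes with the expectation over a shift, so decreasing increments are
preserved. -/
lemma bern_concave {f : ℕ → ℝ} (hf : Antitone fun x => f (x + 1) - f x) :
    Antitone fun x => bern S q f (x + 1) - bern S q f x := by
  have : ∀ x, bern S q f (x + 1) - bern S q f x = bern S q (fun y => f (y + 1) - f y) x := fun x => by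
    rw [bern_sub, bern_succ]
  refine antitone_nat_of_succ_le fun x => ?_
  rw [this, this, bern_succ]
  exact bern_le_bern h0 h1 (fun y => hf (Nat.le_succ y)) x

/-- By concavity every success gains at most the first increment, and the expected number of
successes is the sum of the probabilities. -/
lemma bern_le_linear {f : ℕ → ℝ} (hf : Antitone fun x => f (x + 1) - f x) (x : ℕ) :
    bern S q f x ≤ f x + (∑ i ∈ S, q i) * (f (x + 1) - f x) := by
  induction S using Finset.induction_on generalizing x with
  | empty => simp
  | insert a S ha ih =>
    rw [bern_insert ha, Finset.sum_insert ha]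
    have e1 := mul_le_mul_of_nonneg_left (ih x) (sub_nonneg.2 (h1 a))
    have e2 := mul_le_mul_of_nonneg_left (ih (x + 1)) (h0 a)
    have e3 : f (x + 1 + 1) - f (x + 1) ≤ f (x + 1) - f x := hf (Nat.le_succ x)
    have e4 := mul_le_mul_of_nonneg_left e3
      (mul_nonneg (h0 a) (Finset.sum_nonneg fun i (_ : i ∈ S) => h0 i))
    linarith

/-- The sum is at least the indicator of one success, an event of probability at least `Q`. -/
lemma linear_le_bern {f : ℕ → ℝ} (hf : Monotone f) {Q : ℝ} (hQ : ∏ i ∈ S, (1 - q i) ≤ 1 - Q)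
    (x : ℕ) : (1 - Q) * f x + Q * f (x + 1) ≤ bern S q f x := by
  have key : ∀ x, (∏ i ∈ S, (1 - q i)) * f x + (1 - ∏ i ∈ S, (1 - q i)) * f (x + 1) ≤
      bern S q f x := by
    clear hQ
    intro x
    induction S using Finset.induction_on generalizing x with
    | empty => simp
    | insert a S ha ih =>
      rw [bern_insert ha, Finset.prod_insert ha]
      have e1 := mul_le_mul_of_nonneg_left (ih x) (sub_nonneg.2 (h1 a))
      have e2 := mul_le_mul_of_nonneg_left (ih (x + 1)) (h0 a)
      have e3 : ∏ i ∈ S, (1 - q i) ≤ 1 := Finset.prod_le_one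
        (fun i _ => sub_nonneg.2 (h1 i)) (fun i _ => by linarith [h0 i])
      have e4 := mul_le_mul_of_nonneg_left (hf (Nat.le_succ (x + 1)))
        (mul_nonneg (h0 a) (sub_nonneg.2 e3))
      linarith
  have e := mul_le_mul_of_nonneg_left (hf (Nat.le_succ x)) (sub_nonneg.2 hQ)
  have := key x
  simp only [Nat.succ_eq_add_one] at e
  linarith

lemma bern_antitone_param {q' : ι → ℝ} (hqq : ∀ i, q' i ≤ q i) (h0' : ∀ i, 0 ≤ q' i)
    {f : ℕ → ℝ} (hf : Antitone f) (x : ℕ) : bern S q f x ≤ bern S q' f x := by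
  induction S using Finset.induction_on generalizing x with
  | empty => simp
  | insert a S ha ih =>
    rw [bern_insert ha, bern_insert ha]
    have e1 := mul_le_mul_of_nonneg_left (ih x) (sub_nonneg.2 (h1 a))
    have e2 := mul_le_mul_of_nonneg_left (ih (x + 1)) (h0 a)
    have e3 : bern S q' f (x + 1) ≤ bern S q' f x := by
      rw [bern_succ]
      exact bern_le_bern h0' (fun i => (hqq i).trans (h1 i)) (fun y => hf (Nat.le_succ y)) x
    have e4 := mul_le_mul_of_nonneg_left e3 (sub_nonneg.2 (hqq a))
    linarith

lemma bern_monotone_param {q' : ι → ℝ} (hqq : ∀ i, q' i ≤ q i) (h0' : ∀ i, 0 ≤ q' i)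
    {f : ℕ → ℝ} (hf : Monotone f) (x : ℕ) : bern S q' f x ≤ bern S q f x := by
  have := bern_antitone_param (S := S) h0 h1 hqq h0' (f := fun y => 0 - f y)
    (fun a b hab => sub_le_sub_left (hf hab) 0) x
  rw [bern_sub, bern_sub, bern_const, bern_const] at this
  linarith

/-- Thinning all success probabilities by a factor `θ` loses at most a factor `θ`. -/
lemma bern_thin {f : ℕ → ℝ} (hf : Antitone fun x => f (x + 1) - f x) {θ : ℝ} (hθ0 : 0 ≤ θ)
    (hθ1 : θ ≤ 1) (x : ℕ) :
    θ * (bern S q f x - f x) ≤ bern S (fun i => θ * q i) f x - f x := by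
  have hq0 : ∀ i, 0 ≤ θ * q i := fun i => mul_nonneg hθ0 (h0 i)
  have hq1 : ∀ i, θ * q i ≤ q i := fun i => mul_le_of_le_one_left (h0 i) hθ1
  induction S using Finset.induction_on with
  | empty => simp
  | insert a S ha ih =>
    rw [bern_insert ha, bern_insert ha]
    have e1 : bern S q f (x + 1) - bern S q f x ≤
        bern S (fun i => θ * q i) f (x + 1) - bern S (fun i => θ * q i) f x := by
      rw [bern_succ, bern_succ, ← bern_sub, ← bern_sub]
      exact bern_antitone_param h0 h1 hq1 hq0 hf x
    have e2 := mul_le_mul_of_nonneg_left e1 (hq0 a)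
    linarith

end

/-- Splitting Bernoulli variables into groups of smaller ones lowers concave expectations. -/
lemma bern_prod_le {S : Finset κ} {J : Finset β} {u : κ × β → ℝ} {q : κ → ℝ}
    (hu0 : ∀ x, 0 ≤ u x) (hu1 : ∀ x, u x ≤ 1) (h0 : ∀ i, 0 ≤ q i) (h1 : ∀ i, q i ≤ 1)
    (hS : ∀ i ∈ S, ∑ j ∈ J, u (i, j) ≤ q i) {f : ℕ → ℝ} (hfm : Monotone f)
    (hf : Antitone fun x => f (x + 1) - f x) (x : ℕ) :
    bern (S ×ˢ J) u f x ≤ bern S q f x := by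
  induction S using Finset.induction_on generalizing x with
  | empty => simp
  | insert a S ha ih =>
    have ih' := ih (fun i hi => hS i (by simp [hi]))
    rw [insert_product_eq, bern_union, bern_insert ha]
    -- One group is exchanged at a time. The expectation over the other groups is still concave, so
    -- the group gains at most its mean times the first increment, which one variable of at least
    -- that mean realizes.
    · have e0 : bern (Finset.map ⟨fun j => (a, j), Prod.mk_right_injective a⟩ J) u
          (bern (S ×ˢ J) u f) x ≤ bern (S ×ˢ J) u f x + (∑ j ∈ J, u (a, j)) *
            (bern (S ×ˢ J) u f (x + 1) - bern (S ×ˢ J) u f x) := by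
        rw [bern_map]
        exact bern_le_linear (fun j => hu0 _) (fun j => hu1 _) (bern_concave hu0 hu1 hf) x
      have e1 : bern (S ×ˢ J) u f x ≤ bern (S ×ˢ J) u f (x + 1) :=
        bern_monotone hu0 hu1 hfm (Nat.le_succ x)
      have e2 := mul_le_mul_of_nonneg_right (hS a (by simp)) (sub_nonneg.2 e1)
      have e3 := mul_le_mul_of_nonneg_left (ih' x) (sub_nonneg.2 (h1 a))
      have e4 := mul_le_mul_of_nonneg_left (ih' (x + 1)) (h0 a)
      rw [Finset.map_eq_image] at e0
      refine e0.trans ?_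
      linarith
    · rw [Finset.disjoint_left]
      rintro ⟨i, j⟩ hi hj
      simp only [Finset.mem_image, Prod.mk.injEq, Finset.mem_product] at hi hj
      obtain ⟨_, _, rfl, _⟩ := hi
      exact ha hj.1

/-- Groups of Bernoulli variables whose maxima dominate given ones have larger monotone
expectations. -/
lemma le_bern_prod {S : Finset κ} {J : Finset β} {u : κ × β → ℝ} {q : κ → ℝ}
    (hu0 : ∀ x, 0 ≤ u x) (hu1 : ∀ x, u x ≤ 1) (h0 : ∀ i, 0 ≤ q i) (h1 : ∀ i, q i ≤ 1)
    (hS : ∀ i ∈ S, ∏ j ∈ J, (1 - u (i, j)) ≤ 1 - q i) {f : ℕ → ℝ} (hfm : Monotone f) (x : ℕ) :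
    bern S q f x ≤ bern (S ×ˢ J) u f x := by
  induction S using Finset.induction_on generalizing x with
  | empty => simp
  | insert a S ha ih =>
    have ih' := ih (fun i hi => hS i (by simp [hi]))
    rw [insert_product_eq, bern_union, bern_insert ha]
    · have e0 : (1 - q a) * bern (S ×ˢ J) u f x + q a * bern (S ×ˢ J) u f (x + 1) ≤
          bern (Finset.map ⟨fun j => (a, j), Prod.mk_right_injective a⟩ J) u
          (bern (S ×ˢ J) u f) x := by
        rw [bern_map]
        exact linear_le_bern (fun j => hu0 _) (fun j => hu1 _) (bern_monotone hu0 hu1 hfm)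
          (hS a (by simp)) x
      have e3 := mul_le_mul_of_nonneg_left (ih' x) (sub_nonneg.2 (h1 a))
      have e4 := mul_le_mul_of_nonneg_left (ih' (x + 1)) (h0 a)
      rw [Finset.map_eq_image] at e0
      refine le_trans ?_ e0
      linarith
    · rw [Finset.disjoint_left]
      rintro ⟨i, j⟩ hi hj
      simp only [Finset.mem_image, Prod.mk.injEq, Finset.mem_product] at hi hj
      obtain ⟨_, _, rfl, _⟩ := hi
      exact ha hj.1

/-- The number of units sold to `x` interested agents. -/
noncomputable def cap (k : ℕ) (x : ℕ) : ℝ := min (k : ℝ) x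

lemma cap_monotone (k : ℕ) : Monotone (cap k) := fun a b hab =>
  min_le_min_left _ (by exact_mod_cast hab)

lemma cap_concave (k : ℕ) : Antitone fun x => cap k (x + 1) - cap k x := by
  refine antitone_nat_of_succ_le fun x => ?_
  simp only [cap]
  push_cast
  rcases le_or_gt (k : ℝ) x with h | h
  · rw [min_eq_left h, min_eq_left (by linarith), min_eq_left (by linarith)]
  · have h' : (x : ℝ) + 1 ≤ k := by exact_mod_cast h
    rw [min_eq_right h.le, min_eq_right h']
    have := min_le_right (k : ℝ) (x + 1 + 1)
    linarith

lemma cap_nonneg (k x : ℕ) : 0 ≤ cap k x := by unfold cap; positivity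

@[simp] lemma cap_zero (k : ℕ) : cap k 0 = 0 := by simp [cap]

lemma one_le_cap {k x : ℕ} (hk : 1 ≤ k) (hx : 1 ≤ x) : 1 ≤ cap k x := by
  unfold cap
  exact le_min (by exact_mod_cast hk) (by exact_mod_cast hx)

lemma cap_le (k x : ℕ) : cap k x ≤ k := min_le_left _ _

/-- The variance of the sum is at most its mean. -/
lemma le_bern_quadratic {S : Finset ι} {q : ι → ℝ} (h0 : ∀ i, 0 ≤ q i) (h1 : ∀ i, q i ≤ 1)
    {c : ℝ} (hc : 0 ≤ c) (x : ℕ) :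
    (x + ∑ i ∈ S, q i) - c * ((x + ∑ i ∈ S, q i) ^ 2 + ∑ i ∈ S, q i) ≤
      bern S q (fun y => (y : ℝ) - c * (y : ℝ) ^ 2) x := by
  induction S using Finset.induction_on generalizing x with
  | empty => simp
  | insert a S ha ih =>
    rw [bern_insert ha, Finset.sum_insert ha]
    have e1 := mul_le_mul_of_nonneg_left (ih x) (sub_nonneg.2 (h1 a))
    have e2 := mul_le_mul_of_nonneg_left (ih (x + 1)) (h0 a)
    have e3 := mul_nonneg hc (sq_nonneg (q a))
    push_cast at e2
    nlinarith

/-- A sum of independent Bernoulli variables with mean `μ`, capped at `k`, has mean at least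
`min k μ / 2`. -/
lemma half_min_le_bern_cap {k : ℕ} (hk : 1 ≤ k) {S : Finset ι} {q : ι → ℝ} (h0 : ∀ i, 0 ≤ q i)
    (h1 : ∀ i, q i ≤ 1) : min (k : ℝ) (∑ i ∈ S, q i) / 2 ≤ bern S q (cap k) 0 := by
  have hk' : (1 : ℝ) ≤ k := by exact_mod_cast hk
  have small : ∀ q : ι → ℝ, (∀ i, 0 ≤ q i) → (∀ i, q i ≤ 1) → ∑ i ∈ S, q i ≤ k →
      (∑ i ∈ S, q i) / 2 ≤ bern S q (cap k) 0 := by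
    intro q h0 h1 hμ
    have hμ0 : 0 ≤ ∑ i ∈ S, q i := Finset.sum_nonneg fun i _ => h0 i
    -- The parabola `y - y ^ 2 / (4 * k)` lies below `y` and has maximum `k`, at `y = 2 * k`, so it
    -- lies below `cap k`. Its loss is at most half the mean `μ`, because `μ + 1 ≤ 2 * k`.
    have hc : (0 : ℝ) ≤ 1 / (4 * k) := by positivity
    have e1 := le_bern_quadratic (S := S) h0 h1 hc 0
    have e2 : bern S q (fun y => (y : ℝ) - 1 / (4 * k) * (y : ℝ) ^ 2) 0 ≤ bern S q (cap k) 0 := by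
      refine bern_le_bern h0 h1 (fun y => ?_) 0
      have e3 : (0 : ℝ) ≤ 1 / (4 * k) * ((y : ℝ) ^ 2) := by positivity
      refine le_min ?_ (by linarith)
      have e4 : (y : ℝ) - 1 / (4 * k) * (y : ℝ) ^ 2 = k - (y - 2 * k) ^ 2 / (4 * k) := by
        field_simp; ring
      rw [e4]
      have : (0 : ℝ) ≤ (y - 2 * k) ^ 2 / (4 * k) := by positivity
      linarith
    refine le_trans ?_ (e1.trans e2)
    set μ := ∑ i ∈ S, q i
    have e5 : 1 / (4 * k) * (μ ^ 2 + μ) ≤ μ / 2 := by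
      rw [div_mul_eq_mul_div, div_le_iff₀ (by positivity)]
      nlinarith
    simp only [Nat.cast_zero, zero_add]
    linarith
  rcases le_total (∑ i ∈ S, q i) k with h | h
  · rw [min_eq_right h]; exact small q h0 h1 h
  · rw [min_eq_left h]
    set μ := ∑ i ∈ S, q i with hμ
    have hμ0 : 0 < μ := by linarith
    -- A mean above `k` is thinned to exactly `k`, which only lowers the expectation.
    have hθ0 : 0 ≤ k / μ := by positivity
    have hθ1 : k / μ ≤ 1 := (div_le_one hμ0).2 h
    have e1 : ∀ i, k / μ * q i ≤ q i := fun i => mul_le_of_le_one_left (h0 i) hθ1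
    have e0 : ∀ i, 0 ≤ k / μ * q i := fun i => mul_nonneg hθ0 (h0 i)
    have e2 : ∑ i ∈ S, k / μ * q i = k := by
      rw [← Finset.mul_sum, ← hμ]; field_simp
    have e3 := small (fun i => k / μ * q i) e0 (fun i => (e1 i).trans (h1 i)) e2.le
    rw [e2] at e3
    exact e3.trans (bern_monotone_param h0 h1 e1 e0 (cap_monotone k) 0)

end Bernoulli

/-! ### Sales at posted prices as Bernoulli sums -/

open Classical in
/-- The number of agents in `S` whose values lie in given sets is a sum of independent Bernoulli
variables. -/
theorem integral_card_mem {n : ℕ} (F : Fin n → ValueDist) (S : Finset (Fin n))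
    {E : Fin n → Set ℝ} (hE : ∀ i, MeasurableSet (E i)) (f : ℕ → ℝ) :
    ∫ v, f (S.filter fun i => v i ∈ E i).card ∂jointLaw F =
      bern S (fun i => (F i).law.real (E i)) f 0 := by
  let B : Finset (Fin n) → Set (Fin n → ℝ) := fun A =>
    univ.pi fun i => if i ∈ S then (if i ∈ A then E i else (E i)ᶜ) else univ
  have hBm : ∀ A, MeasurableSet (B A) := fun A => MeasurableSet.univ_pi fun i => by
    split_ifs
    · exact hE i
    · exact (hE i).compl
    · exact MeasurableSet.univ
  have hB : ∀ A ∈ S.powerset, (jointLaw F).real (B A) =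
      (∏ i ∈ A, (F i).law.real (E i)) * ∏ i ∈ S \ A, (1 - (F i).law.real (E i)) := by
    intro A hA
    rw [Finset.mem_powerset] at hA
    simp only [B, jointLaw]
    rw [measureReal_def, Measure.pi_pi, ENNReal.toReal_prod,
      ← Finset.prod_subset (Finset.subset_univ S), ← Finset.prod_sdiff hA, mul_comm]
    · congr 1
      · refine Finset.prod_congr rfl fun i hi => ?_
        rw [if_pos (hA hi), if_pos hi]; rfl
      · refine Finset.prod_congr rfl fun i hi => ?_
        rw [Finset.mem_sdiff] at hi
        rw [if_pos hi.1, if_neg hi.2, ← probReal_compl_eq_one_sub (hE i)]; rfl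
    · intro i _ hi
      rw [if_neg hi]; simp
  have hmem : ∀ A ∈ S.powerset, ∀ v, v ∈ B A ↔ S.filter (fun i => v i ∈ E i) = A := by
    intro A hA v
    rw [Finset.mem_powerset] at hA
    simp only [B, mem_univ_pi]
    constructor
    · intro h
      ext i
      rw [Finset.mem_filter]
      have := h i
      constructor
      · rintro ⟨hi, hp⟩
        by_contra hiA
        rw [if_pos hi, if_neg hiA] at this
        exact this hp
      · intro hi
        rw [if_pos (hA hi), if_pos hi] at this
        exact ⟨hA hi, this⟩
    · rintro rfl i
      split_ifs with h1 h2
      · exact (Finset.mem_filter.1 h2).2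
      · rw [Finset.mem_filter, not_and] at h2
        exact h2 h1
      · trivial
  have hsum : ∀ v, f (S.filter fun i => v i ∈ E i).card =
      ∑ A ∈ S.powerset, (B A).indicator (fun _ => f A.card) v := by
    intro v
    rw [Finset.sum_eq_single_of_mem (S.filter fun i => v i ∈ E i) (by simp)]
    · rw [indicator_of_mem]
      rw [hmem _ (by simp)]
    · intro A hA hne
      rw [indicator_of_notMem]
      rw [hmem A hA]
      exact fun h => hne h.symm
  simp_rw [hsum]
  rw [integral_finsetSum _ fun A _ => (integrable_const _).indicator (hBm A), bern]
  refine Finset.sum_congr rfl fun A hA => ?_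
  rw [integral_indicator_const _ (hBm A), hB A hA, zero_add, smul_eq_mul]

/-- The number of agents in `S` accepting their own price is a sum of independent Bernoulli
variables. -/
theorem integral_card_accept {n : ℕ} (F : Fin n → ValueDist) (S : Finset (Fin n)) (p : Fin n → ℝ)
    (f : ℕ → ℝ) :
    ∫ v, f (S.filter fun i => p i ≤ v i).card ∂jointLaw F =
      bern S (fun i => (F i).tail (p i)) f 0 := by
  rw [show (fun i => (F i).tail (p i)) = fun i => (F i).law.real (Ici (p i)) from rfl,
    ← integral_card_mem F S (fun i => measurableSet_Ici)]
  refine integral_congr_ae (Eventually.of_forall fun v => ?_)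
  simp only
  congr 2

lemma sales_eq_cap (k : ℕ) {n : ℕ} (p : ℝ) (v : Fin n → ℝ) :
    (sales k p v : ℝ) = cap k (Finset.univ.filter fun i => p ≤ v i).card := by
  simp [sales, cap]

theorem APat_eq (k : ℕ) {n : ℕ} (p : ℝ) (F : Fin n → ValueDist) :
    APat k p F = p * bern Finset.univ (fun i => (F i).tail p) (cap k) 0 := by
  simp only [APat, sales_eq_cap]
  rw [integral_const_mul, integral_card_accept F Finset.univ (fun _ => p) (cap k)]

/-! ### The logarithmic gap -/

lemma setIntegral_tail_const (D : ValueDist) (H : Set ℝ) (c : ℝ) :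
    ∫ _ in H, c ∂D.law = c * D.law.real H := by
  rw [setIntegral_const, smul_eq_mul, mul_comm]

lemma OPT_le_of_revenue_le {k n : ℕ} {F : Fin n → ValueDist} {c : ℝ}
    (h : ∀ M : Mechanism k F, M.revenue ≤ c) : OPT k F ≤ ENNReal.ofReal c :=
  iSup_le fun M => ENNReal.ofReal_le_ofReal (h M)

/-- If anonymous pricing earns at most `α` at every price, the demand at high prices is small. -/
theorem sum_tail_le_of_APat_le {k n : ℕ} (hk : 1 ≤ k) {F : Fin n → ValueDist} {α : ℝ}
    (hα : ∀ p, 0 ≤ p → APat k p F ≤ α) {p : ℝ} (hp : 0 < p) (hpk : 2 * α < p * k) :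
    p * ∑ i, (F i).tail p ≤ 2 * α := by
  have h1 := hα p hp.le
  rw [APat_eq] at h1
  have h2 := half_min_le_bern_cap hk (S := Finset.univ) (q := fun i => (F i).tail p)
    (fun i => (F i).tail_nonneg p) (fun i => (F i).tail_le_one p)
  have h3 := mul_le_mul_of_nonneg_left h2 hp.le
  rcases le_total (k : ℝ) (∑ i, (F i).tail p) with h | h
  · rw [min_eq_left h] at h3
    linarith
  · rw [min_eq_right h] at h3
    linarith

/-- The dual has constant virtual value `b = 4α / k`, costing `b * k = 4α` in surplus. The constants
`A i` pay `4α` in total for each of the `J` dyadic levels between `b` and `τ ≥ 4α`, and `4α` for all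
prices above `τ`. -/
theorem revenue_le_of_APat_le {k n : ℕ} (hk : 1 ≤ k) {F : Fin n → ValueDist}
    (hF : ∀ i, (F i).QuasiRegular) {α : ℝ} (hα0 : 0 < α) (hα : ∀ p, 0 ≤ p → APat k p F ≤ α)
    (M : Mechanism k F) : M.revenue ≤ 4 * α * (2 + Nat.clog 2 k) := by
  have hk' : (1 : ℝ) ≤ k := by exact_mod_cast hk
  set J := Nat.clog 2 k
  set b : ℝ := 4 * α / k with hb
  have hb0 : 0 < b := by positivity
  set τ : ℝ := b * 2 ^ J with hτ
  have hτ0 : 0 < τ := by positivity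
  have hkJ : (k : ℝ) ≤ 2 ^ J := by exact_mod_cast Nat.le_pow_clog one_lt_two k
  have hτα : 4 * α ≤ τ := by
    rw [hτ, hb, div_mul_eq_mul_div, le_div_iff₀ (by positivity)]
    gcongr
  have hdemand : ∀ p, b ≤ p → p * ∑ i, (F i).tail p ≤ 2 * α := by
    intro p hp
    refine sum_tail_le_of_APat_le hk hα (hb0.trans_le hp) ?_
    have : b * k = 4 * α := by rw [hb]; field_simp
    nlinarith
  have hbτ : b ≤ τ := by
    rw [hτ]; exact le_mul_of_one_le_right hb0.le (one_le_pow₀ one_le_two)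
  -- Each single tail at `τ` is at most the total demand, hence at most `2α / τ`. By
  -- quasi-regularity, prices above `τ` then earn at most twice the revenue at `τ`.
  have hhalf : ∀ i, (F i).tail τ ≤ 1 / 2 := by
    intro i
    have h1 := hdemand τ hbτ
    have h2 : (F i).tail τ ≤ ∑ i, (F i).tail τ :=
      Finset.single_le_sum (f := fun i => (F i).tail τ) (fun i _ => (F i).tail_nonneg τ)
        (Finset.mem_univ i)
    have h3 : 0 ≤ ∑ i, (F i).tail τ := Finset.sum_nonneg fun i _ => (F i).tail_nonneg τ
    nlinarith
  let A : Fin n → ℝ := fun i =>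
    ∑ j ∈ Finset.range J, b * 2 ^ (j + 1) * (F i).tail (b * 2 ^ j) + 2 * (τ * (F i).tail τ)
  have hterm : ∀ i (j : ℕ), 0 ≤ b * 2 ^ (j + 1) * (F i).tail (b * 2 ^ j) := fun i j =>
    mul_nonneg (by positivity) ((F i).tail_nonneg _)
  have hAτ : ∀ i, 0 ≤ 2 * (τ * (F i).tail τ) := fun i => by
    have := (F i).tail_nonneg τ; positivity
  have hA0 : ∀ i, 0 ≤ A i := fun i =>
    add_nonneg (Finset.sum_nonneg fun j _ => hterm i j) (hAτ i)
  have hAsum : ∑ i, A i ≤ 4 * α * (1 + J) := by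
    simp only [A]
    rw [Finset.sum_add_distrib, Finset.sum_comm, ← Finset.mul_sum, ← Finset.mul_sum]
    have h1 : ∀ j ∈ Finset.range J, ∑ i, b * 2 ^ (j + 1) * (F i).tail (b * 2 ^ j) ≤ 4 * α := by
      intro j _
      have := hdemand (b * 2 ^ j) (le_mul_of_one_le_right hb0.le (one_le_pow₀ one_le_two))
      rw [← Finset.mul_sum, pow_succ]
      linarith
    have h2 := Finset.sum_le_sum h1
    rw [Finset.sum_const, Finset.card_range, nsmul_eq_mul] at h2
    have h3 := hdemand τ hbτ
    linarith
  have hrev := M.revenue_le (fun _ _ => b) A (fun _ => measurable_const) b (fun _ _ => hb0.le)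
    (fun _ _ => le_rfl) hA0 ?_
  · refine hrev.trans ?_
    have h1 : ∫ v, ∑ i, b * M.alloc v i ∂jointLaw F ≤ b * k := by
      calc ∫ v, ∑ i, b * M.alloc v i ∂jointLaw F ≤ ∫ _, b * k ∂jointLaw F := by
            refine integral_mono_of_nonneg (Eventually.of_forall fun v => ?_) (integrable_const _)
              (Eventually.of_forall fun v => ?_)
            · exact Finset.sum_nonneg fun i _ => mul_nonneg hb0.le (M.alloc_mem v i).1
            · simp only
              rw [← Finset.mul_sum]
              exact mul_le_mul_of_nonneg_left (M.alloc_sum_le v) hb0.le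
        _ = b * k := by simp
    have : b * k = 4 * α := by rw [hb]; field_simp
    linarith
  · intro i t H ht hHu hHm hHt
    rw [setIntegral_tail_const]
    have hH : (F i).law.real H ≤ (F i).tail t := measureReal_mono hHt
    have hH0 : 0 ≤ (F i).law.real H := measureReal_nonneg
    rcases lt_or_ge t b with htb | htb
    · have := mul_le_mul_of_nonneg_right htb.le hH0
      linarith [hA0 i]
    have h1 : t * (F i).law.real H ≤ t * (F i).tail t := mul_le_mul_of_nonneg_left hH ht
    have h2 : 0 ≤ b * (F i).law.real H := mul_nonneg hb0.le hH0
    suffices t * (F i).tail t ≤ A i by linarith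
    rcases le_or_gt τ t with htτ | htτ
    · have h3 := (hF i).tail_le hτ0 htτ
      have h4 : 0 ≤ t * (F i).tail t := mul_nonneg ht ((F i).tail_nonneg t)
      have h5 : t * (F i).tail t ≤ 2 * (τ * (F i).tail τ) := by nlinarith [hhalf i]
      exact h5.trans (le_add_of_nonneg_left (Finset.sum_nonneg fun j _ => hterm i j))
    · obtain ⟨j, hj1, hj2⟩ := exists_nat_pow_near ((one_le_div hb0).2 htb) (one_lt_two (α := ℝ))
      rw [le_div_iff₀ hb0] at hj1
      rw [div_lt_iff₀ hb0] at hj2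
      have hjJ : j < J := by
        have : (2 : ℝ) ^ j < 2 ^ J := by
          have h3 : 2 ^ j * b < 2 ^ J * b := by rw [hτ] at htτ; linarith
          exact lt_of_mul_lt_mul_right h3 hb0.le
        exact (pow_lt_pow_iff_right₀ one_lt_two).1 this
      have h3 : t * (F i).tail t ≤ b * 2 ^ (j + 1) * (F i).tail (b * 2 ^ j) :=
        mul_le_mul (by linarith) ((F i).tail_anti (by linarith)) ((F i).tail_nonneg t)
          (by positivity)
      refine h3.trans (le_trans ?_ (le_add_of_nonneg_right (hAτ i)))
      exact Finset.single_le_sum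
        (f := fun j : ℕ => b * 2 ^ (j + 1) * (F i).tail (b * 2 ^ j)) (fun j _ => hterm i j)
        (Finset.mem_range.2 hjJ)

lemma logUnits_ge (k : ℕ) : Real.log 2 ≤ logUnits k :=
  Real.log_le_log (by norm_num) (by exact_mod_cast le_max_right k 2)

lemma logUnits_pos (k : ℕ) : 0 < logUnits k := (Real.log_pos one_lt_two).trans_le (logUnits_ge k)

/-- `2 ^ (clog 2 k - 1) < k` bounds all but one of the factors `log 2`, and the remaining one is at
most `logUnits k`. -/
lemma clog_mul_log_le (k : ℕ) : (Nat.clog 2 k : ℝ) * Real.log 2 ≤ 2 * logUnits k := by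
  have h2 := logUnits_ge k
  have hl := Real.log_pos one_lt_two
  rcases Nat.eq_zero_or_pos (Nat.clog 2 k) with h | h
  · rw [h]; push_cast; linarith
  · have h3 : 2 ^ (Nat.clog 2 k - 1) < k := by
      rw [← Nat.lt_clog_iff_pow_lt one_lt_two]; omega
    have h4 : ((Nat.clog 2 k - 1 : ℕ) : ℝ) * Real.log 2 ≤ logUnits k := by
      rw [← Real.log_pow]
      apply Real.log_le_log (by positivity)
      exact_mod_cast h3.le.trans (le_max_left k 2)
    rw [Nat.cast_sub h] at h4
    push_cast at h4
    linarith

lemma APat_le_toReal {k n : ℕ} {F : Fin n → ValueDist} (hAP : AP k F ≠ ⊤) {p : ℝ} (hp : 0 ≤ p) :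
    APat k p F ≤ (AP k F).toReal := by
  rw [← ENNReal.ofReal_le_iff_le_toReal hAP]
  exact le_iSup₂_of_le (f := fun p (_ : p ∈ Ici (0 : ℝ)) => ENNReal.ofReal (APat k p F)) p hp le_rfl

/-- Anonymous pricing is an `O(log k)` approximation. -/
theorem exists_gapBound : ∃ γ : ℝ, 0 < γ ∧ ∀ k : ℕ, 1 ≤ k → GapBound k γ := by
  have hl := Real.log_pos one_lt_two
  refine ⟨16 / Real.log 2, by positivity, fun k hk n F hF => ?_⟩
  have hγ : 0 < 16 / Real.log 2 * logUnits k := mul_pos (by positivity) (logUnits_pos k)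
  by_cases hAP : AP k F = ⊤
  · rw [hAP, ENNReal.mul_top (ENNReal.ofReal_pos.2 hγ).ne']; exact le_top
  -- The bound needs `α > 0`, while `AP` may be zero; hence the limit `α ↓ AP`.
  have key : ∀ α : ℝ, (AP k F).toReal < α → OPT k F ≤ ENNReal.ofReal (16 / Real.log 2 * logUnits k * α) := by
    intro α hα
    have hα0 : 0 < α := ENNReal.toReal_nonneg.trans_lt hα
    refine OPT_le_of_revenue_le fun M => (revenue_le_of_APat_le hk hF hα0
      (fun p hp => (APat_le_toReal hAP hp).trans hα.le) M).trans ?_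
    have h1 : (4 : ℝ) * (2 + Nat.clog 2 k) ≤ 16 / Real.log 2 * logUnits k := by
      rw [div_mul_eq_mul_div, le_div_iff₀ hl]
      linarith [clog_mul_log_le k, logUnits_ge k]
    calc 4 * α * (2 + Nat.clog 2 k) = 4 * (2 + Nat.clog 2 k) * α := by ring
      _ ≤ _ := by gcongr
  rw [← ENNReal.ofReal_toReal hAP, ← ENNReal.ofReal_mul hγ.le]
  have hlim : Tendsto (fun α : ℝ => ENNReal.ofReal (16 / Real.log 2 * logUnits k * α))
      (𝓝[>] (AP k F).toReal) (𝓝 (ENNReal.ofReal (16 / Real.log 2 * logUnits k * (AP k F).toReal))) :=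
    ((ENNReal.continuous_ofReal.comp (continuous_const.mul continuous_id)).tendsto _).mono_left
      nhdsWithin_le_nhds
  exact ge_of_tendsto hlim (eventually_mem_nhdsWithin.mono key)

/-! ### Triangular distributions -/

/-- The value of a truncated Pareto distribution as a function of a uniform quantile. -/
noncomputable def triValue (r q x : ℝ) : ℝ := min (r / q) (r / (1 - q) * (1 / x - 1))

lemma measurable_triValue (r q : ℝ) : Measurable (triValue r q) := by
  unfold triValue; fun_prop

lemma le_pareto_iff {r q : ℝ} (hr : 0 < r) (hq1 : q < 1) {x p : ℝ} (hx : 0 < x) (hp : 0 ≤ p) :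
    p ≤ r / (1 - q) * (1 / x - 1) ↔ x ≤ r / (r + p * (1 - q)) := by
  have h1 : 0 < 1 - q := by linarith
  have h2 : 0 < r + p * (1 - q) := by positivity
  rw [show r / (1 - q) * (1 / x - 1) = r * (1 - x) / ((1 - q) * x) by field_simp,
    le_div_iff₀ (by positivity), le_div_iff₀ h2]
  constructor <;> intro h <;> nlinarith

section

variable {r q : ℝ} (hr : 0 < r) (hq0 : 0 < q) (hq1 : q < 1)
include hr hq0 hq1

lemma triValue_nonneg {x : ℝ} (hx : x ∈ Ioc (0 : ℝ) 1) : 0 ≤ triValue r q x := by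
  have h1 : 0 < 1 - q := by linarith
  refine le_min (by positivity) (mul_nonneg (by positivity) ?_)
  rw [sub_nonneg, le_div_iff₀ hx.1]
  linarith [hx.2]

/-- The triangular distribution with monopoly revenue `r` and monopoly quantile `q`, for
`0 < q < 1`. -/
noncomputable def triDist : ValueDist where
  law := (volume.restrict (Ioc (0 : ℝ) 1)).map (triValue r q)
  isProb := by
    have : IsProbabilityMeasure (volume.restrict (Ioc (0 : ℝ) 1)) := ⟨by simp⟩
    exact Measure.isProbabilityMeasure_map (measurable_triValue r q).aemeasurable
  nonneg := by
    rw [Measure.map_apply (measurable_triValue r q) measurableSet_Iio,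
      Measure.restrict_apply ((measurable_triValue r q) measurableSet_Iio)]
    convert measure_empty (μ := (volume : Measure ℝ))
    rw [eq_empty_iff_forall_notMem]
    rintro x ⟨h1, h2⟩
    exact absurd (triValue_nonneg hr hq0 hq1 h2) (not_le.2 h1)

lemma triDist_tail {p : ℝ} (hp : 0 ≤ p) (hpq : p ≤ r / q) :
    (triDist hr hq0 hq1).tail p = r / (r + p * (1 - q)) := by
  have h1 : 0 < 1 - q := by linarith
  have h2 : 0 < r + p * (1 - q) := by positivity
  have h3 : r / (r + p * (1 - q)) ≤ 1 := by rw [div_le_one h2]; nlinarith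
  have : triValue r q ⁻¹' Ici p ∩ Ioc 0 1 = Ioc 0 (r / (r + p * (1 - q))) := by
    ext x
    simp only [mem_inter_iff, mem_preimage, mem_Ici, mem_Ioc, triValue, le_min_iff]
    constructor
    · rintro ⟨⟨_, h4⟩, h5, h6⟩
      exact ⟨h5, (le_pareto_iff hr hq1 h5 hp).1 h4⟩
    · rintro ⟨h5, h6⟩
      exact ⟨⟨hpq, (le_pareto_iff hr hq1 h5 hp).2 h6⟩, h5, h6.trans h3⟩
  rw [ValueDist.tail, triDist, measureReal_def,
    Measure.map_apply (measurable_triValue r q) measurableSet_Ici,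
    Measure.restrict_apply ((measurable_triValue r q) measurableSet_Ici), this, Real.volume_Ioc,
    sub_zero, ENNReal.toReal_ofReal (by positivity)]

lemma triDist_tail_eq_zero {p : ℝ} (hpq : r / q < p) : (triDist hr hq0 hq1).tail p = 0 := by
  have : triValue r q ⁻¹' Ici p = ∅ := by
    rw [eq_empty_iff_forall_notMem]
    intro x hx
    exact absurd (lt_of_lt_of_le hpq (hx : p ≤ triValue r q x)) (not_lt.2 (min_le_left _ _))
  rw [ValueDist.tail, triDist, measureReal_def,
    Measure.map_apply (measurable_triValue r q) measurableSet_Ici, this]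
  simp

lemma triDist_tail_monopoly : (triDist hr hq0 hq1).tail (r / q) = q := by
  rw [triDist_tail hr hq0 hq1 (by positivity) le_rfl]
  field_simp
  ring

lemma triDist_tail_le {p : ℝ} (hp : 0 < p) :
    (triDist hr hq0 hq1).tail p ≤ if p ≤ r / q then r / p else 0 := by
  split_ifs with h
  · rw [triDist_tail hr hq0 hq1 hp.le h]
    rw [le_div_iff₀ hq0] at h
    gcongr
    linarith
  · rw [triDist_tail_eq_zero hr hq0 hq1 (not_le.1 h)]

lemma triDist_cdf {v : ℝ} (hv : 0 ≤ v) : (triDist hr hq0 hq1).cdf v = triCDF r q v := by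
  have h1 : 0 < 1 - q := by linarith
  have e : (1 : ℝ) - 1 / (1 + v / r * (1 - q)) = 1 - r / (r + v * (1 - q)) := by
    congr 1; field_simp
  rw [triCDF, e, ← sub_sub_cancel 1 (ValueDist.cdf _ v), ValueDist.one_sub_cdf]
  have h2 : 0 < r + v * (1 - q) := by positivity
  have h3 : r / (r + v * (1 - q)) ≤ 1 := by rw [div_le_one h2]; nlinarith
  rw [triDist, measureReal_def, Measure.map_apply (measurable_triValue r q) measurableSet_Ioi,
    Measure.restrict_apply ((measurable_triValue r q) measurableSet_Ioi)]
  split_ifs with h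
  · have : triValue r q ⁻¹' Ioi v = ∅ := by
      rw [eq_empty_iff_forall_notMem]
      intro x hx
      exact absurd (lt_of_le_of_lt h.2 (hx : v < triValue r q x)) (not_lt.2 (min_le_left _ _))
    rw [this]; simp
  · have hv' : v < r / q := by
      by_contra hcon
      exact h ⟨hq0, not_lt.1 hcon⟩
    have : triValue r q ⁻¹' Ioi v ∩ Ioc 0 1 = Ioo 0 (r / (r + v * (1 - q))) := by
      ext x
      simp only [mem_inter_iff, mem_preimage, mem_Ioi, mem_Ioc, mem_Ioo, triValue, lt_min_iff]
      have h4 : 0 < x → (v < r / (1 - q) * (1 / x - 1) ↔ x < r / (r + v * (1 - q))) := by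
        intro hx
        rw [show r / (1 - q) * (1 / x - 1) = r * (1 - x) / ((1 - q) * x) by field_simp,
          lt_div_iff₀ (by positivity), lt_div_iff₀ h2]
        constructor <;> intro h <;> nlinarith
      constructor
      · rintro ⟨⟨_, h5⟩, h6, h7⟩
        exact ⟨h6, (h4 h6).1 h5⟩
      · rintro ⟨h6, h7⟩
        exact ⟨⟨hv', (h4 h6).2 h7⟩, h6, h7.le.trans h3⟩
    rw [this, Real.volume_Ioo, sub_zero, ENNReal.toReal_ofReal (by positivity)]

lemma triDist_triangular : (triDist hr hq0 hq1).Triangular :=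
  ⟨r, q, hr, hq0.le, hq1.le, fun _ hv => triDist_cdf hr hq0 hq1 hv⟩

/-- The revenue curve is a tent: a line from the origin up to `(q, r)`, then a line down to `(1,
0)`. -/
lemma triDist_monopolyRevenue_le : (triDist hr hq0 hq1).monopolyRevenue ≤ ENNReal.ofReal r := by
  have h1 : 0 < 1 - q := by linarith
  refine iSup₂_le fun x hx => ENNReal.ofReal_le_ofReal ?_
  have hval : ∀ v, 0 ≤ v → 1 - x ≤ triCDF r q v → (triDist hr hq0 hq1).valueAt x ≤ v := by
    intro v hv h
    refine csInf_le ⟨0, fun _ h => h.1⟩ ⟨hv, ?_⟩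
    rwa [triDist_cdf hr hq0 hq1 hv]
  rw [ValueDist.revenueCurve]
  rcases le_or_gt x q with h | h
  · have h2 := hval (r / q) (by positivity) (by rw [triCDF, if_pos ⟨hq0, le_rfl⟩]; linarith [hx.1])
    calc x * _ ≤ q * (r / q) := mul_le_mul h h2 (Real.sInf_nonneg fun _ h => h.1) hq0.le
      _ = r := by field_simp
  · have hx0 : 0 < x := hq0.trans h
    have hv0 : 0 ≤ r / (1 - q) * (1 / x - 1) := by
      refine mul_nonneg (by positivity) ?_
      rw [sub_nonneg, le_div_iff₀ hx0]; linarith [hx.2]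
    have h2 := hval _ hv0 (by
      rw [triCDF, if_neg]
      · rw [show 1 + r / (1 - q) * (1 / x - 1) / r * (1 - q) = 1 / x by field_simp; ring]
        simp
      · rintro ⟨_, h3⟩
        rw [le_pareto_iff hr hq1 hx0 (by positivity)] at h3
        rw [show r / (r + r / q * (1 - q)) = q by field_simp; ring] at h3
        linarith)
    calc x * _ ≤ x * (r / (1 - q) * (1 / x - 1)) := mul_le_mul_of_nonneg_left h2 hx0.le
      _ = r * ((1 - x) / (1 - q)) := by field_simp
      _ ≤ r * 1 := by
          gcongr
          rw [div_le_one h1]; linarith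
      _ = r := mul_one r

end

/-- Below the truncation point the criterion holds with equality; from that point on its left side
is zero. -/
theorem ValueDist.Triangular.quasiRegular {D : ValueDist} (h : D.Triangular) : D.QuasiRegular := by
  obtain ⟨r, q, hr, hq0, hq1, hD⟩ := h
  rw [ValueDist.quasiRegular_iff]
  intro s t hs hst hpos
  have ht := hs.trans hst
  rw [hD s hs] at hpos ⊢
  rw [hD t ht]
  unfold triCDF at hpos ⊢
  by_cases h1 : 0 < q ∧ r / q ≤ t
  · rw [if_pos h1]
    have : (if 0 < q ∧ r / q ≤ s then (1 : ℝ) else 1 - 1 / (1 + s / r * (1 - q))) ≤ 1 := by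
      split_ifs
      · rfl
      · have : 0 ≤ 1 / (1 + s / r * (1 - q)) := by
          have := sub_nonneg.2 hq1; positivity
        linarith
    have := mul_nonneg hs (sub_nonneg.2 this)
    simpa using this
  · have h2 : ¬ (0 < q ∧ r / q ≤ s) := fun h => h1 ⟨h.1, h.2.trans hst⟩
    rw [if_neg h1, if_neg h2]
    have h3 := sub_nonneg.2 hq1
    have h4 : 0 < 1 + s / r * (1 - q) := by positivity
    have h5 : 0 < 1 + t / r * (1 - q) := by positivity
    apply le_of_eq
    field_simp
    ring

/-! ### Sequential posted pricing -/

/-- Serving the first `k` elements of a finite linear order serves `min k` of the size. -/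
lemma card_filter_rank_lt {α : Type*} [LinearOrder α] (k : ℕ) (B : Finset α) :
    (B.filter fun x => (B.filter fun y => y < x).card < k).card = min k B.card := by
  induction B using Finset.induction_on_max with
  | empty => simp
  | insert a B hmax ih =>
    have ha : a ∉ B := fun h => lt_irrefl _ (hmax a h)
    have e1 : (insert a B).filter (fun y => y < a) = B := by
      ext y
      simp only [Finset.mem_filter, Finset.mem_insert]
      constructor
      · rintro ⟨rfl | h, h'⟩
        · exact absurd h' (lt_irrefl _)
        · exact h
      · exact fun h => ⟨Or.inr h, hmax y h⟩
    have e2 : ∀ x ∈ B, (insert a B).filter (fun y => y < x) = B.filter (fun y => y < x) := by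
      intro x hx
      rw [Finset.filter_insert, if_neg (hmax x hx).not_gt]
    have e3 : B.filter (fun x => ((insert a B).filter fun y => y < x).card < k) =
        B.filter (fun x => (B.filter fun y => y < x).card < k) :=
      Finset.filter_congr fun x hx => by rw [e2 x hx]
    rw [Finset.filter_insert, e1, e3, Finset.card_insert_of_notMem ha]
    split_ifs with h
    · rw [Finset.card_insert_of_notMem (by simp [ha]), ih]
      omega
    · rw [ih]; omega

section

variable {m : ℕ}

/-- The allocation of sequential posted prices: in the order of the indices, agents whose value is
at least their price are served until the `k` units run out. -/
noncomputable def seqAlloc (k : ℕ) (s : Fin m → ℝ) (v : Fin m → ℝ) (x : Fin m) : ℝ :=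
  if s x ≤ v x ∧ (Finset.univ.filter fun y => y < x ∧ s y ≤ v y).card < k then 1 else 0

lemma measurable_seqAlloc (k : ℕ) (s : Fin m → ℝ) (x : Fin m) :
    Measurable fun v => seqAlloc k s v x := by
  have h1 : ∀ y : Fin m, MeasurableSet {v : Fin m → ℝ | s y ≤ v y} := fun y =>
    measurableSet_le measurable_const (measurable_pi_apply y)
  have h2 : Measurable fun v : Fin m → ℝ =>
      (Finset.univ.filter fun y => y < x ∧ s y ≤ v y).card := by
    simp_rw [Finset.card_filter]
    refine Finset.measurable_sum _ fun y _ => Measurable.ite ?_ measurable_const measurable_const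
    exact (MeasurableSet.const _).inter (h1 y)
  exact Measurable.ite ((h1 x).inter (h2 measurableSet_Iio)) measurable_const measurable_const

lemma seqAlloc_nonneg (k : ℕ) (s v : Fin m → ℝ) (x : Fin m) : 0 ≤ seqAlloc k s v x := by
  unfold seqAlloc; split_ifs <;> simp

lemma seqAlloc_le_one (k : ℕ) (s v : Fin m → ℝ) (x : Fin m) : seqAlloc k s v x ≤ 1 := by
  unfold seqAlloc; split_ifs <;> simp

/-- Among the agents of a lower set of indices, the units sold are `min k` of those accepting. -/
lemma sum_seqAlloc (k : ℕ) (s v : Fin m → ℝ) (S : Finset (Fin m))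
    (hS : ∀ x ∈ S, ∀ y < x, y ∈ S) :
    ∑ x ∈ S, seqAlloc k s v x = cap k (S.filter fun x => s x ≤ v x).card := by
  have h1 := card_filter_rank_lt k (S.filter fun x => s x ≤ v x)
  have h2 : (S.filter fun x => s x ≤ v x).filter
      (fun x => ((S.filter fun x => s x ≤ v x).filter fun y => y < x).card < k) =
      S.filter fun x => s x ≤ v x ∧
        (Finset.univ.filter fun y => y < x ∧ s y ≤ v y).card < k := by
    rw [Finset.filter_filter]
    refine Finset.filter_congr fun x hx => ?_
    have : (S.filter fun x => s x ≤ v x).filter (fun y => y < x) =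
        Finset.univ.filter fun y => y < x ∧ s y ≤ v y := by
      ext y
      simp only [Finset.mem_filter, Finset.mem_univ, true_and]
      constructor
      · rintro ⟨⟨_, h⟩, h'⟩; exact ⟨h', h⟩
      · rintro ⟨h', h⟩; exact ⟨⟨hS x hx y h', h⟩, h'⟩
    rw [this]
  simp only [seqAlloc, cap]
  rw [Finset.sum_boole, ← h2, h1]
  push_cast
  rfl

/-- Whether a unit is left depends only on earlier agents, so the own report matters only through
the threshold `s x`. This makes posted prices incentive compatible. -/
lemma seqAlloc_update (k : ℕ) (s v : Fin m → ℝ) (x : Fin m) (t : ℝ) :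
    seqAlloc k s (Function.update v x t) x =
      if s x ≤ t then seqAlloc k s (Function.update v x (s x)) x else 0 := by
  have h : ∀ t, (Finset.univ.filter fun y => y < x ∧ s y ≤ Function.update v x t y) =
      Finset.univ.filter fun y => y < x ∧ s y ≤ v y := by
    intro t
    refine Finset.filter_congr fun y _ => and_congr_right fun hy => ?_
    rw [Function.update_of_ne hy.ne]
  simp only [seqAlloc, h, Function.update_self, le_refl, true_and]
  by_cases ht : s x ≤ t <;> simp [ht]

lemma integrable_seqAlloc (k : ℕ) (F : Fin m → ValueDist) (s : Fin m → ℝ) (x : Fin m) :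
    Integrable (fun v => seqAlloc k s v x) (jointLaw F) :=
  Integrable.of_bound (measurable_seqAlloc k s x).aestronglyMeasurable 1
    (Eventually.of_forall fun v => by
      rw [Real.norm_of_nonneg (seqAlloc_nonneg k s v x)]; exact seqAlloc_le_one k s v x)

lemma integrable_seqAlloc_update (k : ℕ) (F : Fin m → ValueDist) (s : Fin m → ℝ) (x : Fin m)
    (t : ℝ) : Integrable (fun v => seqAlloc k s (Function.update v x t) x) (jointLaw F) := by
  refine Integrable.of_bound (Measurable.aestronglyMeasurable ?_) 1
    (Eventually.of_forall fun v => by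
      rw [Real.norm_of_nonneg (seqAlloc_nonneg k s _ x)]; exact seqAlloc_le_one k s _ x)
  exact (measurable_seqAlloc k s x).comp ((measurePreserving_update F x).measurable.comp
    (measurable_const.prodMk measurable_id))

/-- Sequential posted pricing as a mechanism. -/
noncomputable def seqPricing (k : ℕ) (F : Fin m → ValueDist) (s : Fin m → ℝ) : Mechanism k F where
  alloc := seqAlloc k s
  pay v x := s x * seqAlloc k s v x
  measurable_alloc := measurable_pi_lambda _ fun x => measurable_seqAlloc k s x
  measurable_pay := measurable_pi_lambda _ fun x => (measurable_seqAlloc k s x).const_mul (s x)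
  alloc_mem v x := ⟨seqAlloc_nonneg k s v x, seqAlloc_le_one k s v x⟩
  alloc_sum_le v := by
    rw [sum_seqAlloc k s v Finset.univ fun _ _ _ _ => Finset.mem_univ _]
    exact cap_le _ _
  integrable_pay x := (integrable_seqAlloc k F s x).const_mul (s x)
  integrable_interim_pay x t _ := (integrable_seqAlloc_update k F s x t).const_mul (s x)
  incentive_compatible x t t' _ _ := by
    refine integral_mono
      (((integrable_seqAlloc_update k F s x t').const_mul t).sub
        ((integrable_seqAlloc_update k F s x t').const_mul (s x)))
      (((integrable_seqAlloc_update k F s x t).const_mul t).sub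
        ((integrable_seqAlloc_update k F s x t).const_mul (s x))) fun v => ?_
    simp only
    rw [seqAlloc_update k s v x t, seqAlloc_update k s v x t']
    have h0 := seqAlloc_nonneg k s (Function.update v x (s x)) x
    split_ifs with h1 h2 h2
    · rfl
    · nlinarith
    · nlinarith
    · rfl
  individually_rational x t _ := by
    refine integral_nonneg fun v => ?_
    simp only [Pi.zero_apply]
    rw [seqAlloc_update k s v x t]
    have h0 := seqAlloc_nonneg k s (Function.update v x (s x)) x
    split_ifs with h1
    · nlinarith
    · simp

/-- The optimal revenue is at least that of posting the prices `s` in decreasing order, which is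
decomposed along the price levels `g j`. -/
theorem le_OPT_of_levels (k : ℕ) (F : Fin m → ValueDist) {s : Fin m → ℝ} (hs : Antitone s)
    (Λ : Finset ℕ) (g d : ℕ → ℝ) (hsd : ∀ x, s x = ∑ j ∈ Λ, if g j ≤ s x then d j else 0) :
    ENNReal.ofReal (∑ j ∈ Λ, d j * bern (Finset.univ.filter fun x => g j ≤ s x)
      (fun x => (F x).tail (s x)) (cap k) 0) ≤ OPT k F := by
  refine le_iSup_of_le (seqPricing k F s) (ENNReal.ofReal_le_ofReal (le_of_eq ?_))
  -- Since prices decrease along the order, agents priced at `g j` or more come first. Their sales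
  -- are `min k` of their acceptances, whatever the later agents do.
  have h1 : ∀ v, ∑ x, s x * seqAlloc k s v x = ∑ j ∈ Λ, d j *
      cap k ((Finset.univ.filter fun x => g j ≤ s x).filter fun x => s x ≤ v x).card := by
    intro v
    have : ∀ x, s x * seqAlloc k s v x =
        ∑ j ∈ Λ, d j * (if g j ≤ s x then seqAlloc k s v x else 0) := by
      intro x
      conv_lhs => rw [hsd x]
      rw [Finset.sum_mul]
      refine Finset.sum_congr rfl fun j _ => ?_
      split_ifs <;> simp
    simp_rw [this]
    rw [Finset.sum_comm]
    refine Finset.sum_congr rfl fun j _ => ?_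
    rw [← Finset.mul_sum, ← Finset.sum_filter, sum_seqAlloc]
    intro x hx y hy
    rw [Finset.mem_filter] at hx ⊢
    exact ⟨Finset.mem_univ _, hx.2.trans (hs hy.le)⟩
  have hint : ∀ j ∈ Λ, Integrable (fun v : Fin m → ℝ => d j *
      cap k ((Finset.univ.filter fun x => g j ≤ s x).filter fun x => s x ≤ v x).card)
      (jointLaw F) := by
    intro j _
    refine Integrable.const_mul ?_ _
    have : ∀ v, cap k ((Finset.univ.filter fun x => g j ≤ s x).filter fun x => s x ≤ v x).card =
        ∑ x ∈ Finset.univ.filter (fun x => g j ≤ s x), seqAlloc k s v x := by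
      intro v
      rw [sum_seqAlloc]
      intro x hx y hy
      rw [Finset.mem_filter] at hx ⊢
      exact ⟨Finset.mem_univ _, hx.2.trans (hs hy.le)⟩
    simp_rw [this]
    exact integrable_finsetSum _ fun x _ => integrable_seqAlloc k F s x
  change _ = ∫ v, ∑ x, s x * seqAlloc k s v x ∂jointLaw F
  simp_rw [h1]
  rw [integral_finsetSum _ hint]
  refine Finset.sum_congr rfl fun j _ => ?_
  rw [integral_const_mul, integral_card_accept]

end
-- Lagrangian hull of a revenue curve
section Hull

/-- The Lagrangian hull of the revenue curve of `D` over finitely many price levels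
`g 0 > g 1 > ⋯ > g M`, where the prices above `g 0` are summarized by a revenue `A` sold at quantile
`0`. For the slope `g j` the optimal sales event is `E j` and its revenue is `V j`. -/
theorem exists_hull (D : ValueDist) {A : ℝ} (hA : 0 ≤ A) {g : ℕ → ℝ} (hg : StrictAnti g) (M : ℕ) :
    ∃ (E : ℕ → Set ℝ) (V : ℕ → ℝ), (∀ j, IsUpperSet (E j)) ∧ (∀ j, MeasurableSet (E j)) ∧
      E 0 = ∅ ∧ V 0 = A ∧
      (∀ j, (E j = ∅ ∧ V j = A) ∨ ∃ t, g j ≤ t ∧ E j = Ici t ∧ V j = t * D.tail t) ∧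
      (∀ j l, l ≤ M → (g l - g j) * D.tail (g l) ≤ V j - g j * D.law.real (E j)) ∧
      (∀ j l, V l - g j * D.law.real (E l) ≤ V j - g j * D.law.real (E j)) := by
  have hex : ∀ j, ∃ l ≤ M, ∀ l' ≤ M, (g l' - g j) * D.tail (g l') ≤ (g l - g j) * D.tail (g l) := by
    intro j
    obtain ⟨l, hl, hmax⟩ := Finset.exists_max_image (Finset.range (M + 1))
      (fun l => (g l - g j) * D.tail (g l)) ⟨0, by simp⟩
    exact ⟨l, Nat.lt_succ_iff.1 (Finset.mem_range.1 hl),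
      fun l' hl' => hmax l' (Finset.mem_range.2 (Nat.lt_succ_iff.2 hl'))⟩
  choose b hbM hb using hex
  -- When no grid price beats revenue `A` at quantile `0`, nothing is sold at slope `g j`. Ties go
  -- to the empty event, so the other case has a strictly positive margin and hence a price above `g
  -- j`.
  let P : ℕ → Prop := fun j => (g (b j) - g j) * D.tail (g (b j)) ≤ A
  classical
  let E : ℕ → Set ℝ := fun j => if P j then ∅ else Ici (g (b j))
  let V : ℕ → ℝ := fun j => if P j then A else g (b j) * D.tail (g (b j))
  have hEV : ∀ j, (P j ∧ E j = ∅ ∧ V j = A) ∨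
      (¬ P j ∧ E j = Ici (g (b j)) ∧ V j = g (b j) * D.tail (g (b j))) := by
    intro j
    by_cases h : P j
    · exact Or.inl ⟨h, if_pos h, if_pos h⟩
    · exact Or.inr ⟨h, if_neg h, if_neg h⟩
  have hP0 : P 0 := by
    have h1 : g (b 0) - g 0 ≤ 0 := sub_nonpos.2 (hg.antitone (Nat.zero_le _))
    exact (mul_nonpos_of_nonpos_of_nonneg h1 (D.tail_nonneg _)).trans hA
  have hopt : ∀ j l, l ≤ M → (g l - g j) * D.tail (g l) ≤ V j - g j * D.law.real (E j) := by
    intro j l hl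
    rcases hEV j with ⟨hP, h1, h2⟩ | ⟨_, h1, h2⟩
    · rw [h1, h2]; simpa using (hb j l hl).trans hP
    · rw [h1, h2]
      have := hb j l hl
      rw [sub_mul] at this ⊢
      rw [sub_mul] at this
      exact this
  have hoptA : ∀ j, A ≤ V j - g j * D.law.real (E j) := by
    intro j
    rcases hEV j with ⟨_, h1, h2⟩ | ⟨hP, h1, h2⟩
    · rw [h1, h2]; simp
    · rw [h1, h2]
      have : A < (g (b j) - g j) * D.tail (g (b j)) := not_le.1 hP
      rw [sub_mul] at this
      exact this.le
  refine ⟨E, V, fun j => ?_, fun j => ?_, if_pos hP0, if_pos hP0, fun j => ?_, hopt, fun j l => ?_⟩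
  · rcases hEV j with ⟨_, h1, _⟩ | ⟨_, h1, _⟩ <;> rw [h1]
    · exact isUpperSet_empty
    · exact isUpperSet_Ici _
  · rcases hEV j with ⟨_, h1, _⟩ | ⟨_, h1, _⟩ <;> rw [h1]
    · exact MeasurableSet.empty
    · exact measurableSet_Ici
  · rcases hEV j with ⟨_, h1, h2⟩ | ⟨hP, h1, h2⟩
    · exact Or.inl ⟨h1, h2⟩
    · refine Or.inr ⟨g (b j), ?_, h1, h2⟩
      by_contra hlt
      exact hP ((mul_nonpos_of_nonpos_of_nonneg (sub_nonpos.2 (not_le.1 hlt).le)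
        (D.tail_nonneg _)).trans hA)
  · rcases hEV l with ⟨_, h1, h2⟩ | ⟨_, h1, h2⟩
    · rw [h1, h2]; simpa using hoptA j
    · rw [h1, h2]
      have := hopt j (b l) (hbM l)
      rw [sub_mul] at this
      exact this

variable {g Q V : ℕ → ℝ} {A : ℝ}

/-- The concave upper bound of the revenue curve given by its hull. -/
noncomputable def hullBound (g Q : ℕ → ℝ) (M : ℕ) (q : ℝ) : ℝ :=
  g M * q + ∑ j ∈ Finset.range M, (g j - g (j + 1)) * min q (Q (j + 1))

/-- Adding the optimality conditions at two consecutive slopes, each tested against the other's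
optimum, gives `(g j - g (j + 1)) * (Q (j + 1) - Q j) ≥ 0`. -/
lemma quantile_monotone (hg : StrictAnti g) (hopt : ∀ j l, V l - g j * Q l ≤ V j - g j * Q j) :
    Monotone Q := by
  refine monotone_nat_of_le_succ fun j => ?_
  have h1 := hopt j (j + 1)
  have h2 := hopt (j + 1) j
  have h3 : 0 < g j - g (j + 1) := sub_pos.2 (hg (Nat.lt_succ_self j))
  by_contra hcon
  nlinarith

/-- For `q` between `Q j` and `Q (j + 1)` the hull has slope `g j`, so the supporting line of slope
`g j` through the optimum `(Q j, V j)` is the one that matters. Optimality at each slope bounds `V J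
- g J * Q J` by the accumulated increments. -/
lemma le_hullBound (hg : StrictAnti g) (hopt : ∀ j l, V l - g j * Q l ≤ V j - g j * Q j)
    (hV0 : V 0 = A) (hQ0 : Q 0 = 0) {y q : ℝ} (M : ℕ)
    (hy : ∀ j ≤ M, y ≤ V j + g j * (q - Q j)) : y ≤ A + hullBound g Q M q := by
  have hm := quantile_monotone hg hopt
  have hVle : ∀ J, V J - g J * Q J ≤ A + ∑ j ∈ Finset.range J, (g j - g (j + 1)) * Q (j + 1) := by
    intro J
    induction J with
    | zero => simp [hV0, hQ0]
    | succ J ih =>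
      rw [Finset.sum_range_succ]
      have := hopt J (J + 1)
      linarith
  induction M with
  | zero =>
    have := hy 0 le_rfl
    simp only [hullBound, Finset.range_zero, Finset.sum_empty, add_zero]
    rw [hQ0, hV0, sub_zero] at this
    exact this
  | succ M ih =>
    rcases le_total q (Q (M + 1)) with h | h
    · have := ih fun j hj => hy j (hj.trans (Nat.le_succ M))
      rw [hullBound] at this ⊢
      rw [Finset.sum_range_succ, min_eq_left h]
      linarith
    · have h1 := hy (M + 1) le_rfl
      have h2 := hVle (M + 1)
      have h3 : ∑ j ∈ Finset.range (M + 1), (g j - g (j + 1)) * min q (Q (j + 1)) =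
          ∑ j ∈ Finset.range (M + 1), (g j - g (j + 1)) * Q (j + 1) := by
        refine Finset.sum_congr rfl fun j hj => ?_
        rw [min_eq_right ((hm (Nat.succ_le_of_lt (Finset.mem_range.1 hj))).trans h)]
      rw [hullBound, h3]
      linarith

/-- A concave function vanishing at `0` has decreasing average slope. This transfers the bound at
the quantile of a grid price to smaller quantiles. -/
lemma mul_hullBound_le (hg : StrictAnti g) (hQ : ∀ j, 0 ≤ Q j) {h q : ℝ} (hh : 0 ≤ h) (hhq : h ≤ q)
    (M : ℕ) : h * hullBound g Q M q ≤ q * hullBound g Q M h := by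
  rw [hullBound, hullBound, mul_add, mul_add, Finset.mul_sum, Finset.mul_sum]
  refine add_le_add (le_of_eq (by ring)) (Finset.sum_le_sum fun j _ => ?_)
  have h1 : 0 ≤ g j - g (j + 1) := sub_nonneg.2 (hg (Nat.lt_succ_self j)).le
  have h2 : h * min q (Q (j + 1)) ≤ q * min h (Q (j + 1)) := by
    rw [mul_min_of_nonneg _ _ (hh.trans hhq)]
    refine le_min ?_ ?_
    · rw [mul_comm q h]; exact mul_le_mul_of_nonneg_left (min_le_left _ _) hh
    · exact mul_le_mul hhq (min_le_right _ _) (le_min (hh.trans hhq) (hQ _)) (hh.trans hhq)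
  calc h * ((g j - g (j + 1)) * min q (Q (j + 1))) = (g j - g (j + 1)) * (h * min q (Q (j + 1))) := by ring
    _ ≤ (g j - g (j + 1)) * (q * min h (Q (j + 1))) := mul_le_mul_of_nonneg_left h2 h1
    _ = _ := by ring

lemma hullBound_nonneg (hg : StrictAnti g) (hg0 : ∀ j, 0 < g j) (hQ : ∀ j, 0 ≤ Q j) {q : ℝ}
    (hq : 0 ≤ q) (M : ℕ) : 0 ≤ hullBound g Q M q :=
  add_nonneg (mul_nonneg (hg0 M).le hq) (Finset.sum_nonneg fun j _ =>
    mul_nonneg (sub_nonneg.2 (hg (Nat.lt_succ_self j)).le) (le_min hq (hQ _)))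

lemma exists_level {g : ℕ → ℝ} {t : ℝ} : ∀ M : ℕ, g M ≤ t → t < g 0 →
    ∃ l < M, g (l + 1) ≤ t ∧ t < g l := by
  intro M
  induction M with
  | zero => intro h1 h2; exact absurd h2 (not_lt.2 h1)
  | succ M ih =>
    intro h1 h2
    rcases lt_or_ge t (g M) with h | h
    · exact ⟨M, Nat.lt_succ_self M, h1, h⟩
    · obtain ⟨l, hl, h3⟩ := ih h h2
      exact ⟨l, hl.trans (Nat.lt_succ_self M), h3⟩

/-- The dual feasibility of the hull. -/
theorem mul_measure_le_hullBound (D : ValueDist) {B : ℝ} (hA : 0 ≤ A) (hg : StrictAnti g)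
    (hg0 : ∀ j, 0 < g j) (hB : 1 ≤ B) (hgB : ∀ j, g j ≤ B * g (j + 1))
    (hAtop : ∀ t, g 0 ≤ t → t * D.tail t ≤ A) (hQ : ∀ j, 0 ≤ Q j) {M : ℕ}
    (hle : ∀ l ≤ M, g l * D.tail (g l) ≤ A + hullBound g Q M (D.tail (g l))) {t h : ℝ}
    (ht : 0 ≤ t) (hh : 0 ≤ h) (hht : h ≤ D.tail t) :
    t * h ≤ B * (A + hullBound g Q M h) := by
  have hn := hullBound_nonneg hg hg0 hQ hh M
  have hS : 0 ≤ A + hullBound g Q M h := add_nonneg hA hn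
  have hBS : A + hullBound g Q M h ≤ B * (A + hullBound g Q M h) := le_mul_of_one_le_left hS hB
  rcases lt_or_ge t (g M) with htM | htM
  · refine le_trans ?_ hBS
    have h1 := mul_le_mul_of_nonneg_right htM.le hh
    have h2 : g M * h ≤ hullBound g Q M h := by
      refine le_add_of_nonneg_right (Finset.sum_nonneg fun j _ => ?_)
      exact mul_nonneg (sub_nonneg.2 (hg (Nat.lt_succ_self j)).le) (le_min hh (hQ _))
    linarith
  rcases le_or_gt (g 0) t with ht0 | ht0
  · refine le_trans ?_ hBS
    have h1 := mul_le_mul_of_nonneg_left hht ht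
    linarith [hAtop t ht0]
  -- Rounding `t` down to the grid price `g (l + 1)` costs the factor `B`.
  obtain ⟨l, hlM, hl1, hl2⟩ := exists_level M htM ht0
  set q := D.tail (g (l + 1)) with hq
  have hhq : h ≤ q := hht.trans (D.tail_anti hl1)
  have hq0 : 0 ≤ q := hh.trans hhq
  rcases hh.eq_or_lt with hz | hpos
  · rw [← hz] at hS ⊢
    rw [mul_zero]; exact mul_nonneg (by linarith) hS
  have hqpos : 0 < q := hpos.trans_le hhq
  have h1 : t ≤ B * g (l + 1) := hl2.le.trans (hgB l)
  have h2 := hle (l + 1) hlM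
  have h3 := mul_hullBound_le hg hQ hh hhq M
  have h4 : h * (g (l + 1) * q) ≤ q * (A + hullBound g Q M h) := by
    calc h * (g (l + 1) * q) ≤ h * (A + hullBound g Q M q) := mul_le_mul_of_nonneg_left h2 hh
      _ = h * A + h * hullBound g Q M q := by ring
      _ ≤ q * A + q * hullBound g Q M h := add_le_add (mul_le_mul_of_nonneg_right hhq hA) h3
      _ = _ := by ring
  have h5 : h * g (l + 1) ≤ A + hullBound g Q M h := by
    refine le_of_mul_le_mul_left ?_ hqpos
    linarith
  calc t * h ≤ B * g (l + 1) * h := mul_le_mul_of_nonneg_right h1 hh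
    _ = B * (h * g (l + 1)) := by ring
    _ ≤ _ := mul_le_mul_of_nonneg_left h5 (by linarith)

end Hull

/-! ### Optimal revenue bounded by sales at virtual-value levels -/

/-- The optimal revenue is bounded through the hulls of the agents' revenue curves by expected
numbers of sales at virtual-value levels. -/
theorem OPT_le_of_levels {k n : ℕ} {F : Fin n → ValueDist} {g : ℕ → ℝ} {B : ℝ} {M : ℕ}
    {A : Fin n → ℝ} {E : Fin n → ℕ → Set ℝ} (hA : ∀ i, 0 ≤ A i) (hg : StrictAnti g)
    (hg0 : ∀ j, 0 < g j) (hB : 0 ≤ B) (hEu : ∀ i j, IsUpperSet (E i j))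
    (hEm : ∀ i j, MeasurableSet (E i j))
    (hdual : ∀ i t h, 0 ≤ t → 0 ≤ h → h ≤ (F i).tail t →
      t * h ≤ B * (A i + hullBound g (fun j => (F i).law.real (E i j)) M h)) :
    OPT k F ≤ ENNReal.ofReal (B * (∑ i, A i + (g M * k + ∑ j ∈ Finset.range M, (g j - g (j + 1)) *
      bern Finset.univ (fun i => (F i).law.real (E i (j + 1))) (cap k) 0))) := by
  classical
  have hgd : ∀ j, 0 ≤ g j - g (j + 1) := fun j => sub_nonneg.2 (hg (Nat.lt_succ_self j)).le
  -- The ironed virtual value: its integral over an upper set `H` is `B * hullBound` at the quantile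
  -- of `H`.
  let ψ : Fin n → ℝ → ℝ := fun i x =>
    B * (g M + ∑ j ∈ Finset.range M, (E i (j + 1)).indicator (fun _ => g j - g (j + 1)) x)
  have hind0 : ∀ i j x, 0 ≤ (E i (j + 1)).indicator (fun _ => g j - g (j + 1)) x := fun i j x =>
    indicator_nonneg (fun _ _ => hgd j) x
  have hind1 : ∀ i j x, (E i (j + 1)).indicator (fun _ => g j - g (j + 1)) x ≤ g j - g (j + 1) :=
    fun i j x => indicator_apply_le' (fun _ => le_rfl) (fun _ => hgd j)
  have hψ0 : ∀ i x, 0 ≤ ψ i x := fun i x => mul_nonneg hB (add_nonneg (hg0 M).le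
    (Finset.sum_nonneg fun j _ => hind0 i j x))
  have hψm : ∀ i, Measurable (ψ i) := fun i => by
    refine Measurable.const_mul (Measurable.const_add (Finset.measurable_sum _ fun j _ => ?_) _) _
    exact measurable_const.indicator (hEm i (j + 1))
  refine OPT_le_of_revenue_le fun P => ?_
  have hrev := P.revenue_le ψ (fun i => B * A i) hψm
    (B * (g M + ∑ j ∈ Finset.range M, (g j - g (j + 1)))) hψ0 (fun i x => ?_)
    (fun i => mul_nonneg hB (hA i)) ?_
  · refine hrev.trans ?_
    rw [← Finset.mul_sum, mul_add B]
    refine add_le_add le_rfl ?_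
    let R : (Fin n → ℝ) → ℝ := fun v => B * (g M * k + ∑ j ∈ Finset.range M, (g j - g (j + 1)) *
      cap k (Finset.univ.filter fun i => v i ∈ E i (j + 1)).card)
    have hcm : ∀ j, Integrable (fun v : Fin n → ℝ =>
        cap k (Finset.univ.filter fun i => v i ∈ E i (j + 1)).card) (jointLaw F) := by
      intro j
      refine Integrable.of_bound (Measurable.aestronglyMeasurable ?_) k
        (Eventually.of_forall fun v => by
          rw [Real.norm_of_nonneg (cap_nonneg _ _)]; exact cap_le _ _)
      refine (measurable_from_top (f := cap k)).comp ?_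
      simp_rw [Finset.card_filter]
      exact Finset.measurable_sum _ fun i _ => Measurable.ite
        (measurable_pi_apply i (hEm i (j + 1))) measurable_const measurable_const
    have hcm' := fun j => (hcm j).const_mul (g j - g (j + 1))
    have hR : ∫ v, R v ∂jointLaw F = B * (g M * k + ∑ j ∈ Finset.range M, (g j - g (j + 1)) *
        bern Finset.univ (fun i => (F i).law.real (E i (j + 1))) (cap k) 0) := by
      simp only [R]
      rw [integral_const_mul, integral_add (integrable_const _)
        (integrable_finsetSum _ fun j _ => hcm' j), integral_finsetSum _ fun j _ => hcm' j]
      simp only [integral_const, probReal_univ, one_smul]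
      congr 2
      refine Finset.sum_congr rfl fun j _ => ?_
      rw [integral_const_mul, integral_card_mem F Finset.univ fun i => hEm i (j + 1)]
    rw [← hR]
    refine integral_mono_of_nonneg (Eventually.of_forall fun v => ?_) ?_
      (Eventually.of_forall fun v => ?_)
    · exact Finset.sum_nonneg fun i _ => mul_nonneg (hψ0 i _) (P.alloc_mem v i).1
    · exact ((integrable_const _).add (integrable_finsetSum _ fun j _ => hcm' j)).const_mul B
    · simp only [R, ψ]
      have e1 : ∑ i, B * (g M + ∑ j ∈ Finset.range M,
          (E i (j + 1)).indicator (fun _ => g j - g (j + 1)) (v i)) * P.alloc v i =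
          B * (g M * ∑ i, P.alloc v i + ∑ j ∈ Finset.range M, (g j - g (j + 1)) *
            ∑ i ∈ Finset.univ.filter (fun i => v i ∈ E i (j + 1)), P.alloc v i) := by
        have e2 : ∀ j, (g j - g (j + 1)) *
            ∑ i ∈ Finset.univ.filter (fun i => v i ∈ E i (j + 1)), P.alloc v i =
            ∑ i, (E i (j + 1)).indicator (fun _ => g j - g (j + 1)) (v i) * P.alloc v i := by
          intro j
          rw [Finset.sum_filter, Finset.mul_sum]
          refine Finset.sum_congr rfl fun i _ => ?_
          by_cases h : v i ∈ E i (j + 1) <;> simp [h]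
        simp_rw [e2]
        rw [Finset.sum_comm, Finset.mul_sum, ← Finset.sum_add_distrib, Finset.mul_sum]
        refine Finset.sum_congr rfl fun i _ => ?_
        rw [← Finset.sum_mul]
        ring
      rw [e1]
      refine mul_le_mul_of_nonneg_left (add_le_add ?_ (Finset.sum_le_sum fun j _ => ?_)) hB
      · exact mul_le_mul_of_nonneg_left (P.alloc_sum_le v) (hg0 M).le
      · refine mul_le_mul_of_nonneg_left (le_min ?_ ?_) (hgd j)
        · exact (Finset.sum_le_sum_of_subset_of_nonneg (Finset.subset_univ _)
            fun i _ _ => (P.alloc_mem v i).1).trans (P.alloc_sum_le v)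
        · calc _ ≤ ∑ i ∈ Finset.univ.filter (fun i => v i ∈ E i (j + 1)), (1 : ℝ) :=
                Finset.sum_le_sum fun i _ => (P.alloc_mem v i).2
            _ = _ := by simp
  · exact mul_le_mul_of_nonneg_left
      (add_le_add le_rfl (Finset.sum_le_sum fun j _ => hind1 i j x)) hB
  · intro i t H ht hHu hHm hHt
    have h1 := hdual i t ((F i).law.real H) ht measureReal_nonneg (measureReal_mono hHt)
    refine h1.trans (le_of_eq ?_)
    simp only [ψ]
    rw [integral_const_mul, integral_add (integrable_const _) (integrable_finsetSum _ fun j _ =>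
      (integrable_const _).indicator (hEm i (j + 1))), integral_finsetSum _ fun j _ =>
      (integrable_const _).indicator (hEm i (j + 1)), setIntegral_tail_const, hullBound]
    -- Upper sets of the line are nested, so the measure of the intersection is the minimum of the
    -- measures.
    have h2 : ∀ j, ∫ x in H, (E i (j + 1)).indicator (fun _ => g j - g (j + 1)) x ∂(F i).law =
        (g j - g (j + 1)) * min ((F i).law.real H) ((F i).law.real (E i (j + 1))) := by
      intro j
      rw [integral_indicator_const _ (hEm i (j + 1)), smul_eq_mul, mul_comm,
        measureReal_restrict_apply (hEm i (j + 1))]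
      congr 1
      rcases hHu.total (hEu i (j + 1)) with h | h
      · rw [inter_eq_right.2 h, min_eq_left (measureReal_mono h)]
      · rw [inter_eq_left.2 h, min_eq_right (measureReal_mono h)]
    simp_rw [h2]
    ring

/-! ### Instances of triangular agents with prescribed prices and quantiles -/

/-- The elements of a finite set can be listed in the order of decreasing prices. -/
lemma exists_sorted_embedding {κ : Type*} (S : Finset κ) (s : κ → ℝ) :
    ∃ (m : ℕ) (φ : Fin m ↪ κ), Finset.univ.map φ = S ∧ Antitone fun j => s (φ j) := by
  let e := S.equivFin
  let f : Fin S.card → ℝ := fun j => -s (e.symm j)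
  let π : Fin S.card ≃ Fin S.card := Tuple.sort f
  have hπ : Monotone (f ∘ π) := Tuple.monotone_sort f
  refine ⟨S.card, (π.trans e.symm).toEmbedding.trans (Function.Embedding.subtype _), ?_,
    fun a b hab => neg_le_neg_iff.1 (hπ hab)⟩
  ext x
  simp only [Finset.mem_map, Finset.mem_univ, true_and]
  constructor
  · rintro ⟨j, rfl⟩; exact (e.symm (π j)).2
  · intro hx
    exact ⟨π.symm (e ⟨x, hx⟩), by simp⟩

/-- Triangular agents with given monopoly prices `s x` and small monopoly quantiles `u x`, `x ∈ T`;
agents of quantile `0` are dropped. -/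
theorem exists_triangular_instance {κ : Type*} [DecidableEq κ] (k : ℕ) (T : Finset κ) {s u : κ → ℝ}
    (hs : ∀ x, 0 < s x) (hu0 : ∀ x, 0 ≤ u x) (hu1 : ∀ x, u x < 1) :
    ∃ (m : ℕ) (G : Fin m → ValueDist), (∀ j, (G j).Triangular) ∧
      (∀ c, (∀ x ∈ T, s x * u x ≤ c) → ∀ j, (G j).monopolyRevenue ≤ ENNReal.ofReal c) ∧
      (∀ p, 0 < p → ∃ q : κ → ℝ, (∀ x, 0 ≤ q x) ∧ (∀ x, q x ≤ 1) ∧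
        (∀ x, q x ≤ if p ≤ s x then s x * u x / p else 0) ∧
        APat k p G = p * bern T q (cap k) 0) ∧
      (∀ (Λ : Finset ℕ) (g d : ℕ → ℝ),
        (∀ x ∈ T, s x = ∑ j ∈ Λ, if g j ≤ s x then d j else 0) →
        ENNReal.ofReal (∑ j ∈ Λ, d j * bern (T.filter fun x => g j ≤ s x) u (cap k) 0) ≤
          OPT k G) := by
  set S := T.filter fun x => 0 < u x with hS
  obtain ⟨m, φ, hmap, hmono⟩ := exists_sorted_embedding S s
  have hφS : ∀ j, φ j ∈ S := fun j => by rw [← hmap]; exact Finset.mem_map_of_mem φ (Finset.mem_univ j)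
  have hφT : ∀ j, φ j ∈ T := fun j => (Finset.mem_filter.1 (hφS j)).1
  have hφu : ∀ j, 0 < u (φ j) := fun j => (Finset.mem_filter.1 (hφS j)).2
  -- Monopoly revenue `s x * u x` at quantile `u x` puts the monopoly price at `s x`.
  let Dx : ∀ x, 0 < u x → ValueDist := fun x hx => triDist (mul_pos (hs x) hx) hx (hu1 x)
  let G : Fin m → ValueDist := fun j => Dx (φ j) (hφu j)
  have hrq : ∀ x, 0 < u x → s x * u x / u x = s x := fun x hx => by field_simp
  refine ⟨m, G, fun j => triDist_triangular _ _ _, fun c hc j => ?_, fun p hp => ?_,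
    fun Λ g d hsd => ?_⟩
  · exact (triDist_monopolyRevenue_le _ _ _).trans (ENNReal.ofReal_le_ofReal (hc _ (hφT j)))
  · refine ⟨fun x => if h : 0 < u x then (Dx x h).tail p else 0, fun x => ?_, fun x => ?_,
      fun x => ?_, ?_⟩
    · simp only; split_ifs
      · exact ValueDist.tail_nonneg _ _
      · exact le_rfl
    · simp only; split_ifs
      · exact ValueDist.tail_le_one _ _
      · exact zero_le_one
    · simp only
      by_cases h : 0 < u x
      · rw [dif_pos h]
        have := triDist_tail_le (mul_pos (hs x) h) h (hu1 x) hp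
        rwa [hrq x h] at this
      · rw [dif_neg h]
        have : 0 ≤ s x * u x / p := div_nonneg (mul_nonneg (hs x).le (hu0 x)) hp.le
        split_ifs
        · exact this
        · exact le_rfl
    · rw [APat_eq, bern_subset (Finset.filter_subset (fun x => 0 < u x) T), ← hS, ← hmap, bern_map]
      · congr 1
        refine bern_congr (fun j _ => ?_) _ _
        rw [dif_pos (hφu j)]
      · intro x hx hxS
        rw [dif_neg]
        exact fun h => hxS (Finset.mem_filter.2 ⟨hx, h⟩)
  · have h1 := le_OPT_of_levels k G hmono Λ g d fun j => hsd (φ j) (hφT j)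
    convert h1 using 5 with j hj
    rw [bern_subset (S := S.filter fun x => g j ≤ s x), ← hmap, Finset.filter_map, bern_map]
    · refine bern_congr (fun j _ => ?_) _ _
      have := triDist_tail_monopoly (mul_pos (hs (φ j)) (hφu j)) (hφu j) (hu1 (φ j))
      rw [hrq _ (hφu j)] at this
      exact this.symm
    · exact Finset.filter_subset_filter _ (Finset.filter_subset _ _)
    · intro x hx hxS
      by_contra hne
      rw [Finset.mem_filter] at hx
      exact hxS (Finset.mem_filter.2 ⟨Finset.mem_filter.2 ⟨hx.1, (hu0 x).lt_of_ne (Ne.symm hne)⟩, hx.2⟩)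

/-! ### Splitting an agent into small triangular agents -/

lemma one_add_sum_le_prod_one_add {ι : Type*} (S : Finset ι) {f : ι → ℝ} (hf : ∀ i, 0 ≤ f i) :
    1 + ∑ i ∈ S, f i ≤ ∏ i ∈ S, (1 + f i) := by
  classical
  induction S using Finset.induction_on with
  | empty => simp
  | insert a S ha ih =>
    rw [Finset.sum_insert ha, Finset.prod_insert ha]
    have h1 := mul_le_mul_of_nonneg_left ih (by linarith [hf a] : 0 ≤ 1 + f a)
    have h2 := mul_nonneg (hf a) (Finset.sum_nonneg fun i (_ : i ∈ S) => hf i)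
    linarith

/-- Bounds the probability that none of `N` agents sharing the rate `ρ` accepts: `(1 - ρ/N)(1 + ρ/N)
≤ 1`, and `(1 + ρ/N) ^ N ≥ 1 + ρ` by Bernoulli's inequality. -/
lemma one_sub_div_pow_le {ρ : ℝ} {N : ℕ} (hN : 0 < N) (hρ0 : 0 ≤ ρ) (hρ : ρ ≤ N) :
    (1 - ρ / N) ^ N ≤ 1 / (1 + ρ) := by
  have hN' : (0 : ℝ) < N := by exact_mod_cast hN
  have h1 : 0 ≤ 1 - ρ / N := sub_nonneg.2 ((div_le_one hN').2 hρ)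
  have h0 : 0 ≤ ρ / N := by positivity
  rw [le_div_iff₀ (by linarith)]
  have h2 : 1 + ρ ≤ (1 + ρ / N) ^ N := by
    have := one_add_mul_le_pow (a := ρ / N) (by linarith) N
    rwa [mul_div_cancel₀ _ hN'.ne'] at this
  calc (1 - ρ / N) ^ N * (1 + ρ) ≤ (1 - ρ / N) ^ N * (1 + ρ / N) ^ N :=
        mul_le_mul_of_nonneg_left h2 (by positivity)
    _ = ((1 - ρ / N) * (1 + ρ / N)) ^ N := (mul_pow _ _ _).symm
    _ ≤ 1 := by
        refine pow_le_one₀ (mul_nonneg h1 (by linarith)) ?_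
        nlinarith

section Levels

variable {n : ℕ} {g : ℕ → ℝ} {A : Fin n → ℝ} {Q : Fin n → ℕ → ℝ} {θ : ℝ}

/-- The total rates of the triangular agents replacing agent `i` at price level `g j`. -/
noncomputable def rate (g : ℕ → ℝ) (A : Fin n → ℝ) (Q : Fin n → ℕ → ℝ) (θ : ℝ) (i : Fin n) : ℕ → ℝ
  | 0 => A i / g 0
  | j + 1 => (1 - θ) * (Q i (j + 1) - Q i j) / (1 - (1 - θ) * Q i (j + 1))

variable (hg0 : ∀ j, 0 < g j) (hA : ∀ i, 0 ≤ A i) (hQm : ∀ i, Monotone (Q i))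
  (hQ0 : ∀ i, Q i 0 = 0) (hQ1 : ∀ i j, Q i j ≤ 1) (hθ0 : 0 < θ) (hθ1 : θ < 1)

include hQ1 hθ0 hθ1 in
lemma one_sub_pos (i : Fin n) (j : ℕ) : 0 < 1 - (1 - θ) * Q i j := by
  have h1 := mul_le_mul_of_nonneg_left (hQ1 i j) (sub_nonneg.2 hθ1.le)
  linarith

include hg0 hA hQm hQ1 hθ0 hθ1 in
lemma rate_nonneg (i : Fin n) (j : ℕ) : 0 ≤ rate g A Q θ i j := by
  cases j with
  | zero => exact div_nonneg (hA i) (hg0 0).le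
  | succ j =>
    exact div_nonneg (mul_nonneg (sub_nonneg.2 hθ1.le) (sub_nonneg.2 (hQm i (Nat.le_succ j))))
      (one_sub_pos hQ1 hθ0 hθ1 i (j + 1)).le

include hg0 hA hQm hQ0 hQ1 hθ0 hθ1 in
-- The rates are chosen so that `1 + rate` is the quotient of consecutive values of `1 - (1 - θ) *
-- Q`, and the product telescopes. The thinning by `1 - θ` keeps the denominators positive even when
-- `Q = 1`.
lemma prod_rate_le (i : Fin n) (j : ℕ) :
    ∏ l ∈ Finset.Ico 1 (j + 1), 1 / (1 + rate g A Q θ i l) ≤ 1 - (1 - θ) * Q i j := by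
  induction j with
  | zero => simp [hQ0]
  | succ j ih =>
    have h1 := one_sub_pos hQ1 hθ0 hθ1 i (j + 1)
    have h2 := one_sub_pos hQ1 hθ0 hθ1 i j
    have h3 : 1 + rate g A Q θ i (j + 1) =
        (1 - (1 - θ) * Q i j) / (1 - (1 - θ) * Q i (j + 1)) := by
      rw [rate, eq_div_iff h1.ne', add_mul, div_mul_cancel₀ _ h1.ne']
      ring
    rw [Finset.prod_Ico_succ_top (by omega)]
    calc _ ≤ (1 - (1 - θ) * Q i j) * (1 / (1 + rate g A Q θ i (j + 1))) := by
          refine mul_le_mul_of_nonneg_right ih ?_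
          have := rate_nonneg hg0 hA hQm hQ1 hθ0 hθ1 i (j + 1)
          positivity
      _ = _ := by rw [h3]; field_simp

/-- The quantiles of the triangular agents: `N` agents share the rate of every level up to `M`. -/
noncomputable def splitRate (ρ : Fin n → ℕ → ℝ) (M N : ℕ) (x : Fin n × ℕ × ℕ) : ℝ :=
  if x.2.1 ≤ M then ρ x.1 x.2.1 / N else 0

lemma prod_one_sub_splitRate (ρ : Fin n → ℕ → ℝ) {M N : ℕ} (i : Fin n) (S : Finset ℕ)
    (hS : ∀ l ∈ S, l ≤ M) :
    ∏ y ∈ S ×ˢ Finset.range N, (1 - splitRate ρ M N (i, y)) = ∏ l ∈ S, (1 - ρ i l / N) ^ N := by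
  rw [Finset.prod_product]
  refine Finset.prod_congr rfl fun l hl => ?_
  simp only [splitRate, if_pos (hS l hl), Finset.prod_const, Finset.card_range]

include hg0 hA hQm hQ0 hQ1 hθ0 hθ1 in
/-- The number of triangular agents accepting prices of level at least `g j`. -/
theorem le_bern_splitRate {k M N : ℕ} (hk : 1 ≤ k) (hN : 0 < N)
    (hρN : ∀ i, ∀ j ≤ M, rate g A Q θ i j ≤ N) {j : ℕ} (hj : j ≤ M) :
    ((1 - θ) * bern Finset.univ (fun i => Q i j) (cap k) 0 + ∑ i, A i / g 0) /
        (1 + ∑ i, A i / g 0) ≤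
      bern (Finset.univ ×ˢ (Finset.range (j + 1) ×ˢ Finset.range N))
        (splitRate (rate g A Q θ) M N) (cap k) 0 := by
  set u := splitRate (rate g A Q θ) M N with hu
  set σ := ∑ i, A i / g 0 with hσ
  have hN' : (0 : ℝ) < N := by exact_mod_cast hN
  have hρ0 := rate_nonneg hg0 hA hQm hQ1 hθ0 hθ1
  have hσ0 : 0 ≤ σ := Finset.sum_nonneg fun i _ => div_nonneg (hA i) (hg0 0).le
  have hu0 : ∀ x, 0 ≤ u x := by
    intro x
    simp only [hu, splitRate]
    split_ifs
    · exact div_nonneg (hρ0 _ _) hN'.le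
    · exact le_rfl
  have hu1 : ∀ x, u x ≤ 1 := by
    intro x
    simp only [hu, splitRate]
    split_ifs with h
    · exact (div_le_one hN').2 (hρN _ _ h)
    · exact zero_le_one
  have hQnn : ∀ i, 0 ≤ Q i j := fun i => by
    rw [← hQ0 i]; exact hQm i (Nat.zero_le j)
  have hsplit : (Finset.univ : Finset (Fin n)) ×ˢ (Finset.range (j + 1) ×ˢ Finset.range N) =
      Finset.univ ×ˢ (({0} : Finset ℕ) ×ˢ Finset.range N) ∪
        Finset.univ ×ˢ (Finset.Ico 1 (j + 1) ×ˢ Finset.range N) := by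
    ext ⟨i, l, c⟩
    simp only [Finset.mem_product, Finset.mem_univ, true_and, Finset.mem_range, Finset.mem_union,
      Finset.mem_singleton, Finset.mem_Ico]
    constructor
    · rintro ⟨h1, h2⟩
      rcases Nat.eq_zero_or_pos l with h | h
      · exact Or.inl ⟨h, h2⟩
      · exact Or.inr ⟨⟨h, h1⟩, h2⟩
    · rintro (⟨rfl, h⟩ | ⟨⟨_, h1⟩, h2⟩)
      · exact ⟨Nat.succ_pos j, h⟩
      · exact ⟨h1, h2⟩
  have hdisj : Disjoint ((Finset.univ : Finset (Fin n)) ×ˢ (({0} : Finset ℕ) ×ˢ Finset.range N))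
      (Finset.univ ×ˢ (Finset.Ico 1 (j + 1) ×ˢ Finset.range N)) := by
    rw [Finset.disjoint_left]
    rintro ⟨i, l, c⟩ h1 h2
    simp only [Finset.mem_product, Finset.mem_singleton, Finset.mem_Ico] at h1 h2
    omega
  rw [hsplit, bern_union hdisj]
  set S1 := (Finset.univ : Finset (Fin n)) ×ˢ (Finset.Ico 1 (j + 1) ×ˢ Finset.range N)
  -- Some agent of level `0` accepts with probability at least `σ / (1 + σ)`, and then at least one
  -- unit is sold. Otherwise the levels from `1` to `j` alone provide the thinned original sales.
  have hP : ∏ x ∈ (Finset.univ : Finset (Fin n)) ×ˢ (({0} : Finset ℕ) ×ˢ Finset.range N),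
      (1 - u x) ≤ 1 - σ / (1 + σ) := by
    rw [Finset.prod_product]
    calc ∏ i, ∏ y ∈ ({0} : Finset ℕ) ×ˢ Finset.range N, (1 - u (i, y))
        = ∏ i, (1 - A i / g 0 / N) ^ N := by
          refine Finset.prod_congr rfl fun i _ => ?_
          rw [hu, prod_one_sub_splitRate _ _ _ (by simp)]
          simp [rate]
      _ ≤ ∏ i, 1 / (1 + A i / g 0) := by
          refine Finset.prod_le_prod (fun i _ => ?_) fun i _ => ?_
          · refine pow_nonneg (sub_nonneg.2 ((div_le_one hN').2 ?_)) N
            exact hρN i 0 (Nat.zero_le M)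
          · exact one_sub_div_pow_le hN (div_nonneg (hA i) (hg0 0).le) (hρN i 0 (Nat.zero_le M))
      _ = 1 / ∏ i, (1 + A i / g 0) := by
          rw [Finset.prod_div_distrib, Finset.prod_const_one]
      _ ≤ 1 / (1 + σ) := by
          refine one_div_le_one_div_of_le (by linarith) ?_
          exact one_add_sum_le_prod_one_add _ fun i => div_nonneg (hA i) (hg0 0).le
      _ = 1 - σ / (1 + σ) := by field_simp; ring
  have h1 := linear_le_bern hu0 hu1 (bern_monotone (S := S1) hu0 hu1 (cap_monotone k)) hP 0
  have h2 : 1 ≤ bern S1 u (cap k) (0 + 1) := by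
    rw [bern_succ, ← bern_const S1 u 1 0]
    exact bern_le_bern hu0 hu1 (fun x => one_le_cap hk (by omega)) 0
  have hq0 : ∀ i, 0 ≤ (1 - θ) * Q i j := fun i => mul_nonneg (sub_nonneg.2 hθ1.le) (hQnn i)
  have hq1 : ∀ i, (1 - θ) * Q i j ≤ 1 := fun i => by linarith [one_sub_pos hQ1 hθ0 hθ1 i j]
  have h3 : bern Finset.univ (fun i => (1 - θ) * Q i j) (cap k) 0 ≤ bern S1 u (cap k) 0 := by
    refine le_bern_prod hu0 hu1 hq0 hq1 (fun i _ => ?_) (cap_monotone k) 0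
    have hle : ∀ l ∈ Finset.Ico 1 (j + 1), l ≤ M := fun l hl => by
      rw [Finset.mem_Ico] at hl; omega
    rw [hu, prod_one_sub_splitRate _ _ _ hle]
    refine le_trans (Finset.prod_le_prod (fun l hl => ?_) fun l hl => ?_)
      (prod_rate_le hg0 hA hQm hQ0 hQ1 hθ0 hθ1 i j)
    · exact pow_nonneg (sub_nonneg.2 ((div_le_one hN').2 (hρN i l (hle l hl)))) N
    · exact one_sub_div_pow_le hN (hρ0 i l) (hρN i l (hle l hl))
  have h4 := bern_thin (S := Finset.univ) hQnn (fun i => hQ1 i j) (cap_concave k)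
    (sub_nonneg.2 hθ1.le) (by linarith : 1 - θ ≤ 1) 0
  rw [cap_zero, sub_zero, sub_zero] at h4
  have h5 := h4.trans h3
  have h6 : 0 ≤ σ / (1 + σ) := by positivity
  have h7 : 1 - σ / (1 + σ) = 1 / (1 + σ) := by field_simp; ring
  rw [h7] at h1
  have h8 : 0 ≤ 1 / (1 + σ) := by positivity
  have h9 := mul_le_mul_of_nonneg_left h5 h8
  have h10 := mul_le_mul_of_nonneg_left h2 h6
  calc _ = 1 / (1 + σ) * ((1 - θ) * bern Finset.univ (fun i => Q i j) (cap k) 0) +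
        σ / (1 + σ) * 1 := by ring
    _ ≤ _ := by linarith

end Levels

/-- The decomposition of the prices `g 0 > ⋯ > g M` into increments. -/
noncomputable def levelGap (g : ℕ → ℝ) (M j : ℕ) : ℝ := if j < M then g j - g (j + 1) else g M

lemma sum_levelGap (g : ℕ → ℝ) {M l : ℕ} (hl : l ≤ M) :
    ∑ j ∈ Finset.Ico l (M + 1), levelGap g M j = g l := by
  have h1 : ∀ M', l ≤ M' → M' ≤ M → ∑ j ∈ Finset.Ico l M', levelGap g M j = g l - g M' := by
    intro M' hl' hM'
    induction M', hl' using Nat.le_induction with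
    | base => simp
    | succ j hj ih =>
      rw [Finset.sum_Ico_succ_top hj, ih (by omega), levelGap, if_pos (by omega)]
      ring
  rw [Finset.sum_Ico_succ_top hl, h1 M hl le_rfl, levelGap, if_neg (lt_irrefl M)]
  ring

lemma sum_levelGap_ite {g : ℕ → ℝ} (hg : StrictAnti g) {M l : ℕ} (hl : l ≤ M) :
    g l = ∑ j ∈ Finset.range (M + 1), if g j ≤ g l then levelGap g M j else 0 := by
  rw [← Finset.sum_filter]
  conv_lhs => rw [← sum_levelGap g hl]
  congr 1
  ext j
  simp only [Finset.mem_Ico, Finset.mem_filter, Finset.mem_range, hg.le_iff_ge]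
  tauto

/-- The accumulated revenue rate of the triangular agents replacing a quasi-regular agent is
controlled by the revenue of the original agent. -/
theorem sum_rate_le {n : ℕ} {g : ℕ → ℝ} {A : Fin n → ℝ} {E : Fin n → ℕ → Set ℝ} {V : ℕ → ℝ}
    {θ δ p : ℝ} {D : ValueDist} {Q : Fin n → ℕ → ℝ} {i : Fin n}
    (hQ : ∀ j, Q i j = D.law.real (E i j)) (hg : StrictAnti g) (hg0 : ∀ j, 0 < g j)
    (hQm : Monotone (Q i)) (hθ0 : 0 < θ) (hθ1 : θ < 1) (hδ1 : δ < 1)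
    (hD : D.QuasiRegular) (hp : 0 < p) (hpδ : D.tail p ≤ δ) (hV0 : V 0 = A i)
    (hEV : ∀ j, (E i j = ∅ ∧ V j = A i) ∨ ∃ t, g j ≤ t ∧ E i j = Ici t ∧ V j = t * D.tail t)
    (hopt : ∀ j l, V l - g j * Q i l ≤ V j - g j * Q i j)
    (hA : 0 ≤ A i) (hAp : p ≤ g 0 → A i * (1 - D.tail p) ≤ p * D.tail p) (M : ℕ) :
    (1 - δ) ^ 2 * ∑ j ∈ Finset.range (M + 1), (if p ≤ g j then g j * rate g A Q θ i j else 0) ≤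
      p * D.tail p := by
  have h1δ : 0 < 1 - δ := by linarith
  have hpt : 0 ≤ p * D.tail p := mul_nonneg hp.le (D.tail_nonneg p)
  have hQδ : ∀ j, p ≤ g j → Q i j ≤ δ := by
    intro j hj
    rw [hQ]
    rcases hEV j with ⟨h, _⟩ | ⟨t, ht, h, _⟩
    · rw [h]; simpa using (D.tail_nonneg p).trans hpδ
    · rw [h]; exact (D.tail_anti (hj.trans ht)).trans hpδ
  -- The first factor `1 - δ`: the hull value is the revenue of a price above `p`, or `A i`, and
  -- quasi-regularity compares it with the revenue at `p`.
  have hVp : ∀ j, p ≤ g j → V j * (1 - δ) ≤ p * D.tail p := by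
    intro j hj
    have hmain : V j * (1 - D.tail p) ≤ p * D.tail p := by
      rcases hEV j with ⟨_, h⟩ | ⟨t, ht, _, h⟩
      · rw [h]; exact hAp (hj.trans (hg.antitone (Nat.zero_le j)))
      · rw [h]; exact hD.tail_le hp (hj.trans ht)
    rcases le_or_gt (V j) 0 with h | h
    · exact (mul_nonpos_of_nonpos_of_nonneg h h1δ.le).trans hpt
    · exact (mul_le_mul_of_nonneg_left (by linarith) h.le).trans hmain
  -- The second factor `1 - δ` pays for the denominator of the rate. Optimality at slope `g (j + 1)`
  -- bounds the price times the quantile increment by an increment of `V`, and these telescope.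
  have hrate : ∀ j, p ≤ g (j + 1) → (1 - δ) * (g (j + 1) * rate g A Q θ i (j + 1)) ≤
      V (j + 1) - V j := by
    intro j hj
    have hq := hQδ (j + 1) hj
    have hq0 : 0 ≤ Q i (j + 1) := by rw [hQ]; exact measureReal_nonneg
    have hw : 0 ≤ Q i (j + 1) - Q i j := sub_nonneg.2 (hQm (Nat.le_succ j))
    have h2 : 1 - δ ≤ 1 - (1 - θ) * Q i (j + 1) := by nlinarith
    have h3 : (1 - δ) * rate g A Q θ i (j + 1) ≤ Q i (j + 1) - Q i j := by
      rw [rate, ← mul_div_assoc, div_le_iff₀ (h1δ.trans_le h2)]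
      have h4 : (1 - θ) * (Q i (j + 1) - Q i j) ≤ Q i (j + 1) - Q i j :=
        mul_le_of_le_one_left hw (by linarith)
      calc (1 - δ) * ((1 - θ) * (Q i (j + 1) - Q i j)) ≤ (1 - δ) * (Q i (j + 1) - Q i j) :=
            mul_le_mul_of_nonneg_left h4 h1δ.le
        _ = (Q i (j + 1) - Q i j) * (1 - δ) := mul_comm _ _
        _ ≤ _ := mul_le_mul_of_nonneg_left h2 hw
    have h5 := mul_le_mul_of_nonneg_left h3 (hg0 (j + 1)).le
    have h6 := hopt (j + 1) j
    linarith
  have hacc : ∀ J, p ≤ g J →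
      (1 - δ) * ∑ j ∈ Finset.range (J + 1), (if p ≤ g j then g j * rate g A Q θ i j else 0) ≤
        V J := by
    intro J
    induction J with
    | zero =>
      intro h0
      have hA0 : g 0 * rate g A Q θ i 0 = V 0 := by
        rw [rate, hV0, mul_div_cancel₀ _ (hg0 0).ne']
      rw [Finset.sum_range_one, if_pos h0, hA0]
      have hV0' : 0 ≤ V 0 := by

        rcases hEV 0 with ⟨_, h⟩ | ⟨t, ht, _, h⟩
        · rw [h]; exact hA
        · rw [h]; exact mul_nonneg ((hg0 0).le.trans ht) (D.tail_nonneg t)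
      have hδ0 : 0 ≤ δ := (D.tail_nonneg p).trans hpδ
      nlinarith
    | succ J ih =>
      intro hJ
      have hJ' : p ≤ g J := hJ.trans (hg.antitone (Nat.le_succ J))
      rw [Finset.sum_range_succ, if_pos hJ, mul_add]
      linarith [ih hJ', hrate J hJ]
  -- Levels below `p` contribute nothing, so the sum ends at the last level that is at least `p`.
  induction M with
  | zero =>
    by_cases h : p ≤ g 0
    · have h1 := mul_le_mul_of_nonneg_left (hacc 0 h) h1δ.le
      linarith [hVp 0 h]
    · simp [h, hpt]
  | succ M ih =>
    by_cases h : p ≤ g (M + 1)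
    · have h1 := mul_le_mul_of_nonneg_left (hacc (M + 1) h) h1δ.le
      linarith [hVp (M + 1) h]
    · rw [Finset.sum_range_succ, if_neg h, add_zero]
      exact ih

/-! ### Triangular approximation of an instance -/

lemma APat_le_mul (k : ℕ) {n : ℕ} (F : Fin n → ValueDist) {p : ℝ} (hp : 0 ≤ p) :
    APat k p F ≤ p * k := by
  rw [APat_eq]
  refine mul_le_mul_of_nonneg_left ?_ hp
  rw [← bern_const Finset.univ (fun i => (F i).tail p) k 0]
  exact bern_le_bern (fun i => (F i).tail_nonneg p) (fun i => (F i).tail_le_one p)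
    (fun x => cap_le k x) 0

lemma exists_large_price {n : ℕ} (F : Fin n → ValueDist) (a : ℝ) {θ : ℝ} (hθ : 0 < θ) :
    ∃ τ, a ≤ τ ∧ ∑ i, (F i).tail τ / (1 - (F i).tail τ) ≤ θ := by
  have h1 : Tendsto (fun τ => ∑ i, (F i).tail τ / (1 - (F i).tail τ)) atTop
      (𝓝 (∑ _i : Fin n, (0 : ℝ) / (1 - 0))) :=
    tendsto_finsetSum _ fun i _ => (F i).tendsto_tail.div
      (tendsto_const_nhds.sub (F i).tendsto_tail) (by norm_num)
  simp only [zero_div, Finset.sum_const_zero] at h1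
  obtain ⟨τ, h2, h3⟩ := ((h1.eventually_le_const hθ).and (eventually_ge_atTop a)).exists
  exact ⟨τ, h3, h2⟩

lemma bern_cap_nonneg {ι : Type*} [DecidableEq ι] (k : ℕ) {S : Finset ι} {q : ι → ℝ}
    (h0 : ∀ i, 0 ≤ q i) (h1 : ∀ i, q i ≤ 1) : 0 ≤ bern S q (cap k) 0 := by
  rw [← bern_const S q 0 0]
  exact bern_le_bern h0 h1 (fun x => cap_nonneg k x) 0

/-- Enough pieces make every quantile `ρ / N` less than `1` and every monopoly revenue `g j * ρ / N`
at most `c`. -/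
lemma exists_splitting {n : ℕ} (ρ : Fin n → ℕ → ℝ) {g : ℕ → ℝ} (hg0 : ∀ j, 0 < g j)
    (hρ0 : ∀ i j, 0 ≤ ρ i j) (M : ℕ) {c : ℝ} (hc : 0 < c) :
    ∃ N : ℕ, 0 < N ∧ (∀ i, ∀ j ≤ M, ρ i j < N) ∧ ∀ i, ∀ j ≤ M, g j * ρ i j ≤ c * N := by
  obtain ⟨N, hN⟩ := exists_nat_gt (∑ i, ∑ j ∈ Finset.range (M + 1), (ρ i j + g j * ρ i j / c))
  have hterm : ∀ i j, 0 ≤ g j * ρ i j / c := fun i j =>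
    div_nonneg (mul_nonneg (hg0 j).le (hρ0 i j)) hc.le
  have hsum0 : ∀ i, 0 ≤ ∑ j ∈ Finset.range (M + 1), (ρ i j + g j * ρ i j / c) := fun i =>
    Finset.sum_nonneg fun j _ => add_nonneg (hρ0 i j) (hterm i j)
  have hle : ∀ i, ∀ j ≤ M, ρ i j + g j * ρ i j / c < N := by
    intro i j hj
    refine lt_of_le_of_lt ?_ hN
    refine le_trans ?_ (Finset.single_le_sum (fun i _ => hsum0 i) (Finset.mem_univ i))
    exact Finset.single_le_sum (f := fun j => ρ i j + g j * ρ i j / c)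
      (fun j _ => add_nonneg (hρ0 i j) (hterm i j)) (Finset.mem_range.2 (Nat.lt_succ_of_le hj))
  refine ⟨N, ?_, fun i j hj => ?_, fun i j hj => ?_⟩
  · have : (0 : ℝ) < N := lt_of_le_of_lt (Finset.sum_nonneg fun i _ => hsum0 i) hN
    exact_mod_cast this
  · linarith [hle i j hj, hterm i j]
  · have h1 : g j * ρ i j / c ≤ N := by linarith [hle i j hj, hρ0 i j]
    rw [div_le_iff₀ hc] at h1
    linarith

/-- Numerical bookkeeping of the discretization losses. -/
lemma discretization_loss {θ δ O S W Z R σ : ℝ} (hδ1 : δ < 1) (hδ0 : 0 < δ) (hθ : θ = δ / 16)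
    (hS : 0 ≤ S) (hW : 0 ≤ W) (hσ0 : 0 ≤ σ) (hσ : σ ≤ θ) (hR : (1 - θ) * W + S ≤ (1 + σ) * R)
    (hZ : Z ≤ (1 + θ) * W) (hO : O ≤ (1 + θ) * (S + (θ * O + Z))) : O ≤ (1 + δ) * R := by
  have hθ0 : 0 < θ := by rw [hθ]; positivity
  have hθ1 : θ ≤ 1 / 16 := by rw [hθ]; linarith
  have hδθ : δ = 16 * θ := by rw [hθ]; ring
  have hR0 : 0 ≤ R := by
    have h1 : 0 ≤ (1 + σ) * R := le_trans (add_nonneg (mul_nonneg (by linarith) hW) hS) hR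
    exact nonneg_of_mul_nonneg_right h1 (by linarith)
  have hX : (1 - θ) * (W + S) ≤ (1 + θ) * R := by
    have h1 : (1 + σ) * R ≤ (1 + θ) * R := mul_le_mul_of_nonneg_right (by linarith) hR0
    have h2 := mul_nonneg hθ0.le hS
    linarith
  have hO' : O * (1 - θ - θ ^ 2) ≤ (1 + θ) ^ 2 * (W + S) := by
    have h1 := mul_le_mul_of_nonneg_left hZ (by linarith : 0 ≤ 1 + θ)
    have h2 := mul_nonneg hθ0.le hS
    have h3 := mul_nonneg (sq_nonneg θ) hS
    nlinarith
  have h3 : (1 - θ) * (O * (1 - θ - θ ^ 2)) ≤ (1 + θ) ^ 3 * R := by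
    calc (1 - θ) * (O * (1 - θ - θ ^ 2)) ≤ (1 - θ) * ((1 + θ) ^ 2 * (W + S)) :=
          mul_le_mul_of_nonneg_left hO' (by linarith)
      _ = (1 + θ) ^ 2 * ((1 - θ) * (W + S)) := by ring
      _ ≤ (1 + θ) ^ 2 * ((1 + θ) * R) := mul_le_mul_of_nonneg_left hX (by positivity)
      _ = _ := by ring
  have hpos : 0 < (1 - θ) * (1 - θ - θ ^ 2) := by
    apply mul_pos <;> nlinarith
  -- Here `δ = 16 * θ` leaves enough room: `1 + 7θ ≤ (1 + 16θ)(1 - 3θ)` for `θ ≤ 1/16`.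
  have h4 : (1 + θ) ^ 3 ≤ (1 + δ) * ((1 - θ) * (1 - θ - θ ^ 2)) := by
    have e1 : (1 + θ) ^ 3 ≤ 1 + 7 * θ := by nlinarith [mul_nonneg hθ0.le hθ0.le]
    have e2 : 1 - 3 * θ ≤ (1 - θ) * (1 - θ - θ ^ 2) := by nlinarith [mul_nonneg hθ0.le hθ0.le]
    have e3 := mul_le_mul_of_nonneg_left e2 (by linarith : 0 ≤ 1 + δ)
    have e4 : 1 + 7 * θ ≤ (1 + δ) * (1 - 3 * θ) := by rw [hδθ]; nlinarith
    linarith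
  have h5 := mul_le_mul_of_nonneg_right h4 hR0
  refine le_of_mul_le_mul_left ?_ hpos
  linarith

/-- A quasi-regular instance whose agents rarely have values above `a` is approximated by
arbitrarily small triangular agents, as far as the optimal revenue and the revenue of anonymous
prices above `a` are concerned. -/
theorem exists_triangular_approx {k n : ℕ} (hk : 1 ≤ k) {F : Fin n → ValueDist}
    (hF : ∀ i, (F i).QuasiRegular) {O δ a c : ℝ} (hδ0 : 0 < δ) (hδ1 : δ < 1) (ha : 0 < a)
    (hc : 0 < c) (hO : OPT k F = ENNReal.ofReal O) (hO0 : 0 < O)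
    (htail : ∀ i, (F i).tail a ≤ δ) :
    ∃ (m : ℕ) (G : Fin m → ValueDist), (∀ j, (G j).Triangular) ∧
      (∀ j, (G j).monopolyRevenue ≤ ENNReal.ofReal c) ∧
      OPT k F ≤ ENNReal.ofReal (1 + δ) * OPT k G ∧
      ∀ p, a ≤ p → (1 - δ) ^ 2 * APat k p G ≤ APat k p F := by
  set θ := δ / 16 with hθ
  have hθ0 : 0 < θ := by positivity
  have hθ1 : θ < 1 := by rw [hθ]; linarith
  have hB0 : 0 < 1 + θ := by linarith
  have hk' : (0 : ℝ) < k := by exact_mod_cast hk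
  obtain ⟨τ, haτ, hτ⟩ := exists_large_price F a hθ0
  have hτ0 : 0 < τ := ha.trans_le haτ
  have htailp : ∀ i p, a ≤ p → (F i).tail p ≤ δ := fun i p hp =>
    ((F i).tail_anti hp).trans (htail i)
  have h1t : ∀ i p, a ≤ p → 0 < 1 - (F i).tail p := fun i p hp => by linarith [htailp i p hp]
  let g : ℕ → ℝ := fun j => τ / (1 + θ) ^ j
  have hgz : g 0 = τ := by simp [g]
  have hg0 : ∀ j, 0 < g j := fun j => by positivity
  have hgs : ∀ j, g j = (1 + θ) * g (j + 1) := fun j => by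
    simp only [g, pow_succ]; field_simp
  have hg : StrictAnti g := strictAnti_nat_of_succ_lt fun j => by
    rw [hgs j]; nlinarith [hg0 (j + 1)]
  -- The grid reaches down to a price at which selling all `k` units is negligible.
  obtain ⟨M, hM⟩ : ∃ M, g M * k ≤ θ * O := by
    obtain ⟨M, hM⟩ := exists_pow_lt_of_lt_one (show 0 < θ * O / (τ * k) by positivity)
      (show 1 / (1 + θ) < 1 by rw [div_lt_one hB0]; linarith)
    refine ⟨M, ?_⟩
    rw [lt_div_iff₀ (by positivity), one_div_pow] at hM
    calc g M * k = 1 / (1 + θ) ^ M * (τ * k) := by simp only [g]; ring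
      _ ≤ _ := hM.le
  -- The bound that quasi-regularity gives for revenues above `τ`. With the quotient kept, `odds_le`
  -- also compares it with the revenue at any `p ≤ τ`.
  let A : Fin n → ℝ := fun i => τ * ((F i).tail τ / (1 - (F i).tail τ))
  have hA : ∀ i, 0 ≤ A i := fun i =>
    mul_nonneg hτ0.le (div_nonneg ((F i).tail_nonneg τ) (h1t i τ haτ).le)
  have hAg : ∀ i, A i / g 0 = (F i).tail τ / (1 - (F i).tail τ) := fun i => by
    rw [hgz]; simp only [A]; field_simp
  have hAtop : ∀ i t, g 0 ≤ t → t * (F i).tail t ≤ A i := by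
    intro i t ht
    rw [hgz] at ht
    simp only [A]
    rw [← mul_div_assoc, le_div_iff₀ (h1t i τ haτ)]
    exact (hF i).tail_le hτ0 ht
  choose E V hEu hEm hE0 hV0 hEV hoptg hopt using fun i => exists_hull (F i) (hA i) hg M
  let Q : Fin n → ℕ → ℝ := fun i j => (F i).law.real (E i j)
  have hQ0 : ∀ i, Q i 0 = 0 := fun i => by simp [Q, hE0]
  have hQnn : ∀ i j, 0 ≤ Q i j := fun i j => measureReal_nonneg
  have hQ1 : ∀ i j, Q i j ≤ 1 := fun i j => measureReal_le_one
  have hQm : ∀ i, Monotone (Q i) := fun i => quantile_monotone hg (hopt i)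
  have hm0 : ∀ j, 0 ≤ bern Finset.univ (fun i => Q i j) (cap k) 0 := fun j =>
    bern_cap_nonneg k (fun i => hQnn i j) fun i => hQ1 i j
  have hupper : O ≤ (1 + θ) * (∑ i, A i + (g M * k + ∑ j ∈ Finset.range M, (g j - g (j + 1)) *
      bern Finset.univ (fun i => Q i (j + 1)) (cap k) 0)) := by
    have h1 := OPT_le_of_levels (k := k) (M := M) hA hg hg0 hB0.le hEu hEm
      fun i t h ht hh hht => mul_measure_le_hullBound (F i) (hA i) hg hg0
        (by linarith : 1 ≤ 1 + θ) (fun j => (hgs j).le) (hAtop i) (hQnn i) (fun l hl =>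
          le_hullBound hg (hopt i) (hV0 i) (hQ0 i) M fun j _ => by
            have := hoptg i j l hl
            linarith) ht hh hht
    rw [hO] at h1
    rcases ENNReal.ofReal_le_ofReal_iff'.1 h1 with h | h
    · exact h
    · exact absurd hO0 (not_lt.2 h)
  set ρ := rate g A Q θ with hρ
  have hρ0 : ∀ i j, 0 ≤ ρ i j := rate_nonneg hg0 hA hQm hQ1 hθ0 hθ1
  obtain ⟨N, hN, hρN, hgN⟩ := exists_splitting ρ hg0 hρ0 M hc
  have hN' : (0 : ℝ) < N := by exact_mod_cast hN
  let T : Finset (Fin n × ℕ × ℕ) :=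
    Finset.univ ×ˢ (Finset.range (M + 1) ×ˢ Finset.range N)
  have hTM : ∀ x ∈ T, x.2.1 ≤ M := fun x hx => by
    simp only [T, Finset.mem_product, Finset.mem_range] at hx; omega
  set u := splitRate ρ M N with hu
  have hu0 : ∀ x, 0 ≤ u x := fun x => by
    simp only [hu, splitRate]
    split_ifs
    · exact div_nonneg (hρ0 _ _) hN'.le
    · exact le_rfl
  have hu1 : ∀ x, u x < 1 := fun x => by
    simp only [hu, splitRate]
    split_ifs with h
    · exact (div_lt_one hN').2 (hρN _ _ h)
    · exact zero_lt_one
  obtain ⟨m, G, hGtri, hGrev, hGAP, hGOPT⟩ := exists_triangular_instance k T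
    (s := fun x => g x.2.1) (fun x => hg0 _) hu0 hu1
  refine ⟨m, G, hGtri, hGrev c fun x hx => ?_, ?_, fun p hp => ?_⟩
  · simp only [hu, splitRate]
    rw [if_pos (hTM x hx), ← mul_div_assoc, div_le_iff₀ hN']
    exact hgN _ _ (hTM x hx)
  · have hlow := hGOPT (Finset.range (M + 1)) g (levelGap g M)
      fun x hx => sum_levelGap_ite hg (hTM x hx)
    set R := ∑ j ∈ Finset.range (M + 1), levelGap g M j *
      bern (T.filter fun x => g j ≤ g x.2.1) u (cap k) 0 with hR
    set W := ∑ j ∈ Finset.range (M + 1), levelGap g M j *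
      bern Finset.univ (fun i => Q i j) (cap k) 0 with hW
    have hd0 : ∀ j, 0 ≤ levelGap g M j := fun j => by
      unfold levelGap
      split_ifs
      · exact sub_nonneg.2 (hg (Nat.lt_succ_self j)).le
      · exact (hg0 M).le
    have hW0 : 0 ≤ W := Finset.sum_nonneg fun j _ => mul_nonneg (hd0 j) (hm0 j)
    set σ := ∑ i, A i / g 0 with hσ
    have hσ0 : 0 ≤ σ := Finset.sum_nonneg fun i _ => div_nonneg (hA i) (hg0 0).le
    have hσθ : σ ≤ θ := by
      rw [hσ]; simp_rw [hAg]; exact hτ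
    have hσS : σ * g 0 = ∑ i, A i := by
      rw [hσ, Finset.sum_mul]
      exact Finset.sum_congr rfl fun i _ => div_mul_cancel₀ _ (hg0 0).ne'
    have hRW : (1 - θ) * W + ∑ i, A i ≤ (1 + σ) * R := by
      have h1 : ∀ j ∈ Finset.range (M + 1), levelGap g M j *
          ((1 - θ) * bern Finset.univ (fun i => Q i j) (cap k) 0 + σ) ≤
          levelGap g M j * ((1 + σ) * bern (T.filter fun x => g j ≤ g x.2.1) u (cap k) 0) := by
        intro j hj
        have hjM : j ≤ M := Nat.lt_succ_iff.1 (Finset.mem_range.1 hj)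
        refine mul_le_mul_of_nonneg_left ?_ (hd0 j)
        have hfil : T.filter (fun x => g j ≤ g x.2.1) =
            Finset.univ ×ˢ (Finset.range (j + 1) ×ˢ Finset.range N) := by
          ext ⟨i, l, c⟩
          simp only [T, Finset.mem_filter, Finset.mem_product, Finset.mem_univ, true_and,
            Finset.mem_range, hg.le_iff_ge]
          omega
        have h2 := le_bern_splitRate hg0 hA hQm hQ0 hQ1 hθ0 hθ1 hk hN
          (fun i j hj => (hρN i j hj).le) hjM
        rw [← hσ, div_le_iff₀ (by linarith)] at h2
        rw [hfil]
        linarith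
      have h3 := Finset.sum_le_sum h1
      have h4 : ∑ j ∈ Finset.range (M + 1), levelGap g M j *
          ((1 - θ) * bern Finset.univ (fun i => Q i j) (cap k) 0 + σ) =
          (1 - θ) * W + σ * ∑ j ∈ Finset.range (M + 1), levelGap g M j := by
        rw [hW, Finset.mul_sum, Finset.mul_sum, ← Finset.sum_add_distrib]
        exact Finset.sum_congr rfl fun j _ => by ring
      have h5 : ∑ j ∈ Finset.range (M + 1), levelGap g M j *
          ((1 + σ) * bern (T.filter fun x => g j ≤ g x.2.1) u (cap k) 0) = (1 + σ) * R := by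
        rw [hR, Finset.mul_sum]
        exact Finset.sum_congr rfl fun j _ => by ring
      have h6 : ∑ j ∈ Finset.range (M + 1), levelGap g M j = g 0 := by
        rw [Finset.range_eq_Ico]; exact sum_levelGap g (Nat.zero_le M)
      rw [h4, h5, h6, hσS] at h3
      exact h3
    -- The dual pairs the gap `g j - g (j + 1)` with the event of level `j + 1`, the pricing with
    -- that of level `j`. On a geometric grid this shift costs the factor `1 + θ`.
    have hZW : ∑ j ∈ Finset.range M, (g j - g (j + 1)) *
        bern Finset.univ (fun i => Q i (j + 1)) (cap k) 0 ≤ (1 + θ) * W := by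
      rw [hW, Finset.sum_range_succ', mul_add, Finset.mul_sum]
      refine le_add_of_le_of_nonneg (Finset.sum_le_sum fun j _ => ?_)
        (mul_nonneg hB0.le (mul_nonneg (hd0 0) (hm0 0)))
      rw [← mul_assoc]
      refine mul_le_mul_of_nonneg_right ?_ (hm0 (j + 1))
      have h1 : g (j + 1) - g (j + 1 + 1) ≤ levelGap g M (j + 1) := by
        unfold levelGap
        split_ifs with h
        · exact le_rfl
        · have : j + 1 = M := by
            have := Finset.mem_range.1 ‹_›
            omega
          rw [this]; linarith [hg0 (M + 1)]
      calc g j - g (j + 1) = (1 + θ) * (g (j + 1) - g (j + 1 + 1)) := by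
            rw [mul_sub, ← hgs, ← hgs]
        _ ≤ _ := mul_le_mul_of_nonneg_left h1 hB0.le
    have hS0 : 0 ≤ ∑ i, A i := Finset.sum_nonneg fun i _ => hA i
    have hfinal := discretization_loss hδ1 hδ0 hθ hS0 hW0 hσ0 hσθ hRW hZW
      (hupper.trans (mul_le_mul_of_nonneg_left (by linarith) hB0.le))
    rw [hO]
    calc ENNReal.ofReal O ≤ ENNReal.ofReal ((1 + δ) * R) := ENNReal.ofReal_le_ofReal hfinal
      _ = ENNReal.ofReal (1 + δ) * ENNReal.ofReal R := ENNReal.ofReal_mul (by linarith)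
      _ ≤ _ := by gcongr
  · have hp0 : 0 < p := ha.trans_le hp
    obtain ⟨q, hq0, hq1, hq, hAPq⟩ := hGAP p hp0
    have hδ2 : 0 ≤ (1 - δ) ^ 2 := sq_nonneg _
    have hδ3 : (1 - δ) ^ 2 ≤ 1 := by nlinarith
    -- After thinning by `(1 - δ) ^ 2`, the pieces of agent `i` have total demand at most `(F
    -- i).tail p`. By concavity they then sell no more than the original agents.
    have h1 := bern_thin (S := T) hq0 hq1 (cap_concave k) hδ2 hδ3 0
    rw [cap_zero, sub_zero, sub_zero] at h1
    have h2 : bern T (fun x => (1 - δ) ^ 2 * q x) (cap k) 0 ≤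
        bern Finset.univ (fun i => (F i).tail p) (cap k) 0 := by
      refine bern_prod_le (fun x => mul_nonneg hδ2 (hq0 x))
        (fun x => mul_le_one₀ hδ3 (hq0 x) (hq1 x)) (fun i => (F i).tail_nonneg p)
        (fun i => (F i).tail_le_one p) (fun i _ => ?_) (cap_monotone k) (cap_concave k) 0
      have h3 := sum_rate_le (D := (F i)) (E := E) (V := V i) (Q := Q) (i := i) (A := A) (θ := θ)
        (fun j => rfl) hg hg0 (hQm i) hθ0 hθ1 hδ1 (hF i) hp0 (htailp i p hp) (hV0 i) (hEV i)
        (hopt i) (hA i) (fun hpg => by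
          rw [hgz] at hpg
          have := (hF i).odds_le hp0 hpg
          simp only [A]
          rw [← mul_div_assoc, div_mul_eq_mul_div, div_le_iff₀ (h1t i τ haτ)]
          exact this) M
      rw [← Finset.mul_sum]
      have h4 : ∑ y ∈ Finset.range (M + 1) ×ˢ Finset.range N, q (i, y) ≤
          (∑ j ∈ Finset.range (M + 1), (if p ≤ g j then g j * ρ i j else 0)) / p := by
        rw [Finset.sum_product, Finset.sum_div]
        refine Finset.sum_le_sum fun j hj => ?_
        have hjM : j ≤ M := Nat.lt_succ_iff.1 (Finset.mem_range.1 hj)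
        have h5 : ∀ c ∈ Finset.range N, q (i, j, c) ≤
            (if p ≤ g j then g j * ρ i j else 0) / p / N := by
          intro c _
          refine (hq (i, j, c)).trans (le_of_eq ?_)
          simp only [hu, splitRate, if_pos hjM]
          split_ifs
          · field_simp
          · simp
        refine (Finset.sum_le_sum h5).trans (le_of_eq ?_)
        rw [Finset.sum_const, Finset.card_range, nsmul_eq_mul, mul_div_cancel₀ _ hN'.ne']
      calc (1 - δ) ^ 2 * ∑ y ∈ Finset.range (M + 1) ×ˢ Finset.range N, q (i, y)
          ≤ (1 - δ) ^ 2 *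
            ((∑ j ∈ Finset.range (M + 1), (if p ≤ g j then g j * ρ i j else 0)) / p) :=
            mul_le_mul_of_nonneg_left h4 hδ2
        _ = (1 - δ) ^ 2 *
            (∑ j ∈ Finset.range (M + 1), (if p ≤ g j then g j * ρ i j else 0)) / p := by ring
        _ ≤ (F i).tail p := by
            rw [div_le_iff₀ hp0]; linarith
    rw [hAPq, APat_eq]
    have h5 := mul_le_mul_of_nonneg_left (h1.trans h2) hp0.le
    linarith

/-! ### Comparison of the approximation ratios -/

lemma pos_of_OPT_ne_zero {k m : ℕ} {G : Fin m → ValueDist} (h : OPT k G ≠ 0) : 0 < m := by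
  rcases Nat.eq_zero_or_pos m with rfl | hm
  · refine absurd (le_antisymm (iSup_le fun P => ?_) (zero_le)) h
    simp [Mechanism.revenue]
  · exact hm

/-- Triangular instances can be arbitrarily large markets. -/
theorem exists_large_triangular {k : ℕ} (hk : 1 ≤ k) {ε : ℝ} (hε : 0 < ε) :
    ∃ (m : ℕ) (G : Fin m → ValueDist), 0 < m ∧ (∀ j, (G j).Triangular) ∧ IsLarge k ε G := by
  -- Identical agents with monopoly price `1` and quantile `u`, numerous enough that posting price
  -- `1` sells with probability at least `1/2`. The optimum is then at least `1/2`, and `u ≤ ε / 2`.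
  set u : ℝ := min ε 1 / 2 with hu
  have hu0 : 0 < u := by positivity
  have hu1 : u < 1 := by linarith [min_le_right ε 1]
  have huε : u ≤ ε * (1 / 2) := by linarith [min_le_left ε 1]
  obtain ⟨N, hN⟩ := exists_pow_lt_of_lt_one (show (0 : ℝ) < 1 / 2 by norm_num)
    (show 1 - u < 1 by linarith)
  obtain ⟨m, G, hG, hrev, -, hopt⟩ := exists_triangular_instance k (Finset.range N)
    (s := fun _ => 1) (u := fun _ => u) (fun _ => one_pos) (fun _ => hu0.le) (fun _ => hu1)
  have h1 := hopt {0} (fun _ => 1) (fun _ => 1) (fun x _ => by simp)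
  have h2 := linear_le_bern (S := Finset.range N) (q := fun _ => u) (Q := 1 / 2)
    (fun _ => hu0.le) (fun _ => hu1.le) (cap_monotone k)
    (by rw [Finset.prod_const, Finset.card_range]; linarith) 0
  have h3 : (1 : ℝ) ≤ cap k (0 + 1) := one_le_cap hk le_rfl
  have h4 : ENNReal.ofReal (1 / 2) ≤ OPT k G := by
    refine le_trans (ENNReal.ofReal_le_ofReal ?_) h1
    simp only [le_refl, Finset.filter_true, Finset.sum_singleton, one_mul]
    rw [cap_zero] at h2
    linarith
  refine ⟨m, G, pos_of_OPT_ne_zero (k := k) (G := G) ?_, hG, fun j => ?_⟩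
  · exact ((ENNReal.ofReal_pos.2 (by norm_num)).trans_le h4).ne'
  · calc (G j).monopolyRevenue ≤ ENNReal.ofReal (ε * (1 / 2)) :=
          hrev _ (fun x _ => by rw [one_mul]; exact huε) j
      _ = ENNReal.ofReal ε * ENNReal.ofReal (1 / 2) := ENNReal.ofReal_mul hε.le
      _ ≤ _ := by gcongr

/-- Large quasi-regular markets are approximated by large triangular markets. -/
theorem exists_triangular_ratio {k : ℕ} {γ : ℝ} (hk : 1 ≤ k) (hγ : GapBound k γ) {ε : ℝ}
    (hε : 0 < ε) (hε1 : ε < 1 / (γ * k * logUnits k)) {n : ℕ} {F : Fin n → ValueDist}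
    (hF : ∀ i, (F i).QuasiRegular) (hlarge : IsLarge k ε F) :
    ∃ (m : ℕ) (G : Fin m → ValueDist), 0 < m ∧ (∀ j, (G j).Triangular) ∧ IsLarge k ε G ∧
      ratio k F ≤
        ENNReal.ofReal
          ((1 + ε * γ * k * logUnits k) / (1 - ε * γ * k * logUnits k) ^ 2) * ratio k G := by
  -- This covers `OPT = 0` and `AP = ⊤`, where any large triangular market will do. Otherwise the
  -- gap bound makes `OPT` and `AP` positive and finite.
  by_cases hr : ratio k F = 0
  · obtain ⟨m, G, h1, h2, h3⟩ := exists_large_triangular hk hε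
    exact ⟨m, G, h1, h2, h3, by rw [hr]; exact zero_le⟩
  have hOPT0 : OPT k F ≠ 0 := fun h => hr (by rw [ratio, h, ENNReal.zero_div])
  have hAPtop : AP k F ≠ ⊤ := fun h => hr (by rw [ratio, h, ENNReal.div_top])
  have hgap := hγ n F hF
  have hAP0 : AP k F ≠ 0 := fun h => hOPT0 (by rw [h, mul_zero] at hgap; exact le_antisymm hgap (zero_le))
  have hOPTtop : OPT k F ≠ ⊤ :=
    ne_top_of_le_ne_top (ENNReal.mul_ne_top ENNReal.ofReal_ne_top hAPtop) hgap
  have hk' : (0 : ℝ) < k := by exact_mod_cast hk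
  have hl := logUnits_pos k
  -- The sign of `γ` is not assumed; for a nonpositive product the bound on `ε` would be
  -- nonpositive.
  have hpos : 0 < γ * k * logUnits k := by
    by_contra h
    have := div_nonpos_of_nonneg_of_nonpos zero_le_one (not_lt.1 h)
    linarith
  have hγl : 0 < γ * logUnits k := by
    have : γ * k * logUnits k = k * (γ * logUnits k) := by ring
    rw [this] at hpos
    exact pos_of_mul_pos_right hpos hk'.le
  set δ := ε * γ * k * logUnits k with hδ
  have hδ' : δ = ε * (γ * k * logUnits k) := by rw [hδ]; ring
  have hδ0 : 0 < δ := by rw [hδ']; positivity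
  have hδ1 : δ < 1 := by rw [hδ']; exact (lt_div_iff₀ hpos).1 hε1
  set O := (OPT k F).toReal with hO
  set α := (AP k F).toReal with hα
  have hOeq : OPT k F = ENNReal.ofReal O := (ENNReal.ofReal_toReal hOPTtop).symm
  have hαeq : AP k F = ENNReal.ofReal α := (ENNReal.ofReal_toReal hAPtop).symm
  have hO0 : 0 < O := ENNReal.toReal_pos hOPT0 hOPTtop
  have hα0 : 0 < α := ENNReal.toReal_pos hAP0 hAPtop
  have hOα : O ≤ γ * logUnits k * α := by
    rw [hOeq, hαeq, ← ENNReal.ofReal_mul hγl.le,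
      ENNReal.ofReal_le_ofReal_iff (mul_nonneg hγl.le hα0.le)] at hgap
    exact hgap
  have ha : 0 < α / k := by positivity
  -- The revenue of price `α / k` from one agent is at most `ε * OPT ≤ ε * γ * logUnits k * α`;
  -- dividing by `α / k` gives `δ`.
  have htail : ∀ i, (F i).tail (α / k) ≤ δ := by
    intro i
    have h1 := ((F i).mul_tail_le_monopolyRevenue (α / k)).trans (hlarge i)
    rw [hOeq, ← ENNReal.ofReal_mul hε.le,
      ENNReal.ofReal_le_ofReal_iff (mul_nonneg hε.le hO0.le)] at h1
    have h2 : α / k * (F i).tail (α / k) ≤ α / k * δ := by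
      calc _ ≤ ε * O := h1
        _ ≤ ε * (γ * logUnits k * α) := mul_le_mul_of_nonneg_left hOα hε.le
        _ = α / k * δ := by rw [hδ]; field_simp
    exact le_of_mul_le_mul_left h2 ha
  -- The new optimum is at least `O / (1 + δ)`, so this bound `c` on the monopoly revenues makes the
  -- new market `ε`-large.
  obtain ⟨m, G, hGtri, hGrev, hGOPT, hGAP⟩ := exists_triangular_approx hk hF hδ0 hδ1 ha
    (c := ε * (O / (1 + δ))) (by positivity) hOeq hO0 htail
  have hδp : 0 < 1 + δ := by linarith
  have hδ2 : 0 < (1 - δ) ^ 2 := pow_pos (by linarith) 2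
  have hOG : ENNReal.ofReal (O / (1 + δ)) ≤ OPT k G := by
    rw [ENNReal.ofReal_div_of_pos hδp, ← hOeq]
    exact ENNReal.div_le_of_le_mul' hGOPT
  have hAPG : AP k G ≤ ENNReal.ofReal (1 / (1 - δ) ^ 2) * AP k F := by
    rw [hαeq, ← ENNReal.ofReal_mul (by positivity)]
    refine iSup₂_le fun p hp => ENNReal.ofReal_le_ofReal ?_
    rw [div_mul_eq_mul_div, one_mul, le_div_iff₀ hδ2]
    rcases le_or_gt (α / k) p with h | h
    · rw [mul_comm]
      exact (hGAP p h).trans (APat_le_toReal hAPtop hp)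
    -- A price below `α / k` earns at most `α` even if all units are sold.
    · have h1 := APat_le_mul k G hp
      have h2 : p * k ≤ α := ((lt_div_iff₀ hk').1 h).le
      have h3 : (1 - δ) ^ 2 ≤ 1 := by nlinarith
      calc APat k p G * (1 - δ) ^ 2 ≤ α * (1 - δ) ^ 2 :=
            mul_le_mul_of_nonneg_right (h1.trans h2) hδ2.le
        _ ≤ α := mul_le_of_le_one_right hα0.le h3
  refine ⟨m, G, pos_of_OPT_ne_zero (k := k) (G := G) ?_, hGtri, fun j => ?_, ?_⟩
  · exact ((ENNReal.ofReal_pos.2 (by positivity)).trans_le hOG).ne'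
  · calc (G j).monopolyRevenue ≤ ENNReal.ofReal (ε * (O / (1 + δ))) := hGrev j
      _ = ENNReal.ofReal ε * ENNReal.ofReal (O / (1 + δ)) := ENNReal.ofReal_mul hε.le
      _ ≤ _ := by gcongr
  · set C := ENNReal.ofReal (1 / (1 - δ) ^ 2) with hC
    have hC0 : C ≠ 0 := (ENNReal.ofReal_pos.2 (by positivity)).ne'
    have hCtop : C ≠ ⊤ := ENNReal.ofReal_ne_top
    have h1 : (AP k F)⁻¹ ≤ C * (AP k G)⁻¹ := by
      calc (AP k F)⁻¹ = C * (C * AP k F)⁻¹ := by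
            rw [ENNReal.mul_inv (Or.inl hC0) (Or.inl hCtop), ← mul_assoc,
              ENNReal.mul_inv_cancel hC0 hCtop, one_mul]
        _ ≤ C * (AP k G)⁻¹ := by gcongr
    have h2 : ENNReal.ofReal ((1 + δ) / (1 - δ) ^ 2) = ENNReal.ofReal (1 + δ) * C := by
      rw [hC, ← ENNReal.ofReal_mul hδp.le, mul_one_div]
    rw [h2, ratio, ratio, div_eq_mul_inv, div_eq_mul_inv]
    calc OPT k F * (AP k F)⁻¹ ≤ (ENNReal.ofReal (1 + δ) * OPT k G) * (C * (AP k G)⁻¹) :=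
          mul_le_mul' hGOPT h1
      _ = _ := by ring

/-! ### The large-market limit -/

lemma worstRatio_mono_prop (k : ℕ) {P P' : ValueDist → Prop} (h : ∀ D, P D → P' D) (ε : ℝ) :
    worstRatio k P ε ≤ worstRatio k P' ε :=
  iSup_mono fun _ => iSup_mono fun _ => iSup_mono' fun hF => ⟨fun i => h _ (hF i), le_rfl⟩

lemma worstRatio_monotone (k : ℕ) (P : ValueDist → Prop) : Monotone (worstRatio k P) := by
  intro ε ε' hε
  refine iSup_mono fun _ => iSup_mono fun F => iSup_mono fun _ => iSup_mono' fun hl => ⟨?_, le_rfl⟩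
  exact fun i => (hl i).trans (by gcongr)

lemma worstRatio_quasiRegular_le {k : ℕ} {γ : ℝ} (hγ : GapBound k γ) (ε : ℝ) :
    worstRatio k ValueDist.QuasiRegular ε ≤ ENNReal.ofReal (γ * logUnits k) :=
  iSup_le fun n => iSup_le fun F => iSup_le fun hF => iSup_le fun _ =>
    ENNReal.div_le_of_le_mul (hγ n F hF)

/-- In the limit of large markets the worst case over quasi-regular distributions is attained by
triangular distributions. -/
theorem exists_tendsto_worstRatio {k : ℕ} (hk : 1 ≤ k) : ∃ L : ℝ≥0∞, L ≠ ⊤ ∧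
    Tendsto (worstRatio k ValueDist.QuasiRegular) (𝓝[>] 0) (𝓝 L) ∧
    Tendsto (worstRatio k ValueDist.Triangular) (𝓝[>] 0) (𝓝 L) := by
  obtain ⟨γ, hγ0, hγ⟩ := exists_gapBound
  have hgap := hγ k hk
  have hk' : (0 : ℝ) < k := by exact_mod_cast hk
  have hl := logUnits_pos k
  have hle : ∀ ε, worstRatio k ValueDist.Triangular ε ≤ worstRatio k ValueDist.QuasiRegular ε :=
    worstRatio_mono_prop k fun _ h => h.quasiRegular
  -- A larger `ε` admits more instances, so the right limit at `0` exists and is the infimum. The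
  -- quasi-regular ratio is squeezed between the triangular one and `C ε` times it.
  have hT := (worstRatio_monotone k ValueDist.Triangular).tendsto_nhdsGT 0
  set L := sInf (worstRatio k ValueDist.Triangular '' Ioi 0)
  have hL : L ≠ ⊤ := by
    refine ne_top_of_le_ne_top ENNReal.ofReal_ne_top (b := ENNReal.ofReal (γ * logUnits k)) ?_
    have h1 : L ≤ worstRatio k ValueDist.Triangular 1 :=
      sInf_le (mem_image_of_mem _ (mem_Ioi.2 one_pos))
    exact h1.trans ((hle 1).trans (worstRatio_quasiRegular_le hgap 1))
  refine ⟨L, hL, ?_, hT⟩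
  let C : ℝ → ℝ := fun ε => (1 + ε * γ * k * logUnits k) / (1 - ε * γ * k * logUnits k) ^ 2
  have hC : Tendsto (fun ε => ENNReal.ofReal (C ε)) (𝓝[>] 0) (𝓝 1) := by
    have h1 : ContinuousAt C 0 := by
      refine ContinuousAt.div (by fun_prop) (by fun_prop) (by simp)
    have h2 : C 0 = 1 := by simp [C]
    have h3 := (ENNReal.continuous_ofReal.tendsto (C 0)).comp h1.tendsto
    rw [h2, ENNReal.ofReal_one] at h3
    exact h3.mono_left nhdsWithin_le_nhds
  have hCT : Tendsto (fun ε => ENNReal.ofReal (C ε) * worstRatio k ValueDist.Triangular ε)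
      (𝓝[>] 0) (𝓝 L) := by
    have := ENNReal.Tendsto.mul hC (Or.inl one_ne_zero) hT (Or.inr ENNReal.one_ne_top)
    rwa [one_mul] at this
  refine tendsto_of_tendsto_of_tendsto_of_le_of_le' hT hCT (Eventually.of_forall hle) ?_
  have hb : 0 < 1 / (γ * k * logUnits k) := by positivity
  filter_upwards [Ioo_mem_nhdsGT hb] with ε hε
  refine iSup_le fun n => iSup_le fun F => iSup_le fun hF => iSup_le fun hlarge => ?_
  obtain ⟨m, G, _, hG, hGl, hr⟩ := exists_triangular_ratio hk hgap hε.1 hε.2 hF hlarge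
  refine hr.trans ?_
  gcongr
  exact le_iSup_of_le m (le_iSup_of_le G (le_iSup_of_le hG (le_iSup_of_le hGl le_rfl)))

end AnonPricing

theorem mainTheorem2 :
    (∃ γ : ℝ, 0 < γ ∧ ∀ k : ℕ, 1 ≤ k → GapBound k γ) ∧
    (∀ (k : ℕ) (γ : ℝ), 1 ≤ k → GapBound k γ →
      ∀ ε : ℝ, 0 < ε → ε < 1 / (γ * k * logUnits k) →
      ∀ (n : ℕ) (F : Fin n → ValueDist), (∀ i, (F i).QuasiRegular) → IsLarge k ε F →
        ∃ (m : ℕ) (G : Fin m → ValueDist), 0 < m ∧ (∀ j, (G j).Triangular) ∧ IsLarge k ε G ∧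
          ratio k F ≤
            ENNReal.ofReal
              ((1 + ε * γ * k * logUnits k) / (1 - ε * γ * k * logUnits k) ^ 2) * ratio k G) ∧
    (∀ k : ℕ, 1 ≤ k → ∃ L : ℝ≥0∞, L ≠ ⊤ ∧
      Tendsto (worstRatio k ValueDist.QuasiRegular) (𝓝[>] 0) (𝓝 L) ∧
      Tendsto (worstRatio k ValueDist.Triangular) (𝓝[>] 0) (𝓝 L)) :=
  ⟨exists_gapBound,
    fun _ _ hk hγ _ hε hε1 _ _ hF hlarge => exists_triangular_ratio hk hγ hε hε1 hF hlarge,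
    fun _ hk => exists_tendsto_worstRatio hk⟩
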